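/- **Setting.** Let $G=\mathrm{SL}(2,\mathbb R)$ act on the upper half-plane $\mathbb H$, and write $n(x)=\begin{pmatrix}1&x\\0&1\end{pmatrix}$, $a(y)=\mathrm{diag}(y^{1/2},y^{-1/2})$, $k(\theta)=\begin{pmatrix}\cos\frac\theta2&-\sin\frac\theta2\\ \sin\frac\theta2&\cos\frac\theta2\end{pmatrix}$. For $g\in G$ let $\boldsymbol c(g)$ be the oriented geodesic $t\mapsto g\,\mathrm{diag}(t,t^{-1})\,\mathrm i$ ($t>0$), with backward and forward endpoints $\boldsymbol c^-=g(0)$, $\boldsymbol c^+=g(\infty)$; $\overline{\boldsymbol c}$ is $\boldsymbol c$ with reversed orientation. We call $\boldsymbol c$ positively oriented if $\boldsymbol c^\pm\in\mathbb R$ and $\boldsymbol c^-<\boldsymbol c^+$; its top $z_{\boldsymbol c}$ is then its point of largest imaginary part. Let $\Gamma<G$ be a lattice with $\Gamma\cap\{\pm n(x):x\in\mathbb R\}=\{\pm n(k):k\in\mathbb Z\}$ (so $-I\in\Gamma$ and there is a cusp of width one at $\infty$). Let $h\ge1$ and let $\boldsymbol c_l=\boldsymbol c(g_l)$, $l=1,\dots,h$,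 be positively oriented geodesics, no two of them $\Gamma$-equivalent as oriented geodesics, each projecting to a closed geodesic in $\Gamma\backslash\mathbb H$. Let $\Gamma_{\boldsymbol c_l}=\Gamma\cap\{\pm g_l\,\mathrm{diag}(t,t^{-1})g_l^{-1}:t>0\}$ be the stabiliser of $\boldsymbol c_l$, let $\varepsilon_l>1$ be the smallest $t>1$ with $\pm g_l\,\mathrm{diag}(t,t^{-1})g_l^{-1}\in\Gamma$, and put $\ell=2\sum_l\log\varepsilon_l$, $\kappa_\Gamma=\ell/(2\pi\,\mathrm{vol}_{\mathbb H}(\Gamma\backslash\mathbb H))$. For $B\subset\mathbb H$ let $$\mathcal N_B(g)=\sum_{l=1}^h\#\{\gamma\in\Gamma/\Gamma_{\boldsymbol c_l}:\ g^{-1}\gamma\boldsymbol c_l\text{ is positively oriented and }z_{g^{-1}\gamma\boldsymbol c_l}\in B\},$$ a function on $\Gamma\backslash G$. For $\alpha\ge1$ let $\nu_{\alpha,\infty}$ be the measure on $\Gamma\backslash G$ with $$\int f\,d\nu_{\alpha,\infty}=\frac1{2\pi\,\mathrm{vol}_{\mathbb H}(\Gamma\backslash\mathbb H)}\sum_{l=1}^h\int_\alpha^\infty\!\int_1^{\varepsilon_l^2}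 f\big(\Gamma g_l\,a(s)k(-\tfrac\pi2)a(v^{-1})\big)\frac{ds}{s}\frac{dv}{v^2},$$ let $\widehat\nu_{\alpha,\infty}=\kappa_\Gamma^{-1}\alpha\,\nu_{\alpha,\infty}$, and let $\mathbb E\Theta^0_{\alpha,\infty}(B)=\int_{\Gamma\backslash G}\mathcal N_B\,d\widehat\nu_{\alpha,\infty}$ be the intensity of the process of tops $z_{g^{-1}\gamma\boldsymbol c_l}$ with $g$ distributed according to $\widehat\nu_{\alpha,\infty}$. Put $B_{I,\alpha,\infty}=\{u+\mathrm iv\in\mathbb H:u\in I,\ v\ge\alpha\}$. For $q\in\mathbb R\setminus\{\pm1\}$ and $v_1,v_2\in\mathbb R$ let $$H_+(q,v_1,v_2)=\int_{-1}^{1}F\,ds,\qquad H_-(q,v_1,v_2)=\Big(\int_{-\infty}^{-1}+\int_1^\infty\Big)F\,ds,$$ $$F(s)=\chi_{[1,\infty)}\Big(2v_1\tfrac{s+q}{s^2+2qs+1}\Big)\,\chi_{[1,\infty)}\Big(v_2\tfrac{1-s^2}{s^2+2qs+1}\Big)\,\Big|\tfrac{s^2+2qs+1}{(s+q)(s^2-1)}\Big|.$$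 For $\gamma\in\Gamma$ let $q(\gamma,l_1,l_2)=\frac{r+1}{r-1}$, where $r$ is the cross-ratio $$r=\frac{((\gamma\boldsymbol c_{l_2})^+-\boldsymbol c_{l_1}^-)((\gamma\boldsymbol c_{l_2})^--\boldsymbol c_{l_1}^+)}{((\gamma\boldsymbol c_{l_2})^+-\boldsymbol c_{l_1}^+)((\gamma\boldsymbol c_{l_2})^--\boldsymbol c_{l_1}^-)}.$$ Let $\mathcal D_{l_1,l_2}$ be the set of double cosets $\gamma\in\Gamma_{\boldsymbol c_{l_1}}\backslash\Gamma/\Gamma_{\boldsymbol c_{l_2}}$ with $\gamma\boldsymbol c_{l_2}\ne\boldsymbol c_{l_1},\overline{\boldsymbol c_{l_1}}$. **Proposition.** (i) For all $\alpha_1,\alpha_2\in[1,\infty)$ there is an even continuous function $W_{\alpha_1,\alpha_2}:\mathbb R\to\mathbb R_{\ge0}$ given for $v\ne0$ by $$W_{\alpha_1,\alpha_2}(v)=\frac{\alpha_1}{\ell v^2}\sum_{l_1,l_2=1}^h\ \sum_{\gamma\in\mathcal D_{l_1,l_2}}H_{\mathrm{sign}(g_{l_1}^{-1}\gamma g_{l_2}(0))}\big(q(\gamma,l_1,l_2),v\alpha_1^{-1},v\alpha_2^{-1}\big),$$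 the series being absolutely convergent, such that for every finite interval $I$ $$\mathbb E\Theta^0_{\alpha_1,\infty}(B_{I,\alpha_2,\infty})=\min\Big\{1,\frac{\alpha_1}{\alpha_2}\Big\}\delta_0(I)+\int_I W_{\alpha_1,\alpha_2}(v)\,dv .$$ If $\alpha_1=\alpha_2=\alpha$, then, with an absolutely convergent series, $$W_{\alpha,\alpha}(0)=\frac1{\alpha\ell}\sum_{l_1,l_2=1}^h\ \sum_{\substack{\gamma\in\mathcal D_{l_1,l_2}\\ q=q(\gamma,l_1,l_2)>1}}\frac{q-\sqrt{q^2-1}}{2\sqrt{q^2-1}} .$$ (ii) For $q\ne\pm1$ the integrals $H_\pm(q,v_1,v_2)$ converge absolutely. For $v_1=v_2=v$ they are $$H_+(q,v,v)=\begin{cases}0& q<-1,\\ 0& -1<q<1,\ v\le\sqrt{2-2q},\\ h_q(s_1)-h_q(s_2)& -1<q<1,\ v>\sqrt{2-2q},\\ h_q(s_1)-h_q(-q+\sqrt{q^2-1})& q>1,\end{cases}$$ $$H_-(q,v,v)=\begin{cases}0& q<-1,\ |v|\le\sqrt{2-2q},\\ h_q(s_1)-h_q(s_2)& q<-1,\ |v|>\sqrt{2-2q},\\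 h_q(s_1)-h_q(s_2)& -1<q<1,\ v<-\sqrt{2-2q},\\ 0& -1<q<1,\ v\ge-\sqrt{2-2q},\\ h_q(-q-\sqrt{q^2-1})-h_q(s_2)& q>1,\end{cases}$$ where $h_q(s)=\log\frac{s+q}{1-s^2}$, $s_1=s_1(q,v)=\frac{-q+\sqrt{v^2+q^2-1}}{v+1}$ and $s_2=s_2(q,v)=v-q-\sqrt{v^2+q^2-1}$. (At $v=-1$, where $s_1$ is needed only for $q>0$, it stands for its limit $-1/q$.) -/

import Mathlib

open MeasureTheory Set UpperHalfPlane
open scoped MatrixGroups ENNReal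

noncomputable section

namespace GeodesicLines

/-! ### The group `G = SL(2, ℝ)` and its one-parameter subgroups -/

/-- The Borel σ-algebra of `SL(2, ℝ)`. -/
instance instMeasurableSpaceSL : MeasurableSpace SL(2, ℝ) := borel SL(2, ℝ)

instance instBorelSpaceSL : BorelSpace SL(2, ℝ) := ⟨rfl⟩

/-- The upper triangular unipotent matrix `n(x)`. -/
def nMat (x : ℝ) : SL(2, ℝ) := ⟨!![1, x; 0, 1], by simp⟩

/-- The diagonal matrix with entries `t, t⁻¹` (only used for `t > 0`; it is `1` at `t = 0`). -/
def dMat (t : ℝ) : SL(2, ℝ) :=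
  if ht : t = 0 then 1 else ⟨!![t, 0; 0, t⁻¹], by simp [ht]⟩

/-- `a(y) = diag(√y, 1/√y)`, for `y > 0`. -/
def aMat (y : ℝ) : SL(2, ℝ) := dMat (√y)

/-- The rotation `k(θ)`, with half angles as entries. -/
def kMat (θ : ℝ) : SL(2, ℝ) :=
  ⟨!![Real.cos (θ / 2), -Real.sin (θ / 2); Real.sin (θ / 2), Real.cos (θ / 2)], by
    simp only [Matrix.det_fin_two_of]; nlinarith [Real.sin_sq_add_cos_sq (θ / 2)]⟩

/-- The matrix exchanging `0` and `∞`; right multiplication by it reverses a geodesic. -/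
def revMat : SL(2, ℝ) := ⟨!![0, -1; 1, 0], by simp⟩

theorem dMat_val {t : ℝ} (ht : t ≠ 0) :
    (dMat t : Matrix (Fin 2) (Fin 2) ℝ) = !![t, 0; 0, t⁻¹] := by
  simp [dMat, ht]

theorem dMat_mul {s t : ℝ} (hs : s ≠ 0) (ht : t ≠ 0) : dMat s * dMat t = dMat (s * t) := by
  apply Subtype.ext
  rw [Matrix.SpecialLinearGroup.coe_mul, dMat_val hs, dMat_val ht, dMat_val (mul_ne_zero hs ht)]
  simp [mul_comm]

theorem dMat_one : dMat 1 = 1 := by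
  apply Subtype.ext
  rw [dMat_val one_ne_zero]
  simp [Matrix.one_fin_two]

theorem dMat_inv {t : ℝ} (ht : t ≠ 0) : (dMat t)⁻¹ = dMat t⁻¹ := by
  rw [inv_eq_iff_mul_eq_one, dMat_mul ht (inv_ne_zero ht), mul_inv_cancel₀ ht, dMat_one]

/-! ### Oriented geodesics

The oriented geodesic `c(g)` is the curve `t ↦ g diag(t, t⁻¹) i`, `t > 0`; so `γ c(g) = c(γ g)`. -/

/-- The set of points of the geodesic `c(g)`. -/
def geodesic (g : SL(2, ℝ)) : Set ℍ := {z | ∃ t : ℝ, 0 < t ∧ z = (g * dMat t) • UpperHalfPlane.I}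

/-- `c(g) = c(g')` as oriented geodesics: `g` and `g'` differ, up to sign, by a
translation along the geodesic. -/
def SameGeodesic (g g' : SL(2, ℝ)) : Prop :=
  ∃ t : ℝ, 0 < t ∧ (g' = g * dMat t ∨ g' = -(g * dMat t))

/-- The backward endpoint `c(g)⁻ = g(0) = b/d` (if `d ≠ 0`, so that it is finite). -/
def backwardEnd (g : SL(2, ℝ)) : ℝ := g 0 1 / g 1 1

/-- The forward endpoint `c(g)⁺ = g(∞) = a/c` (if `c ≠ 0`, so that it is finite). -/
def forwardEnd (g : SL(2, ℝ)) : ℝ := g 0 0 / g 1 0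

/-- Both endpoints are finite and the geodesic runs from left to right. -/
def IsPositivelyOriented (g : SL(2, ℝ)) : Prop :=
  g 1 0 ≠ 0 ∧ g 1 1 ≠ 0 ∧ backwardEnd g < forwardEnd g

/-- `z` is the point of largest imaginary part on `c(g)`. -/
def IsTop (g : SL(2, ℝ)) (z : ℍ) : Prop := z ∈ geodesic g ∧ ∀ w ∈ geodesic g, w.im ≤ z.im

/-! ### The lattice -/

/-- The group of isometries of `ℍ` induced by `Γ` (that is, `Γ / {±1}` when `-1 ∈ Γ`). -/
def isometryGroup (Γ : Subgroup SL(2, ℝ)) : Subgroup (Equiv.Perm ℍ) :=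
  Γ.map (MulAction.toPermHom SL(2, ℝ) ℍ)

/-- `Γ` is discrete, and `Γ \ ℍ` has finite hyperbolic area. -/
structure IsLattice (Γ : Subgroup SL(2, ℝ)) : Prop where
  discrete : DiscreteTopology Γ
  hasFundamentalDomain : HasFundamentalDomain (isometryGroup Γ) ℍ
  covolume_lt_top : covolume (isometryGroup Γ) ℍ < ⊤

/-- The hyperbolic area of `Γ \ ℍ`. -/
def area (Γ : Subgroup SL(2, ℝ)) : ℝ := (covolume (isometryGroup Γ) ℍ).toReal

/-- `Γ ∩ {± n(x) : x ∈ ℝ} = {± n(k) : k ∈ ℤ}`: there is a cusp of width one at `∞`, and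
`-1 ∈ Γ` (take `k = 0`). -/
def HasCuspOfWidthOne (Γ : Subgroup SL(2, ℝ)) : Prop :=
  {γ : SL(2, ℝ) | γ ∈ Γ ∧ ∃ x : ℝ, γ = nMat x ∨ γ = -nMat x} =
    {γ : SL(2, ℝ) | ∃ k : ℤ, γ = nMat k ∨ γ = -nMat k}

/-- The stabiliser in `Γ` of the oriented geodesic `c(g)`. -/
def stab (Γ : Subgroup SL(2, ℝ)) (g : SL(2, ℝ)) : Subgroup Γ where
  carrier := {γ | ∃ t : ℝ, 0 < t ∧
    ((γ : SL(2, ℝ)) = g * dMat t * g⁻¹ ∨ (γ : SL(2, ℝ)) = -(g * dMat t * g⁻¹))}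
  one_mem' := ⟨1, one_pos, Or.inl (by simp [dMat_one])⟩
  mul_mem' := by
    rintro x y ⟨s, hs, hx⟩ ⟨t, ht, hy⟩
    have key : g * dMat s * g⁻¹ * (g * dMat t * g⁻¹) = g * dMat (s * t) * g⁻¹ := by
      rw [← dMat_mul hs.ne' ht.ne']; group
    refine ⟨s * t, mul_pos hs ht, ?_⟩
    rcases hx with hx | hx <;> rcases hy with hy | hy <;>
      simp only [Subgroup.coe_mul, hx, hy, neg_mul, mul_neg, neg_neg, key, true_or, or_true]
  inv_mem' := by
    rintro x ⟨s, hs, hx⟩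
    have key : (g * dMat s * g⁻¹)⁻¹ = g * dMat s⁻¹ * g⁻¹ := by
      rw [← dMat_inv hs.ne']; group
    refine ⟨s⁻¹, inv_pos.mpr hs, ?_⟩
    rcases hx with hx | hx
    · exact Or.inl (by rw [Subgroup.coe_inv, hx, key])
    · exact Or.inr (by rw [Subgroup.coe_inv, hx, inv_neg, key])

/-- The factors `t > 1` of the translations along `c(g)` that, up to sign, belong to `Γ`; the
translation with factor `t` moves points of `c(g)` by the hyperbolic distance `2 log t`. -/
def periods (Γ : Subgroup SL(2, ℝ)) (g : SL(2, ℝ)) : Set ℝ :=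
  {t | 1 < t ∧ (g * dMat t * g⁻¹ ∈ Γ ∨ -(g * dMat t * g⁻¹) ∈ Γ)}

/-- `c(g)` projects to a closed geodesic in `Γ \ ℍ`. -/
def IsClosedGeodesic (Γ : Subgroup SL(2, ℝ)) (g : SL(2, ℝ)) : Prop := (periods Γ g).Nonempty

/-- `ε > 1`: the smallest period, so that `2 log ε` is the length of the closed geodesic. -/
def epsilon (Γ : Subgroup SL(2, ℝ)) (g : SL(2, ℝ)) : ℝ := sInf (periods Γ g)

/-- The total length `ℓ` of the closed geodesics. -/
def totalLength {h : ℕ} (Γ : Subgroup SL(2, ℝ)) (g : Fin h → SL(2, ℝ)) : ℝ :=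
  2 * ∑ l, Real.log (epsilon Γ (g l))

/-- `κ = ℓ / (2π area(Γ \ ℍ))`. -/
def kappa {h : ℕ} (Γ : Subgroup SL(2, ℝ)) (g : Fin h → SL(2, ℝ)) : ℝ :=
  totalLength Γ g / (2 * Real.pi * area Γ)

/-! ### The point process of tops of geodesics and its intensity -/

/-- The space `Γ \ G`, with the quotient of the Borel σ-algebra of `G`. -/
abbrev QuotSpace (Γ : Subgroup SL(2, ℝ)) : Type := MulAction.orbitRel.Quotient Γ SL(2, ℝ)

/-- The classes `γ Γ_c` in `Γ / Γ_c`, `c = c(g₀)`, such that `u⁻¹ γ c` is positively oriented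
and has its top in `B`. -/
def countSet (Γ : Subgroup SL(2, ℝ)) (g₀ : SL(2, ℝ)) (B : Set ℍ) (u : SL(2, ℝ)) :
    Set (Γ ⧸ stab Γ g₀) :=
  {x | ∃ γ : Γ, (γ : Γ ⧸ stab Γ g₀) = x ∧ IsPositivelyOriented (u⁻¹ * γ * g₀) ∧
    ∃ z ∈ B, IsTop (u⁻¹ * γ * g₀) z}

theorem countSet_smul (Γ : Subgroup SL(2, ℝ)) (g₀ : SL(2, ℝ)) (B : Set ℍ) (δ : Γ)
    (u : SL(2, ℝ)) :
    countSet Γ g₀ B (δ • u) = (fun x => δ • x) '' countSet Γ g₀ B u := by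
  have e : ∀ γ : Γ, (δ • u)⁻¹ * ((δ * γ : Γ) : SL(2, ℝ)) * g₀ = u⁻¹ * γ * g₀ := by
    intro γ
    simp only [Subgroup.smul_def, smul_eq_mul, Subgroup.coe_mul]
    group
  ext x
  constructor
  · rintro ⟨γ, rfl, h⟩
    refine ⟨((δ⁻¹ * γ : Γ) : Γ ⧸ stab Γ g₀), ⟨δ⁻¹ * γ, rfl, ?_⟩, ?_⟩
    · rw [← e (δ⁻¹ * γ), mul_inv_cancel_left]; exact h
    · change ((δ * (δ⁻¹ * γ) : Γ) : Γ ⧸ stab Γ g₀) = _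
      rw [mul_inv_cancel_left]
  · rintro ⟨_, ⟨γ, rfl, h⟩, rfl⟩
    exact ⟨δ * γ, rfl, by rw [e γ]; exact h⟩

/-- The counting function `𝒩_B` on `G`. -/
def countG {h : ℕ} (Γ : Subgroup SL(2, ℝ)) (g : Fin h → SL(2, ℝ)) (B : Set ℍ)
    (u : SL(2, ℝ)) : ℝ≥0∞ :=
  ∑ l, ((countSet Γ (g l) B u).encard : ℝ≥0∞)

theorem countG_smul {h : ℕ} (Γ : Subgroup SL(2, ℝ)) (g : Fin h → SL(2, ℝ)) (B : Set ℍ) (δ : Γ)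
    (u : SL(2, ℝ)) : countG Γ g B (δ • u) = countG Γ g B u := by
  unfold countG
  refine Finset.sum_congr rfl fun l _ => ?_
  rw [countSet_smul, (MulAction.injective δ).encard_image]

/-- The counting function `𝒩_B` on `Γ \ G`. -/
def count {h : ℕ} (Γ : Subgroup SL(2, ℝ)) (g : Fin h → SL(2, ℝ)) (B : Set ℍ) :
    QuotSpace Γ → ℝ≥0∞ :=
  Quotient.lift (countG Γ g B) (by
    rintro _ b ⟨δ, rfl⟩
    exact countG_smul Γ g B δ b)

/-- The measure `(ds / s) (dv / v²)` on `[1, ε²) × [α, ∞)`. -/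
def paramMeasure (ε α : ℝ) : Measure (ℝ × ℝ) :=
  (volume.restrict (Ico 1 (ε ^ 2) ×ˢ Ici α)).withDensity
    fun p => ENNReal.ofReal (1 / (p.1 * p.2 ^ 2))

/-- The measure `ν_{α,∞}` on the section of the horocycle flow in `Γ \ G`. -/
def sectionMeasure {h : ℕ} (Γ : Subgroup SL(2, ℝ)) (g : Fin h → SL(2, ℝ)) (α : ℝ) :
    Measure (QuotSpace Γ) :=
  ∑ l, ENNReal.ofReal (1 / (2 * Real.pi * area Γ)) •
    (paramMeasure (epsilon Γ (g l)) α).map fun p =>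
      (Quotient.mk'' (g l * aMat p.1 * kMat (-(Real.pi / 2)) * aMat p.2⁻¹) : QuotSpace Γ)

/-- The measure `ν_{α,∞}` normalised to a probability measure. -/
def sectionProb {h : ℕ} (Γ : Subgroup SL(2, ℝ)) (g : Fin h → SL(2, ℝ)) (α : ℝ) :
    Measure (QuotSpace Γ) :=
  ENNReal.ofReal ((kappa Γ g)⁻¹ * (1 / α)⁻¹) • sectionMeasure Γ g α

/-- `B_{I,α,∞}`. -/
def strip (I : Set ℝ) (α : ℝ) : Set ℍ := {z | z.re ∈ I ∧ α ≤ z.im}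

/-- The intensity `𝔼 Θ⁰_{α,∞}(B)`: the mean of `𝒩_B` under the probability measure above. -/
def intensity {h : ℕ} (Γ : Subgroup SL(2, ℝ)) (g : Fin h → SL(2, ℝ)) (α : ℝ) (B : Set ℍ) :
    ℝ≥0∞ :=
  ∫⁻ x, count Γ g B x ∂(sectionProb Γ g α)

/-! ### The density -/

/-- The cross-ratio of the endpoints of `c(g₁)` and `c(g₂)` (in the cases used below, all
endpoints are finite: no endpoint of a closed geodesic is a cusp). -/
def crossRatio (g₁ g₂ : SL(2, ℝ)) : ℝ :=
  ((forwardEnd g₂ - backwardEnd g₁) * (backwardEnd g₂ - forwardEnd g₁)) /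
    ((forwardEnd g₂ - forwardEnd g₁) * (backwardEnd g₂ - backwardEnd g₁))

/-- `q = (r + 1) / (r - 1)` with `r` the cross-ratio. -/
def qParam (g₁ g₂ : SL(2, ℝ)) : ℝ := (crossRatio g₁ g₂ + 1) / (crossRatio g₁ g₂ - 1)

/-- The characteristic function of `[1, ∞)`. -/
def chi (x : ℝ) : ℝ := (Ici (1 : ℝ)).indicator (fun _ => 1) x

/-- The common integrand of `H_+` and `H_-`. -/
def integrand (q v₁ v₂ s : ℝ) : ℝ :=
  chi (2 * v₁ * ((s + q) / (s ^ 2 + 2 * q * s + 1))) *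
    chi (v₂ * ((1 - s ^ 2) / (s ^ 2 + 2 * q * s + 1))) *
    |(s ^ 2 + 2 * q * s + 1) / ((s + q) * (s ^ 2 - 1))|

/-- `H_+`. -/
def Hplus (q v₁ v₂ : ℝ) : ℝ := ∫ s in Ioo (-1) 1, integrand q v₁ v₂ s

/-- `H_-`. -/
def Hminus (q v₁ v₂ : ℝ) : ℝ :=
  (∫ s in Iio (-1), integrand q v₁ v₂ s) + ∫ s in Ioi 1, integrand q v₁ v₂ s

/-- `H_σ` with `σ` the sign of `x`. -/
def Hsign (x q v₁ v₂ : ℝ) : ℝ := if 0 < x then Hplus q v₁ v₂ else Hminus q v₁ v₂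

/-- The double cosets in `Γ_{c₁} \ Γ / Γ_{c₂}`, `c_i = c(g_i)`, for which `γ c₂` is neither
`c₁` nor `c₁` reversed. Here and below, `x.out` is a representative `γ` of the double coset
`x`; nothing depends on its choice. -/
def AdmissibleCoset (Γ : Subgroup SL(2, ℝ)) (g₁ g₂ : SL(2, ℝ)) : Type :=
  {x : DoubleCoset.Quotient (stab Γ g₁ : Set Γ) (stab Γ g₂ : Set Γ) //
    ¬ SameGeodesic ((x.out : Γ) * g₂) g₁ ∧ ¬ SameGeodesic ((x.out : Γ) * g₂) (g₁ * revMat)}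

/-- A representative in `G` of a double coset. -/
def AdmissibleCoset.rep {Γ : Subgroup SL(2, ℝ)} {g₁ g₂ : SL(2, ℝ)}
    (x : AdmissibleCoset Γ g₁ g₂) : SL(2, ℝ) := ((Quotient.out x.1 : Γ) : SL(2, ℝ))

/-- `q(γ, c₁, c₂)`. -/
def AdmissibleCoset.q {Γ : Subgroup SL(2, ℝ)} {g₁ g₂ : SL(2, ℝ)}
    (x : AdmissibleCoset Γ g₁ g₂) : ℝ := qParam g₁ (x.rep * g₂)

/-- The term `H_{sign(g₁⁻¹ γ g₂ (0))}(q, v₁, v₂)` of the series for the density. -/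
def AdmissibleCoset.term {Γ : Subgroup SL(2, ℝ)} {g₁ g₂ : SL(2, ℝ)}
    (x : AdmissibleCoset Γ g₁ g₂) (v₁ v₂ : ℝ) : ℝ :=
  Hsign (backwardEnd (g₁⁻¹ * x.rep * g₂)) x.q v₁ v₂

/-- The term of the double coset in the value of the density at the origin. -/
def AdmissibleCoset.originTerm {Γ : Subgroup SL(2, ℝ)} {g₁ g₂ : SL(2, ℝ)}
    (x : AdmissibleCoset Γ g₁ g₂) : ℝ :=
  if 1 < x.q then (x.q - √(x.q ^ 2 - 1)) / (2 * √(x.q ^ 2 - 1)) else 0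

/-- `h_q(s)`. -/
def hFun (q s : ℝ) : ℝ := Real.log ((s + q) / (1 - s ^ 2))

/-- `s₁(q, v)`, with its limit `-1/q` (for `q > 0`) at the removable singularity `v = -1`. -/
def s₁ (q v : ℝ) : ℝ := if v = -1 then -1 / q else (-q + √(v ^ 2 + q ^ 2 - 1)) / (v + 1)

/-- `s₂(q, v)`. -/
def s₂ (q v : ℝ) : ℝ := v - q - √(v ^ 2 + q ^ 2 - 1)

end GeodesicLines

end

open GeodesicLines

/-!
The intensity counts, along each section `s ↦ g₁ a(s) k(-π/2) a(v⁻¹)` over one period of the closed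
geodesic `c₁ = c(g₁)`, the cosets in `Γ / Γ_{c₂}` whose geodesic has its top in the strip
(`intensity_eq`, `lintegral_encard`). Every coset that sends `c₂` neither to `c₁` nor to its reverse
is uniquely of the form `δⁿ γ`, with `δ` the generator of `Γ_{c₁}` and `γ` the representative of an
admissible double coset (`AdmissibleCoset.coset_injective`, `AdmissibleCoset.mem_range_coset`). The
sum over `n` unfolds the period into the whole geodesic (`tsum_cellMass`), so that each double coset
contributes one integral over `s > 0`, `v ≥ α₁`. The coset that sends `c₂` to `c₁` has its top
straight above `0`, and gives the point mass (`cellMass_one`); the reversed geodesic is never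
counted (`cellMass_eq_zero_of_rev`).

For a double coset with matrix `m = g₁⁻¹ γ g₂` with entries `a, b, c, d` the parameter `q` is
`ad + bc` (`qParam_eq_matQ`). All four entries are nonzero: a common endpoint of two closed geodesics
would let one translation contract conjugates of the other, against discreteness
(`entry_01_eq_zero`). Replacing the height `v` by the real part `w` of the top, and `s` by its image
under the Möbius transformation that sends `0`, `∞`, `b / d` to `1`, `-1`, `0`, turns the integral
into `∫ H_±(q, w / α₁, w / α₂) / w² dw` over the interval (`lintegral_height`, `lintegral_level`,
`lintegral_topSet`).

The integrals `H_±` become explicit in the variable `ρ = 2 (s + q) / (1 - s²)`, in which the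
integrand is `dρ / ρ` and the characteristic functions describe the arc
`0 < ρ² - 2qρ + 1 ≤ min (v₁² ρ²) v₂²` (`integral_integrand_eq`, `Hplus_eq`, `Hminus_eq`). For equal
heights its endpoints are roots of a quadratic, which correspond to `s₁` and `s₂` (`Hplus_self`,
`Hminus_self`). The same description shows that each term of the density extends continuously to
`0`: for `q < 1` the arc is empty near `0`, and for `q > 1` its mass is of order `w²`
(`tendsto_arcMass_Ioi`, `continuous_termDensity`). It also bounds the terms by a multiple of
`(1 + |q|)⁻²` for large `|q|` (`termDensity_le`, `summable_termBound`).

The sum of `(1 + |q|)⁻²` over the double cosets converges. The stabilisers balance the entries of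
`m`, so that each double coset has a representative with `normSq` at most a multiple of `1 + |q|`
(`exists_normSq_le`), and `∑ normSq⁻²` over `Γ` is a Poincaré series with exponent `2`, which is
compared with the integral of `exp (-2 d(z, i))` over the half-plane (`summable_inv_normSq_sq`,
`AdmissibleCoset.summable_matQ`). The density is therefore a locally uniform limit of continuous
functions. It is even since the terms with `|q| > 1` are even, while for `|q| < 1`, where the
geodesics intersect, the inversion of double cosets exchanges the pair and the sign of `H_±`, which
amounts to a reflection (`pairDensity_neg_add`).
-/

noncomputable section

namespace GeodesicLines

open Filter Topology

/-! ### The integrals `H_±` -/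

/-- The set of `s` on which both characteristic functions in the integrand equal one. -/
def activeSet (q v₁ v₂ : ℝ) : Set ℝ :=
  {s | 1 ≤ 2 * v₁ * ((s + q) / (s ^ 2 + 2 * q * s + 1)) ∧
    1 ≤ v₂ * ((1 - s ^ 2) / (s ^ 2 + 2 * q * s + 1))}

theorem integrand_eq_indicator (q v₁ v₂ : ℝ) :
    integrand q v₁ v₂ = (activeSet q v₁ v₂).indicator
      fun s => |(s ^ 2 + 2 * q * s + 1) / ((s + q) * (s ^ 2 - 1))| := by
  ext s
  unfold integrand chi activeSet
  by_cases h1 : 1 ≤ 2 * v₁ * ((s + q) / (s ^ 2 + 2 * q * s + 1)) <;>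
  by_cases h2 : 1 ≤ v₂ * ((1 - s ^ 2) / (s ^ 2 + 2 * q * s + 1)) <;>
  simp [indicator, h1, h2]

theorem integrand_nonneg (q v₁ v₂ s : ℝ) : 0 ≤ integrand q v₁ v₂ s := by
  rw [integrand_eq_indicator]
  exact indicator_nonneg (fun _ _ => abs_nonneg _) s

theorem measurableSet_activeSet (q v₁ v₂ : ℝ) : MeasurableSet (activeSet q v₁ v₂) := by
  have e : activeSet q v₁ v₂ =
      {s : ℝ | 1 ≤ 2 * v₁ * ((s + q) / (s ^ 2 + 2 * q * s + 1))} ∩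
        {s : ℝ | 1 ≤ v₂ * ((1 - s ^ 2) / (s ^ 2 + 2 * q * s + 1))} := rfl
  rw [e]
  exact (measurableSet_le (by fun_prop) (by fun_prop)).inter
    (measurableSet_le (by fun_prop) (by fun_prop))

theorem measurable_integrand (q v₁ v₂ : ℝ) : Measurable (integrand q v₁ v₂) := by
  rw [integrand_eq_indicator]
  exact Measurable.indicator (by fun_prop) (measurableSet_activeSet q v₁ v₂)

theorem activeSet_ne {q v₁ v₂ s : ℝ} (hs : s ∈ activeSet q v₁ v₂) :
    s ^ 2 + 2 * q * s + 1 ≠ 0 ∧ s + q ≠ 0 ∧ 1 - s ^ 2 ≠ 0 := by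
  obtain ⟨h1, h2⟩ := hs
  refine ⟨?_, ?_, ?_⟩ <;> intro h
  · rw [h] at h1; norm_num at h1
  · rw [h] at h1; norm_num at h1
  · rw [h] at h2; norm_num at h2

/-- On the active set `|s² + 2qs + 1|` is at most `2|v₁||s + q|` and at most `|v₂||1 - s²|`. -/
theorem activeSet_le {q v₁ v₂ s : ℝ} (hs : s ∈ activeSet q v₁ v₂) :
    |s ^ 2 + 2 * q * s + 1| ≤ 2 * |v₁| * |s + q| ∧
      |s ^ 2 + 2 * q * s + 1| ≤ |v₂| * |s ^ 2 - 1| := by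
  obtain ⟨hD, -, -⟩ := activeSet_ne hs
  obtain ⟨h1, h2⟩ := hs
  have hD' := abs_pos.mpr hD
  constructor
  · have := h1.trans (le_abs_self _)
    rw [abs_mul, abs_div, abs_mul, abs_two, mul_div_assoc', le_div_iff₀ hD'] at this
    linarith
  · have := h2.trans (le_abs_self _)
    rw [abs_mul, abs_div, mul_div_assoc', le_div_iff₀ hD', abs_sub_comm 1] at this
    linarith

/-- Since `s² + 2qs + 1` is quadratic and `2|v₁||s + q|` linear in `s`, the active set is bounded.
-/
theorem activeSet_bounded (q v₁ v₂ : ℝ) :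
    activeSet q v₁ v₂ ⊆ Icc (-(1 + 2 * |q| + |q| ^ 2 + 2 * |v₁|)) (1 + 2 * |q| + |q| ^ 2 + 2 * |v₁|) := by
  intro s hs
  have h1 := (activeSet_le hs).1
  have e : s ^ 2 + 2 * q * s + 1 = (s + q) ^ 2 - (q ^ 2 - 1) := by ring
  have h2 : |s + q| ^ 2 ≤ 2 * |v₁| * |s + q| + |q| ^ 2 + 1 := by
    rw [sq_abs, sq_abs]
    have := le_abs_self (s ^ 2 + 2 * q * s + 1)
    nlinarith
  have h3 : |s + q| ≤ 1 + |q| + |q| ^ 2 + 2 * |v₁| := by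
    by_contra h
    push Not at h
    nlinarith [abs_nonneg q, abs_nonneg v₁, sq_nonneg |q|, abs_nonneg (s + q)]
  rw [mem_Icc, ← abs_le]
  have : |s| ≤ |s + q| + |q| := by
    calc |s| = |(s + q) - q| := by ring_nf
      _ ≤ _ := abs_sub _ _
  linarith

/-- The integrand is bounded: its poles `±1` and `-q` are at positive distance from the active
set. -/
theorem integrand_bounded {q v₁ v₂ : ℝ} (h1 : q ≠ 1) (h2 : q ≠ -1) :
    ∃ C, ∀ s, integrand q v₁ v₂ s ≤ C := by
  set R := 1 + 2 * |q| + |q| ^ 2 + 2 * |v₁| with hR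
  have hR1 : 1 ≤ R := by
    have := abs_nonneg q
    have := abs_nonneg v₁
    nlinarith
  have hδ : 0 < |q ^ 2 - 1| := by
    rw [abs_pos]
    intro h
    have : (q - 1) * (q + 1) = 0 := by linarith
    rcases mul_eq_zero.mp this with h | h
    · exact h1 (by linarith)
    · exact h2 (by linarith)
  set δ := |q ^ 2 - 1| with hδdef
  set K := R + |q| with hK
  have hK1 : 0 < K := by have := abs_nonneg q; linarith
  refine ⟨4 * |v₁| / δ + 2 * K * |v₂| / δ, fun s => ?_⟩
  rw [integrand_eq_indicator]
  by_cases hs : s ∈ activeSet q v₁ v₂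
  swap
  · rw [indicator_of_notMem hs]; positivity
  rw [indicator_of_mem hs]
  obtain ⟨-, hx, hy⟩ := activeSet_ne hs
  replace hy : s ^ 2 - 1 ≠ 0 := fun h => hy (by linarith)
  obtain ⟨b1, b2⟩ := activeSet_le hs
  have hsR : |s| ≤ R := abs_le.mpr (activeSet_bounded q v₁ v₂ hs)
  have hx' := abs_pos.mpr hx
  have hy' := abs_pos.mpr hy
  rw [abs_div, abs_mul]
  have key : δ ≤ |s ^ 2 - 1| + |s + q| * K := by
    calc δ = |(s ^ 2 - 1) - (s + q) * (s - q)| := by rw [hδdef]; ring_nf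
      _ ≤ |s ^ 2 - 1| + |(s + q) * (s - q)| := abs_sub _ _
      _ ≤ _ := by
        rw [abs_mul]
        gcongr
        calc |s - q| ≤ |s| + |q| := abs_sub _ _
          _ ≤ K := by linarith
  have p1 : 0 ≤ 4 * |v₁| / δ := by positivity
  have p2 : 0 ≤ 2 * K * |v₂| / δ := by positivity
  rcases le_or_gt (δ / 2) |s ^ 2 - 1| with h | h
  · have : |s ^ 2 + 2 * q * s + 1| / (|s + q| * |s ^ 2 - 1|) ≤ 4 * |v₁| / δ := by
      rw [div_le_div_iff₀ (by positivity) hδ]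
      calc |s ^ 2 + 2 * q * s + 1| * δ ≤ (2 * |v₁| * |s + q|) * (2 * |s ^ 2 - 1|) := by
            gcongr; linarith
        _ = _ := by ring
    linarith
  · have : |s ^ 2 + 2 * q * s + 1| / (|s + q| * |s ^ 2 - 1|) ≤ 2 * K * |v₂| / δ := by
      rw [div_le_div_iff₀ (by positivity) hδ]
      calc |s ^ 2 + 2 * q * s + 1| * δ ≤ (|v₂| * |s ^ 2 - 1|) * (2 * (|s + q| * K)) := by
            gcongr; linarith
        _ = _ := by ring
    linarith

theorem integrableOn_integrand {q v₁ v₂ : ℝ} (h1 : q ≠ 1) (h2 : q ≠ -1) (S : Set ℝ) :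
    IntegrableOn (integrand q v₁ v₂) S := by
  obtain ⟨C, hC⟩ := integrand_bounded (v₁ := v₁) (v₂ := v₂) h1 h2
  apply Integrable.integrableOn
  have e : integrand q v₁ v₂ = (Icc (-(1 + 2 * |q| + |q| ^ 2 + 2 * |v₁|))
      (1 + 2 * |q| + |q| ^ 2 + 2 * |v₁|)).indicator (integrand q v₁ v₂) := by
    rw [eq_comm, indicator_eq_self]
    intro s hs
    apply activeSet_bounded q v₁ v₂
    by_contra h
    apply hs
    rw [integrand_eq_indicator, indicator_of_notMem h]
  rw [e, integrable_indicator_iff measurableSet_Icc]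
  apply IntegrableOn.of_bound (by simp) (measurable_integrand q v₁ v₂).aestronglyMeasurable C
  exact Filter.Eventually.of_forall fun s => by
    rw [Real.norm_of_nonneg (integrand_nonneg _ _ _ _)]; exact hC s

/-- The ratio of the heights of the tops of two geodesics in the pencil parametrised by `s`; it is
the exponential of `h_q`, up to a factor two. -/
def ratio (q s : ℝ) : ℝ := 2 * (s + q) / (1 - s ^ 2)

/-- The image of the active set under `ratio`. -/
def arcSet (q v₁ v₂ : ℝ) : Set ℝ :=
  {ρ | 0 < ρ ∧ 0 < ρ ^ 2 - 2 * q * ρ + 1 ∧ ρ ^ 2 - 2 * q * ρ + 1 ≤ v₁ ^ 2 * ρ ^ 2 ∧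
    ρ ^ 2 - 2 * q * ρ + 1 ≤ v₂ ^ 2}

/-- The inverse of `ratio` on the active set of parameters of sign `σ`. -/
def ratioInv (q σ ρ : ℝ) : ℝ := (σ * √(ρ ^ 2 - 2 * q * ρ + 1) - 1) / ρ

section

variable {q v₁ v₂ σ : ℝ}

/-- For `ρ = ratio q s` the square of `1 + ρs` is `ρ² - 2qρ + 1`; on the active set its sign is that
of `v₁` and `v₂`, so that `s` is determined by `ρ`. -/
theorem ratio_mem_arcSet (hσ : σ = 1 ∨ σ = -1) (h1 : 0 < σ * v₁) (h2 : 0 < σ * v₂) {s : ℝ}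
    (hs : s ∈ activeSet q v₁ v₂) :
    ratio q s ∈ arcSet q v₁ v₂ ∧ ratioInv q σ (ratio q s) = s := by
  obtain ⟨hD, hsq, hs1⟩ := activeSet_ne hs
  obtain ⟨a1, a2⟩ := hs
  set D := s ^ 2 + 2 * q * s + 1 with hDdef
  set X := (s + q) / D with hX
  set Y := (1 - s ^ 2) / D with hY
  have hσσ : σ * σ = 1 := by rcases hσ with rfl | rfl <;> norm_num
  have hXpos : 0 < σ * X := by
    by_contra h
    push Not at h
    have : 2 * v₁ * X = 2 * (σ * v₁) * (σ * X) := by linear_combination -(2 * v₁ * X) * hσσ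
    nlinarith
  have hYpos : 0 < σ * Y := by
    by_contra h
    push Not at h
    have : v₂ * Y = (σ * v₂) * (σ * Y) := by linear_combination -(v₂ * Y) * hσσ
    nlinarith
  have hX0 : X ≠ 0 := by rintro h; simp [h] at hXpos
  have hY0 : Y ≠ 0 := by rintro h; simp [h] at hYpos
  have hρ : ratio q s = 2 * X / Y := by
    unfold ratio; rw [hX, hY]; field_simp
  have hρpos : 0 < ratio q s := by
    rw [hρ, ← mul_div_mul_left _ _ (show σ ≠ 0 by rintro rfl; simp at hσσ)]
    apply div_pos _ hYpos
    linarith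
  have hQ : ratio q s ^ 2 - 2 * q * ratio q s + 1 = (1 / Y) ^ 2 := by
    rw [hY, ratio, one_div_div]; field_simp; rw [hDdef]; ring
  have hQ1 : 1 + ratio q s * s = 1 / Y := by
    rw [hY, ratio, one_div_div]; field_simp; rw [hDdef]; ring
  have hsqrt : √(ratio q s ^ 2 - 2 * q * ratio q s + 1) = σ * (1 / Y) := by
    rw [hQ, show (1 / Y) ^ 2 = (σ * (1 / Y)) ^ 2 by rw [mul_pow, sq σ, hσσ, one_mul]]
    apply Real.sqrt_sq
    rw [show σ * (1 / Y) = (σ * σ) * (1 / (σ * Y)) by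
      have : σ ≠ 0 := by rintro rfl; simp at hσσ
      field_simp, hσσ]
    positivity
  refine ⟨⟨hρpos, ?_, ?_, ?_⟩, ?_⟩
  · rw [hQ]; positivity
  · rw [hQ, ← mul_pow, ← sq_abs (1 / Y), ← sq_abs (v₁ * _)]
    gcongr 1
    rw [hρ, abs_div 1 Y, abs_one, ← mul_div_assoc, abs_div _ Y]
    rw [div_le_div_iff_of_pos_right (abs_pos.mpr hY0)]
    calc 1 ≤ 2 * v₁ * X := a1
      _ = v₁ * (2 * X) := by ring
      _ ≤ _ := le_abs_self _
  · rw [hQ, ← sq_abs (1 / Y), ← sq_abs v₂]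
    gcongr 1
    rw [abs_div, abs_one, div_le_iff₀ (abs_pos.mpr hY0), ← abs_mul]
    exact a2.trans (le_abs_self _)
  · rw [ratioInv, hsqrt, ← mul_assoc, hσσ, one_mul, ← hQ1]
    field_simp
    ring

/-- Together with `ratio_mem_arcSet`: `ratio` and `ratioInv` are inverse bijections between the
active set and the arc. -/
theorem ratioInv_mem_activeSet (hq1 : q ≠ 1) (hq2 : q ≠ -1) (hσ : σ = 1 ∨ σ = -1)
    (h1 : 0 < σ * v₁) (h2 : 0 < σ * v₂) {ρ : ℝ}
    (hρ : ρ ∈ arcSet q v₁ v₂) :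
    ratioInv q σ ρ ∈ activeSet q v₁ v₂ ∧ ratio q (ratioInv q σ ρ) = ρ := by
  obtain ⟨h0, hQ, a1, a2⟩ := hρ
  have hσσ : σ * σ = 1 := by rcases hσ with rfl | rfl <;> norm_num
  have hσ0 : σ ≠ 0 := by rintro rfl; simp at hσσ
  set r := √(ρ ^ 2 - 2 * q * ρ + 1) with hr
  have hrpos : 0 < r := Real.sqrt_pos.mpr hQ
  have hr2 : r ^ 2 = ρ ^ 2 - 2 * q * ρ + 1 := Real.sq_sqrt hQ.le
  have hσr2 : (σ * r) ^ 2 = ρ ^ 2 - 2 * q * ρ + 1 := by rw [mul_pow, sq σ, hσσ, one_mul, hr2]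
  -- the sign `σ` selects the root `1 + ρ s = σ r` of `(1 + ρ s)² = ρ² - 2qρ + 1`
  set s := ratioInv q σ ρ with hs
  have hs1 : ρ * s = σ * r - 1 := by rw [hs, ratioInv, ← hr]; field_simp
  have e1 : 1 - s ^ 2 = 2 * (s + q) / ρ := by
    field_simp
    have : ρ * (ρ * (1 - s ^ 2)) = ρ * (2 * (s + q)) := by
      linear_combination (-ρ * s - (σ * r - 1) - 2) * hs1 - hσr2
    have := mul_left_cancel₀ h0.ne' this
    linarith
  have e2 : s ^ 2 + 2 * q * s + 1 = (σ * r) * (1 - s ^ 2) := by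
    rw [← sub_eq_zero]
    have : s ^ 2 + 2 * q * s + 1 - σ * r * (1 - s ^ 2) = 2 * s * (s + q) - ρ * s * (1 - s ^ 2) := by
      linear_combination (1 - s ^ 2) * hs1
    rw [this, e1]; field_simp; ring
  have hne : 1 - s ^ 2 ≠ 0 := by
    intro h
    rw [h] at e2 e1
    have : s + q = 0 := by
      have := e1.symm
      rw [div_eq_zero_iff] at this
      rcases this with h | h <;> linarith
    have hq : q = - s := by linarith
    have hs2 : s ^ 2 = 1 := by linarith
    have : (q - 1) * (q + 1) = 0 := by rw [hq]; linarith
    rcases mul_eq_zero.mp this with h | h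
    · exact hq1 (by linarith)
    · exact hq2 (by linarith)
  have e3 : (1 - s ^ 2) / (s ^ 2 + 2 * q * s + 1) = 1 / (σ * r) := by
    rw [e2]; field_simp
  have e4 : 2 * ((s + q) / (s ^ 2 + 2 * q * s + 1)) = ρ / (σ * r) := by
    rw [e2]
    have : 2 * (s + q) = ρ * (1 - s ^ 2) := by rw [e1]; field_simp
    rw [← mul_div_assoc, this]; field_simp
  have e5 : 1 / (σ * r) = σ / r := by
    rw [div_eq_div_iff (by positivity) hrpos.ne']; linear_combination -r * hσσ
  refine ⟨⟨?_, ?_⟩, ?_⟩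
  · rw [mul_comm 2, mul_assoc, e4, div_eq_mul_one_div, e5, ← mul_assoc, ← mul_div_assoc, le_div_iff₀ hrpos,
      one_mul, show v₁ * ρ * σ = σ * v₁ * ρ by ring]
    apply abs_le_of_sq_le_sq' _ (by positivity) |>.2
    rw [hr2]
    calc _ ≤ _ := a1
      _ = _ := by rw [mul_pow, mul_pow, sq σ, hσσ, one_mul]
  · rw [e3, e5, ← mul_div_assoc, le_div_iff₀ hrpos, one_mul, mul_comm v₂]
    apply abs_le_of_sq_le_sq' _ h2.le |>.2
    rw [hr2, mul_pow, sq σ, hσσ, one_mul]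
    exact a2
  · rw [ratio]
    rw [div_eq_iff hne, e1]; field_simp

theorem ratio_image (hq1 : q ≠ 1) (hq2 : q ≠ -1) (hσ : σ = 1 ∨ σ = -1) (h1 : 0 < σ * v₁)
    (h2 : 0 < σ * v₂) (R : Set ℝ) :
    ratio q '' (activeSet q v₁ v₂ ∩ R) = arcSet q v₁ v₂ ∩ ratioInv q σ ⁻¹' R := by
  ext ρ
  constructor
  · rintro ⟨s, ⟨hs, hR⟩, rfl⟩
    obtain ⟨a, b⟩ := ratio_mem_arcSet hσ h1 h2 hs
    exact ⟨a, by rwa [mem_preimage, b]⟩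
  · rintro ⟨hρ, hR⟩
    obtain ⟨a, b⟩ := ratioInv_mem_activeSet hq1 hq2 hσ h1 h2 hρ
    exact ⟨_, ⟨a, hR⟩, b⟩

theorem hasDerivAt_ratio {s : ℝ} (hs : 1 - s ^ 2 ≠ 0) :
    HasDerivAt (ratio q) (2 * (s ^ 2 + 2 * q * s + 1) / (1 - s ^ 2) ^ 2) s := by
  have h1 : HasDerivAt (fun s => 2 * (s + q)) 2 s := by
    simpa using ((hasDerivAt_id s).add_const q).const_mul 2
  have h2 : HasDerivAt (fun s : ℝ => 1 - s ^ 2) (-(2 * s)) s := by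
    simpa using (hasDerivAt_pow 2 s).const_sub 1
  refine (h1.div h2 hs).congr_deriv ?_
  congr 1
  ring

/-- The substitution `ρ = ratio q s` turns the integrand into `dρ / ρ`. -/
theorem integral_integrand_eq (hq1 : q ≠ 1) (hq2 : q ≠ -1) (hσ : σ = 1 ∨ σ = -1) (h1 : 0 < σ * v₁)
    (h2 : 0 < σ * v₂) {R : Set ℝ} (hR : MeasurableSet R) :
    ∫ s in R, integrand q v₁ v₂ s = ∫ ρ in arcSet q v₁ v₂ ∩ ratioInv q σ ⁻¹' R, ρ⁻¹ := by
  have hm := measurableSet_activeSet q v₁ v₂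
  rw [← ratio_image hq1 hq2 hσ h1 h2, integrand_eq_indicator, setIntegral_indicator hm, inter_comm R]
  rw [integral_image_eq_integral_abs_deriv_smul (hm.inter hR)
    (fun s hs => (hasDerivAt_ratio (activeSet_ne hs.1).2.2).hasDerivWithinAt)]
  · refine setIntegral_congr_fun (hm.inter hR) fun s hs => ?_
    obtain ⟨hD, hsq, hs1⟩ := activeSet_ne hs.1
    have hpos := (ratio_mem_arcSet hσ h1 h2 hs.1).1.1
    simp only [smul_eq_mul]
    rw [← abs_of_pos (inv_pos.mpr hpos), ← abs_mul, ← abs_neg]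
    congr 1
    have : s ^ 2 - 1 ≠ 0 := fun h => hs1 (by linarith)
    rw [ratio, inv_div]
    field_simp
    ring
  · intro s hs t ht hst
    rw [← (ratio_mem_arcSet hσ h1 h2 hs.1).2, hst, (ratio_mem_arcSet hσ h1 h2 ht.1).2]

theorem measurableSet_arcSet : MeasurableSet (arcSet q v₁ v₂) := by
  have e : arcSet q v₁ v₂ = {ρ : ℝ | 0 < ρ} ∩ ({ρ : ℝ | 0 < ρ ^ 2 - 2 * q * ρ + 1} ∩
    ({ρ : ℝ | ρ ^ 2 - 2 * q * ρ + 1 ≤ v₁ ^ 2 * ρ ^ 2} ∩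
      {ρ : ℝ | ρ ^ 2 - 2 * q * ρ + 1 ≤ v₂ ^ 2})) := rfl
  rw [e]
  exact (measurableSet_lt (by fun_prop) (by fun_prop)).inter
    ((measurableSet_lt (by fun_prop) (by fun_prop)).inter
    ((measurableSet_le (by fun_prop) (by fun_prop)).inter
    (measurableSet_le (by fun_prop) (by fun_prop))))

/-- The part of the arc over which `H_+` integrates, the other part belonging to `H_-`: all or
nothing for `q < 1`, and the part beyond `1` for `q > 1`. -/
theorem ratioInv_mem_Ioo_iff (hq1 : q ≠ 1) (hσ : σ = 1 ∨ σ = -1) {ρ : ℝ} (hρ : ρ ∈ arcSet q v₁ v₂) :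
    ratioInv q σ ρ ∈ Ioo (-1 : ℝ) 1 ↔ -1 < q ∧ (1 < q → 1 < ρ) ∧ (q < 1 → σ = 1) := by
  obtain ⟨h0, hQ, -, -⟩ := hρ
  set r := √(ρ ^ 2 - 2 * q * ρ + 1) with hr
  have hrpos : 0 < r := Real.sqrt_pos.mpr hQ
  have hr2 : r ^ 2 = ρ ^ 2 - 2 * q * ρ + 1 := Real.sq_sqrt hQ.le
  rw [ratioInv, mem_Ioo, lt_div_iff₀ h0, div_lt_iff₀ h0, ← hr]
  rcases hσ with rfl | rfl
  · simp only [implies_true, and_true, one_mul]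
    constructor
    · rintro ⟨a, b⟩
      refine ⟨?_, fun hq => ?_⟩
      · by_contra h; push Not at h
        nlinarith
      · by_contra h; push Not at h
        nlinarith
    · rintro ⟨a, b⟩
      constructor
      · by_contra h; push Not at h
        rcases lt_or_gt_of_ne hq1 with h' | h'
        · nlinarith
        · have := b h'; linarith
      · by_contra h; push Not at h
        nlinarith
  · have : ¬ (-1 : ℝ) = 1 := by norm_num
    simp only [this, imp_false, not_lt]
    constructor
    · rintro ⟨a, b⟩
      have h1 : 1 < ρ := by linarith
      have h2 : 1 ≤ q := by
        by_contra h; push Not at h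
        nlinarith
      exact ⟨by linarith, fun _ => h1, h2⟩
    · rintro ⟨a, b, c⟩
      have hq : 1 < q := lt_of_le_of_ne c (Ne.symm hq1)
      have := b hq
      refine ⟨?_, by linarith⟩
      by_contra h; push Not at h
      nlinarith

theorem Hplus_eq (hq1 : q ≠ 1) (hq2 : q ≠ -1) (hσ : σ = 1 ∨ σ = -1) (h1 : 0 < σ * v₁)
    (h2 : 0 < σ * v₂) :
    Hplus q v₁ v₂ =
      ∫ ρ in arcSet q v₁ v₂ ∩ {ρ | -1 < q ∧ (1 < q → 1 < ρ) ∧ (q < 1 → σ = 1)}, ρ⁻¹ := by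
  rw [Hplus, integral_integrand_eq hq1 hq2 hσ h1 h2 measurableSet_Ioo]
  congr 2
  ext ρ
  refine and_congr_right fun h => ?_
  exact ratioInv_mem_Ioo_iff hq1 hσ h

theorem Hminus_eq (hq1 : q ≠ 1) (hq2 : q ≠ -1) (hσ : σ = 1 ∨ σ = -1) (h1 : 0 < σ * v₁)
    (h2 : 0 < σ * v₂) :
    Hminus q v₁ v₂ =
      ∫ ρ in arcSet q v₁ v₂ ∩ {ρ | ¬ (-1 < q ∧ (1 < q → 1 < ρ) ∧ (q < 1 → σ = 1))}, ρ⁻¹ := by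
  rw [Hminus, ← setIntegral_union _ measurableSet_Ioi (integrableOn_integrand hq1 hq2 _)
    (integrableOn_integrand hq1 hq2 _)]
  · rw [integral_integrand_eq hq1 hq2 hσ h1 h2 (measurableSet_Iio.union measurableSet_Ioi)]
    congr 2
    ext ρ
    refine and_congr_right fun h => ?_
    rw [mem_ofPred_eq, ← ratioInv_mem_Ioo_iff hq1 hσ h]
    have h3 := (activeSet_ne (ratioInv_mem_activeSet hq1 hq2 hσ h1 h2 h).1).2.2
    have n1 : ratioInv q σ ρ ≠ 1 := by intro h; rw [h] at h3; norm_num at h3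
    have n2 : ratioInv q σ ρ ≠ -1 := by intro h; rw [h] at h3; norm_num at h3
    rw [mem_preimage, mem_union, mem_Iio, mem_Ioi, mem_Ioo, not_and_or, not_lt, not_lt]
    exact or_congr (lt_iff_le_and_ne.trans (and_iff_left n2))
      (lt_iff_le_and_ne.trans (and_iff_left n1.symm))
  · rw [Set.disjoint_left]
    intro x hx hx'
    rw [mem_Iio] at hx
    rw [mem_Ioi] at hx'
    linarith

/-! ### Equal heights -/

theorem setIntegral_inv_Ioc {a b : ℝ} (ha : 0 < a) (hab : a ≤ b) :
    ∫ ρ in Ioc a b, ρ⁻¹ = Real.log b - Real.log a := by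
  rw [← intervalIntegral.integral_of_le hab, integral_inv_of_pos ha (ha.trans_le hab),
    Real.log_div (ha.trans_le hab).ne' ha.ne']

/-- The larger root of `ρ² - 2qρ + 1 = v²`. -/
def rhoMax (q v : ℝ) : ℝ := q + √(v ^ 2 + q ^ 2 - 1)

end

theorem rhoMax_root {q v : ℝ} (h : 0 ≤ v ^ 2 + q ^ 2 - 1) :
    rhoMax q v ^ 2 - 2 * q * rhoMax q v + 1 = v ^ 2 := by
  rw [rhoMax]; linear_combination Real.sq_sqrt h

theorem le_rhoMax (q v : ℝ) : q ≤ rhoMax q v := by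
  rw [rhoMax]; linarith [Real.sqrt_nonneg (v ^ 2 + q ^ 2 - 1)]

theorem hFun_s₁ {q v : ℝ} (hq1 : q ≠ 1) (hq2 : q ≠ -1) (h : 0 ≤ v ^ 2 + q ^ 2 - 1)
    (hr : 0 < rhoMax q v) : hFun q (s₁ q v) = Real.log (rhoMax q v / 2) := by
  have hroot := rhoMax_root h
  set P := rhoMax q v with hP
  have hs : s₁ q v = (v - 1) / P := by
    rw [s₁]
    split_ifs with hv
    · have hsq : √(v ^ 2 + q ^ 2 - 1) = |q| := by
        rw [hv, ← Real.sqrt_sq_eq_abs]; congr 1; ring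
      have hq : 0 < q := by
        by_contra hq
        rw [hP, rhoMax, hsq, abs_of_nonpos (not_lt.mp hq)] at hr
        linarith
      rw [hP, rhoMax, hsq, abs_of_pos hq, hv]
      field_simp
      norm_num
    · have : v + 1 ≠ 0 := fun h' => hv (by linarith)
      rw [div_eq_div_iff this hr.ne', hP, rhoMax]
      linear_combination Real.sq_sqrt h
  have hne : v - 1 + q * P ≠ 0 := by
    intro h0
    have h1 : (P - (v - 1)) * (P + (v - 1)) = 0 := by linear_combination hroot + 2 * h0
    rcases mul_eq_zero.mp h1 with h2 | h2
    · have : P * (q + 1) = 0 := by linear_combination h2 + h0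
      rcases mul_eq_zero.mp this with h3 | h3
      · exact hr.ne' h3
      · exact hq2 (by linarith)
    · have : P * (q - 1) = 0 := by linear_combination h0 - h2
      rcases mul_eq_zero.mp this with h3 | h3
      · exact hr.ne' h3
      · exact hq1 (by linarith)
  rw [hFun, hs]
  congr 1
  have e : 1 - ((v - 1) / P) ^ 2 = 2 * (v - 1 + q * P) / P ^ 2 := by
    field_simp; linear_combination hroot
  rw [e, div_eq_div_iff (by positivity) two_ne_zero]
  field_simp

theorem hFun_s₂ {q v : ℝ} (hq1 : q ≠ 1) (hq2 : q ≠ -1) (h : 0 ≤ v ^ 2 + q ^ 2 - 1)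
    (hr : 0 < rhoMax q v) : hFun q (s₂ q v) = Real.log (1 / (2 * rhoMax q v)) := by
  have hroot := rhoMax_root h
  have hs : s₂ q v = v - rhoMax q v := by rw [s₂, rhoMax]; ring
  have hne : v - rhoMax q v + q ≠ 0 := by
    intro h0
    have h1 : √(v ^ 2 + q ^ 2 - 1) = v := by rw [rhoMax] at h0; linarith
    have h2 := Real.sq_sqrt h
    rw [h1] at h2
    have : (q - 1) * (q + 1) = 0 := by linarith
    rcases mul_eq_zero.mp this with h | h
    · exact hq1 (by linarith)
    · exact hq2 (by linarith)
  set P := rhoMax q v with hP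
  rw [hFun, hs]
  congr 1
  have e : 1 - (v - P) ^ 2 = 2 * P * (v - P + q) := by linear_combination hroot
  rw [e]
  field_simp

theorem hFun_add_sqrt {q : ℝ} (hq : 1 < q) :
    hFun q (-q + √(q ^ 2 - 1)) = Real.log (rhoMax q 0 / 2) := by
  have h : 0 < q ^ 2 - 1 := by nlinarith
  have h2 := Real.sq_sqrt h.le
  have h3 := Real.sqrt_pos.mpr h
  rw [hFun, rhoMax, show (0 : ℝ) ^ 2 + q ^ 2 - 1 = q ^ 2 - 1 by ring]
  set r := √(q ^ 2 - 1)
  congr 1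
  have e : 1 - (-q + r) ^ 2 = 2 * r * (q - r) := by linear_combination 1 * h2
  have : 0 < q - r := by nlinarith
  rw [e, div_eq_div_iff (by positivity) two_ne_zero]
  linear_combination 2 * r * h2

theorem hFun_sub_sqrt {q : ℝ} (hq : 1 < q) :
    hFun q (-q - √(q ^ 2 - 1)) = Real.log (1 / (2 * rhoMax q 0)) := by
  have h : 0 < q ^ 2 - 1 := by nlinarith
  have h2 := Real.sq_sqrt h.le
  have h3 := Real.sqrt_pos.mpr h
  rw [hFun, rhoMax, show (0 : ℝ) ^ 2 + q ^ 2 - 1 = q ^ 2 - 1 by ring]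
  set r := √(q ^ 2 - 1)
  congr 1
  have e : 1 - (-q - r) ^ 2 = -(2 * r * (q + r)) := by linear_combination 1 * h2
  have : 0 < q + r := by linarith
  rw [e]
  field_simp
  ring

/-- For `q > 1` the polynomial `ρ² - 2qρ + 1` is positive beyond its root `rhoMax q 0`; the
condition with `v₁` is the one with `v₂` for `ρ⁻¹`. -/
theorem arcSet_inter_Ioi {q : ℝ} (hq : 1 < q) (v₁ v₂ : ℝ) :
    arcSet q v₁ v₂ ∩ Ioi 1 =
      Ioc (rhoMax q 0) (rhoMax q v₂) ∩ {ρ | ρ * (2 * q - rhoMax q v₁) ≤ 1} := by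
  have r0 := rhoMax_root (q := q) (v := 0) (by nlinarith)
  have r1 := rhoMax_root (q := q) (v := v₁) (by nlinarith)
  have r2 := rhoMax_root (q := q) (v := v₂) (by nlinarith)
  have l0 := le_rhoMax q 0
  have l1 := le_rhoMax q v₁
  have l2 := le_rhoMax q v₂
  set P0 := rhoMax q 0
  set P1 := rhoMax q v₁
  set P2 := rhoMax q v₂
  ext ρ
  simp only [arcSet, mem_inter_iff, mem_ofPred_eq, mem_Ioi, mem_Ioc]
  have f0 : ρ ^ 2 - 2 * q * ρ + 1 = (ρ - P0) * (ρ - (2 * q - P0)) := by linear_combination r0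
  have f1 : v₁ ^ 2 * ρ ^ 2 - (ρ ^ 2 - 2 * q * ρ + 1) = (ρ * P1 - 1) * (1 - ρ * (2 * q - P1)) := by
    linear_combination -ρ ^ 2 * r1
  have f2 : v₂ ^ 2 - (ρ ^ 2 - 2 * q * ρ + 1) = (P2 - ρ) * (ρ - (2 * q - P2)) := by
    linear_combination - r2
  have hP0 : 2 * q - P0 < 1 := by nlinarith
  constructor
  · rintro ⟨⟨a, b, c, d⟩, e⟩
    refine ⟨⟨?_, ?_⟩, ?_⟩
    · by_contra h; push Not at h; nlinarith
    · by_contra h; push Not at h; nlinarith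
    · by_contra h; push Not at h
      have : 0 < ρ * P1 - 1 := by nlinarith
      nlinarith
  · rintro ⟨⟨a, b⟩, c⟩
    have hρ : 1 < ρ := by linarith
    refine ⟨⟨by linarith, ?_, ?_, ?_⟩, hρ⟩
    · rw [f0]; apply mul_pos <;> linarith
    · have : 0 < ρ * P1 - 1 := by nlinarith
      rw [← sub_nonneg, f1]; apply mul_nonneg <;> linarith
    · rw [← sub_nonneg, f2]; apply mul_nonneg <;> linarith

theorem one_le_rhoMax {q v : ℝ} (hv : 2 - 2 * q ≤ v ^ 2) : 1 ≤ rhoMax q v := by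
  have : 1 - q ≤ √(v ^ 2 + q ^ 2 - 1) := Real.le_sqrt_of_sq_le (by nlinarith)
  rw [rhoMax]; linarith

theorem arcSet_self {q v : ℝ} (hq1 : q < 1) (hv0 : v ≠ 0) (hv : 2 - 2 * q ≤ v ^ 2) :
    arcSet q v v = Icc (rhoMax q v)⁻¹ (rhoMax q v) := by
  have hP1 := one_le_rhoMax hv
  have hroot := rhoMax_root (q := q) (v := v) (by nlinarith [sq_nonneg (q - 1)])
  have hle := le_rhoMax q v
  set P := rhoMax q v
  have hP0 : 0 < P := by linarith
  ext ρ
  simp only [arcSet, mem_ofPred_eq, mem_Icc]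
  have f1 : v ^ 2 * ρ ^ 2 - (ρ ^ 2 - 2 * q * ρ + 1) = (ρ * P - 1) * (1 - ρ * (2 * q - P)) := by
    linear_combination -ρ ^ 2 * hroot
  have f2 : v ^ 2 - (ρ ^ 2 - 2 * q * ρ + 1) = (P - ρ) * (ρ - (2 * q - P)) := by
    linear_combination - hroot
  have hv2 : 0 < v ^ 2 := by positivity
  rw [inv_le_iff_one_le_mul₀ hP0]
  constructor
  · rintro ⟨a, b, c, d⟩
    constructor
    · by_contra h; push Not at h
      have : ρ * (2 * q - P) ≤ ρ * P := by gcongr; linarith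
      nlinarith
    · by_contra h; push Not at h; nlinarith
  · rintro ⟨a, b⟩
    have hρ : 0 < ρ := by
      by_contra h; push Not at h; nlinarith
    have hle2 : 2 * q - P ≤ ρ := by
      by_contra h; push Not at h; nlinarith
    refine ⟨hρ, ?_, ?_, ?_⟩
    · by_contra h; push Not at h
      nlinarith [sq_nonneg (ρ - 1)]
    · rw [← sub_nonneg, f1]; apply mul_nonneg
      · linarith
      · nlinarith
    · rw [← sub_nonneg, f2]; apply mul_nonneg <;> linarith

/-- Multiplying the two height conditions out bounds `ρ + ρ⁻¹`. -/
theorem arcSet_add_inv_le {q v w₁ w₂ ρ : ℝ} (h1 : w₁ ^ 2 ≤ v ^ 2) (h2 : w₂ ^ 2 ≤ v ^ 2)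
    (hρ : ρ ∈ arcSet q w₁ w₂) : (ρ - 1) ^ 2 ≤ (v ^ 2 + 2 * q - 2) * ρ := by
  obtain ⟨a, b, c, d⟩ := hρ
  rcases le_or_gt ρ 1 with h | h
  · nlinarith [mul_le_mul_of_nonneg_right h1 (sq_nonneg ρ), mul_nonneg (sq_nonneg v) a.le]
  · nlinarith [mul_nonneg (sq_nonneg v) a.le]

theorem arcSet_eq_empty {q v w₁ w₂ : ℝ} (h1 : w₁ ^ 2 ≤ v ^ 2) (h2 : w₂ ^ 2 ≤ v ^ 2)
    (hv : v ^ 2 < 2 - 2 * q) : arcSet q w₁ w₂ = ∅ := by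
  rw [eq_empty_iff_forall_notMem]
  intro ρ hρ
  have := arcSet_add_inv_le h1 h2 hρ
  nlinarith [hρ.1, sq_nonneg (ρ - 1)]

/-- The inversion `ρ ↦ ρ⁻¹` exchanges the roles of the two heights. -/
theorem integral_arcSet_lt_one (q v₁ v₂ : ℝ) :
    ∫ ρ in arcSet q v₁ v₂ ∩ Iio 1, ρ⁻¹ = ∫ ρ in arcSet q v₂ v₁ ∩ Ioi 1, ρ⁻¹ := by
  have e : arcSet q v₂ v₁ ∩ Ioi 1 = (fun ρ : ℝ => ρ⁻¹) '' (arcSet q v₁ v₂ ∩ Iio 1) := by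
    have key : ∀ v₁ v₂ ρ : ℝ, ρ ∈ arcSet q v₁ v₂ → ρ⁻¹ ∈ arcSet q v₂ v₁ := by
      rintro v₁ v₂ ρ ⟨a, b, c, d⟩
      have e : ρ⁻¹ ^ 2 - 2 * q * ρ⁻¹ + 1 = (ρ ^ 2 - 2 * q * ρ + 1) / ρ ^ 2 := by
        field_simp; ring
      refine ⟨inv_pos.mpr a, ?_, ?_, ?_⟩
      · rw [e]; positivity
      · rw [e, inv_pow, ← div_eq_mul_inv]; gcongr
      · rw [e, div_le_iff₀ (by positivity)]; exact c
    ext ρ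
    constructor
    · rintro ⟨a, b⟩
      exact ⟨ρ⁻¹, ⟨key _ _ _ a, mem_Iio.mpr (inv_lt_one_of_one_lt₀ b)⟩, inv_inv ρ⟩
    · rintro ⟨ρ, ⟨a, b⟩, rfl⟩
      exact ⟨key _ _ _ a, (one_lt_inv₀ a.1).mpr b⟩
  have hm : MeasurableSet (arcSet q v₁ v₂ ∩ Iio 1) := measurableSet_arcSet.inter measurableSet_Iio
  rw [e, integral_image_eq_integral_abs_deriv_smul hm
    (fun x hx => (hasDerivAt_inv hx.1.1.ne').hasDerivWithinAt) inv_injective.injOn]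
  refine setIntegral_congr_fun hm fun ρ hρ => ?_
  have := hρ.1.1
  simp only [abs_neg, smul_eq_mul, inv_inv]
  rw [abs_of_nonneg (by positivity)]
  field_simp

theorem integral_arcSet_of_le {q v : ℝ} (hv : v ^ 2 ≤ 2 - 2 * q) (S : Set ℝ) :
    ∫ ρ in arcSet q v v ∩ S, ρ⁻¹ = 0 := by
  apply setIntegral_measure_zero
  refine measure_mono_null (t := {1}) ?_ (by simp)
  rintro ρ ⟨hρ, -⟩
  have := arcSet_add_inv_le le_rfl le_rfl hρ
  have : (ρ - 1) ^ 2 ≤ 0 := by nlinarith [hρ.1]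
  have : ρ - 1 = 0 := by simpa using le_antisymm this (sq_nonneg _)
  exact mem_singleton_iff.mpr (by linarith)

theorem integral_arcSet_self {q v : ℝ} (hq1 : q < 1) (hq2 : q ≠ -1) (hv0 : v ≠ 0)
    (hv : 2 - 2 * q ≤ v ^ 2) :
    ∫ ρ in arcSet q v v, ρ⁻¹ = hFun q (s₁ q v) - hFun q (s₂ q v) := by
  have hP1 := one_le_rhoMax hv
  have hP0 : 0 < rhoMax q v := by linarith
  have hle : (rhoMax q v)⁻¹ ≤ rhoMax q v := (inv_le_one_of_one_le₀ hP1).trans hP1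
  have h0 : 0 ≤ v ^ 2 + q ^ 2 - 1 := by nlinarith [sq_nonneg (q - 1)]
  rw [arcSet_self hq1 hv0 hv, integral_Icc_eq_integral_Ioc, setIntegral_inv_Ioc (inv_pos.mpr hP0)
    hle, hFun_s₁ hq1.ne hq2 h0 hP0, hFun_s₂ hq1.ne hq2 h0 hP0, Real.log_div hP0.ne' two_ne_zero,
    Real.log_div one_ne_zero (by positivity), Real.log_mul two_ne_zero hP0.ne', Real.log_one,
    Real.log_inv]
  ring

theorem integral_arcSet_gt_one_self {q v : ℝ} (hq : 1 < q) :
    ∫ ρ in arcSet q v v ∩ Ioi 1, ρ⁻¹ = Real.log (rhoMax q v) - Real.log (rhoMax q 0) := by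
  have l0 := le_rhoMax q 0
  have hle : rhoMax q 0 ≤ rhoMax q v := by
    rw [rhoMax, rhoMax]; gcongr 1
    exact Real.sqrt_le_sqrt (by nlinarith [sq_nonneg v])
  have r := rhoMax_root (q := q) (v := v) (by nlinarith [sq_nonneg v])
  rw [arcSet_inter_Ioi hq, inter_eq_left.mpr, setIntegral_inv_Ioc (by linarith) hle]
  rintro ρ ⟨a, b⟩
  rw [mem_ofPred_eq]
  rcases le_or_gt (2 * q - rhoMax q v) 0 with h | h
  · nlinarith
  · nlinarith [mul_le_mul_of_nonneg_right b h.le, sq_nonneg v]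

theorem arcSet_inter_not_gt {q : ℝ} (hq : 1 < q) (v₁ v₂ : ℝ) :
    arcSet q v₁ v₂ ∩ {ρ | ¬ 1 < ρ} = arcSet q v₁ v₂ ∩ Iio 1 := by
  ext ρ
  refine and_congr_right fun h => ⟨fun h1 => lt_of_le_of_ne (not_lt.mp h1) ?_, fun h1 => h1.not_gt⟩
  rintro rfl
  have := h.2.1
  linarith

theorem Hplus_zero (q : ℝ) : Hplus q 0 0 = 0 := by
  have : activeSet q 0 0 = ∅ := by
    rw [eq_empty_iff_forall_notMem]; rintro s ⟨h, -⟩; norm_num at h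
  simp [Hplus, integrand_eq_indicator, this]

theorem Hminus_zero (q : ℝ) : Hminus q 0 0 = 0 := by
  have : activeSet q 0 0 = ∅ := by
    rw [eq_empty_iff_forall_notMem]; rintro s ⟨h, -⟩; norm_num at h
  simp [Hminus, integrand_eq_indicator, this]

theorem exists_sign {v : ℝ} (hv : v ≠ 0) : ∃ σ : ℝ, (σ = 1 ∨ σ = -1) ∧ 0 < σ * v := by
  rcases lt_or_gt_of_ne hv with h | h
  · exact ⟨-1, Or.inr rfl, by linarith⟩
  · exact ⟨1, Or.inl rfl, by linarith⟩

theorem Hplus_self {q v : ℝ} (hq1 : q ≠ 1) (hq2 : q ≠ -1) :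
    Hplus q v v =
      (if q < -1 then 0
      else if q < 1 then
        if v ≤ √(2 - 2 * q) then 0 else hFun q (s₁ q v) - hFun q (s₂ q v)
      else hFun q (s₁ q v) - hFun q (-q + √(q ^ 2 - 1))) := by
  rcases eq_or_ne v 0 with rfl | hv0
  · rw [Hplus_zero]
    split_ifs with h1 h2 h3
    · rfl
    · rfl
    · exact absurd (Real.sqrt_nonneg _) h3
    · have h : 1 < q := lt_of_le_of_ne (not_lt.mp h2) (Ne.symm hq1)
      have := le_rhoMax q 0
      rw [hFun_s₁ hq1 hq2 (by nlinarith) (by linarith), hFun_add_sqrt h, sub_self]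
  obtain ⟨σ, hσ, hσv⟩ := exists_sign hv0
  rw [Hplus_eq hq1 hq2 hσ hσv hσv]
  split_ifs with h1 h2 h3
  · have : ¬ -1 < q := by linarith
    simp [this]
  · by_cases hs : σ = 1
    · have hv : 0 < v := by rw [hs] at hσv; linarith
      apply integral_arcSet_of_le
      rwa [Real.le_sqrt hv.le (by linarith)] at h3
    · simp [h2, hs]
  · have h4 : -1 < q := lt_of_le_of_ne (not_lt.mp h1) (Ne.symm hq2)
    push Not at h3
    have hv : 0 < v := (Real.sqrt_nonneg _).trans_lt h3
    have hs : σ = 1 := by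
      rcases hσ with h | h
      · exact h
      · rw [h] at hσv; linarith
    have h5 : ¬ 1 < q := by linarith
    rw [Real.sqrt_lt (by linarith) hv.le] at h3
    rw [← integral_arcSet_self h2 hq2 hv0 h3.le]
    simp [h4, h5, hs]
  · have h : 1 < q := lt_of_le_of_ne (not_lt.mp h2) (Ne.symm hq1)
    have h4 : -1 < q := by linarith
    have := le_rhoMax q 0
    have := le_rhoMax q v
    rw [hFun_s₁ hq1 hq2 (by nlinarith [sq_nonneg v]) (by linarith), hFun_add_sqrt h,
      Real.log_div (by linarith) two_ne_zero, Real.log_div (by linarith) two_ne_zero]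
    have := integral_arcSet_gt_one_self (v := v) h
    rw [Ioi] at this
    simp only [h, h4, h2, true_and, forall_const, IsEmpty.forall_iff, and_true, this]
    ring

theorem Hminus_self {q v : ℝ} (hq1 : q ≠ 1) (hq2 : q ≠ -1) :
    Hminus q v v =
      (if q < -1 then
        if |v| ≤ √(2 - 2 * q) then 0 else hFun q (s₁ q v) - hFun q (s₂ q v)
      else if q < 1 then
        if v < -√(2 - 2 * q) then hFun q (s₁ q v) - hFun q (s₂ q v) else 0
      else hFun q (-q - √(q ^ 2 - 1)) - hFun q (s₂ q v)) := by
  rcases eq_or_ne v 0 with rfl | hv0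
  · rw [Hminus_zero]
    split_ifs with h1 h2 h3 h4
    · rfl
    · rw [abs_zero] at h2; exact absurd (Real.sqrt_nonneg _) h2
    · have := Real.sqrt_nonneg (2 - 2 * q); linarith
    · rfl
    · have h : 1 < q := lt_of_le_of_ne (not_lt.mp h3) (Ne.symm hq1)
      have := le_rhoMax q 0
      rw [hFun_s₂ hq1 hq2 (by nlinarith) (by linarith), hFun_sub_sqrt h, sub_self]
  obtain ⟨σ, hσ, hσv⟩ := exists_sign hv0
  rw [Hminus_eq hq1 hq2 hσ hσv hσv]
  split_ifs with h1 h2 h3 h4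
  · apply integral_arcSet_of_le
    rwa [Real.le_sqrt (abs_nonneg _) (by linarith), sq_abs] at h2
  · have h4 : ¬ -1 < q := by linarith
    push Not at h2
    rw [Real.sqrt_lt (by linarith) (abs_nonneg _), sq_abs] at h2
    rw [← integral_arcSet_self (by linarith) hq2 hv0 h2.le]
    simp [h4]
  · have h5 : -1 < q := lt_of_le_of_ne (not_lt.mp h1) (Ne.symm hq2)
    have hv : v < 0 := h4.trans_le (neg_nonpos.mpr (Real.sqrt_nonneg _))
    have hs : σ ≠ 1 := by rintro rfl; linarith
    have h6 : √(2 - 2 * q) < -v := by linarith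
    rw [Real.sqrt_lt (by linarith) (by linarith), neg_sq] at h6
    rw [← integral_arcSet_self h3 hq2 hv0 h6.le]
    simp [hs, h3]
  · have h5 : -1 < q := lt_of_le_of_ne (not_lt.mp h1) (Ne.symm hq2)
    have h7 : ¬ 1 < q := by linarith
    rcases hσ with h | h
    · simp [h, h5, h7]
    · apply integral_arcSet_of_le
      have hv : 0 < -v := by rw [h] at hσv; linarith
      push Not at h4
      have : -v ≤ √(2 - 2 * q) := by linarith
      rwa [Real.le_sqrt hv.le (by linarith), neg_sq] at this
  · have h : 1 < q := lt_of_le_of_ne (not_lt.mp h3) (Ne.symm hq1)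
    have h4 : -1 < q := by linarith
    have := le_rhoMax q 0
    have := le_rhoMax q v
    rw [hFun_s₂ hq1 hq2 (by nlinarith [sq_nonneg v]) (by linarith), hFun_sub_sqrt h,
      Real.log_div one_ne_zero (by linarith), Real.log_div one_ne_zero (by linarith),
      Real.log_mul two_ne_zero (by linarith), Real.log_mul two_ne_zero (by linarith)]
    have := integral_arcSet_gt_one_self (v := v) h
    rw [← integral_arcSet_lt_one, ← arcSet_inter_not_gt h] at this
    simp only [h, h4, h3, true_and, forall_const, IsEmpty.forall_iff, and_true, this, Real.log_one]
    ring

/-! ### The contribution of a pair of geodesics to the density -/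

/-- The mass, for `dρ / ρ`, of the part in `S` of the arc with heights at least `α₁`, `α₂` and
distance `w` between the tops. -/
def arcMass (q α₁ α₂ : ℝ) (S : Set ℝ) (w : ℝ) : ℝ :=
  ∫ ρ in arcSet q (w / α₁) (w / α₂) ∩ S, ρ⁻¹

theorem arcMass_neg (q α₁ α₂ : ℝ) (S : Set ℝ) (w : ℝ) :
    arcMass q α₁ α₂ S (-w) = arcMass q α₁ α₂ S w := by
  unfold arcMass arcSet
  simp only [neg_div, neg_sq]

variable {q α₁ α₂ : ℝ}

theorem sq_div_le (hα : 1 ≤ α₁) (w : ℝ) : (w / α₁) ^ 2 ≤ w ^ 2 := by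
  rw [div_pow]
  exact div_le_self (sq_nonneg w) (one_le_pow₀ hα)

theorem arcSet_subset_Icc (h1 : 1 ≤ α₁) (h2 : 1 ≤ α₂) {V w : ℝ} (hw : |w| ≤ V) :
    arcSet q (w / α₁) (w / α₂) ⊆ Icc (V ^ 2 + 2 * |q| + 2)⁻¹ (V ^ 2 + 2 * |q| + 2) := by
  intro ρ hρ
  have hV : w ^ 2 ≤ V ^ 2 := by rw [← sq_abs w]; gcongr
  have := arcSet_add_inv_le ((sq_div_le h1 w).trans hV) ((sq_div_le h2 w).trans hV) hρ
  have h0 := hρ.1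
  have hq := le_abs_self q
  have hM : 0 < V ^ 2 + 2 * |q| + 2 := by positivity
  constructor
  · rw [inv_le_iff_one_le_mul₀ hM]; nlinarith
  · by_contra h; push Not at h; nlinarith

theorem integrableOn_inv_Icc {a b : ℝ} (ha : 0 < a) : IntegrableOn (fun ρ : ℝ => ρ⁻¹) (Icc a b) :=
  ContinuousOn.integrableOn_Icc fun _ hx =>
    (continuousAt_inv₀ (ha.trans_le hx.1).ne').continuousWithinAt

theorem arcMass_le (h1 : 1 ≤ α₁) (h2 : 1 ≤ α₂) {V w : ℝ} (hw : |w| ≤ V) (S : Set ℝ) :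
    arcMass q α₁ α₂ S w ≤ 2 * Real.log (V ^ 2 + 2 * |q| + 2) := by
  set M := V ^ 2 + 2 * |q| + 2 with hM
  have hM1 : 1 ≤ M := by nlinarith [sq_nonneg V, abs_nonneg q]
  have hM0 : 0 < M := by linarith
  calc arcMass q α₁ α₂ S w ≤ ∫ ρ in Icc M⁻¹ M, ρ⁻¹ := by
        apply setIntegral_mono_set (integrableOn_inv_Icc (inv_pos.mpr hM0))
        · refine (ae_restrict_iff' measurableSet_Icc).mpr (Eventually.of_forall fun ρ hρ => ?_)
          exact inv_nonneg.mpr ((inv_pos.mpr hM0).le.trans hρ.1)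
        · exact (inter_subset_left.trans (arcSet_subset_Icc h1 h2 hw)).eventuallyLE
    _ = 2 * Real.log M := by
        rw [integral_Icc_eq_integral_Ioc, setIntegral_inv_Ioc (inv_pos.mpr hM0)
          ((inv_le_one_of_one_le₀ hM1).trans hM1), Real.log_inv]
        ring

theorem arcMass_eq_zero (h1 : 1 ≤ α₁) (h2 : 1 ≤ α₂) {w : ℝ} (hw : w ^ 2 < 2 - 2 * q) (S : Set ℝ) :
    arcMass q α₁ α₂ S w = 0 := by
  rw [arcMass, arcSet_eq_empty (sq_div_le h1 w) (sq_div_le h2 w) hw]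
  simp

theorem finite_setOf_quadratic_eq (q k : ℝ) : {ρ : ℝ | ρ ^ 2 - 2 * q * ρ + 1 = k}.Finite := by
  refine (Set.toFinite {q + √(k + q ^ 2 - 1), q - √(k + q ^ 2 - 1)}).subset fun ρ hρ => ?_
  rw [mem_ofPred_eq] at hρ
  have h : (ρ - q) ^ 2 = k + q ^ 2 - 1 := by linear_combination hρ
  have h2 : |ρ - q| = √(k + q ^ 2 - 1) := by rw [← h, Real.sqrt_sq_eq_abs]
  rcases abs_choice (ρ - q) with h3 | h3
  · left; linarith
  · right; rw [mem_singleton_iff]; linarith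

/-- The boundary of the arc is finite, so that its mass depends continuously on the distance. -/
theorem continuous_arcMass (h1 : 1 ≤ α₁) (h2 : 1 ≤ α₂) {S : Set ℝ} (hS : MeasurableSet S) :
    Continuous (arcMass q α₁ α₂ S) := by
  rw [continuous_iff_continuousAt]
  intro w₀
  set M := (|w₀| + 1) ^ 2 + 2 * |q| + 2 with hM
  have hM0 : 0 < M := by positivity
  have e : arcMass q α₁ α₂ S = fun w => ∫ ρ,
      (arcSet q (w / α₁) (w / α₂) ∩ S).indicator (fun ρ => ρ⁻¹) ρ := by
    ext w
    rw [integral_indicator (measurableSet_arcSet.inter hS)]; rfl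
  rw [e]
  apply continuousAt_of_dominated (bound := (Icc M⁻¹ M).indicator fun ρ => ρ⁻¹)
  · exact Eventually.of_forall fun w => (Measurable.indicator (by fun_prop)
      (measurableSet_arcSet.inter hS)).aestronglyMeasurable
  · have : ∀ᶠ w in 𝓝 w₀, |w| < |w₀| + 1 :=
      (continuous_abs.continuousAt (x := w₀)).eventually_lt continuousAt_const (by simp)
    filter_upwards [this] with w hw
    refine Eventually.of_forall fun ρ => ?_
    rw [Real.norm_eq_abs, abs_of_nonneg
      (indicator_nonneg (fun _ h => inv_nonneg.mpr h.1.1.le) ρ)]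
    by_cases h : ρ ∈ arcSet q (w / α₁) (w / α₂) ∩ S
    · rw [indicator_of_mem h, indicator_of_mem (arcSet_subset_Icc h1 h2 hw.le h.1)]
    · rw [indicator_of_notMem h]
      exact indicator_nonneg (fun ρ hρ => inv_nonneg.mpr ((inv_pos.mpr hM0).le.trans hρ.1)) ρ
  · rw [integrable_indicator_iff measurableSet_Icc]
    exact integrableOn_inv_Icc (inv_pos.mpr hM0)
  · have hfin : {ρ : ℝ | ρ ^ 2 - 2 * q * ρ + 1 = (w₀ / α₁) ^ 2 * ρ ^ 2 ∨
        ρ ^ 2 - 2 * q * ρ + 1 = (w₀ / α₂) ^ 2}.Finite := by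
      refine Finite.union ?_ (finite_setOf_quadratic_eq q _)
      refine ((finite_setOf_quadratic_eq q ((w₀ / α₁) ^ 2)).preimage inv_injective.injOn).subset ?_
      intro ρ hρ
      change ρ ^ 2 - 2 * q * ρ + 1 = (w₀ / α₁) ^ 2 * ρ ^ 2 at hρ
      have h0 : ρ ≠ 0 := by rintro rfl; norm_num at hρ
      rw [mem_preimage, mem_ofPred_eq]
      have e : ρ⁻¹ ^ 2 - 2 * q * ρ⁻¹ + 1 = (ρ ^ 2 - 2 * q * ρ + 1) / ρ ^ 2 := by
        field_simp; ring
      rw [e, hρ, mul_div_assoc, div_self (pow_ne_zero 2 h0), mul_one]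
    have hae := hfin.measure_zero volume
    rw [measure_eq_zero_iff_ae_notMem] at hae
    filter_upwards [hae] with ρ hρ
    replace hρ := not_or.mp hρ
    apply ContinuousAt.congr (f := fun _ => (arcSet q (w₀ / α₁) (w₀ / α₂) ∩ S).indicator
      (fun ρ => ρ⁻¹) ρ) continuousAt_const
    have key : ∀ (f : ℝ → ℝ) (c : ℝ), Continuous f → c ≠ f w₀ →
        ∀ᶠ w in 𝓝 w₀, (c ≤ f w ↔ c ≤ f w₀) := by
      intro f c hf hne
      rcases lt_or_gt_of_ne hne with h | h
      · filter_upwards [continuousAt_const.eventually_lt hf.continuousAt h] with w hw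
        exact iff_of_true hw.le h.le
      · filter_upwards [hf.continuousAt.eventually_lt continuousAt_const h] with w hw
        exact iff_of_false hw.not_ge h.not_ge
    filter_upwards [key (fun w => (w / α₁) ^ 2 * ρ ^ 2) _ (by fun_prop) hρ.1,
      key (fun w => (w / α₂) ^ 2) _ (by fun_prop) hρ.2] with w hw1 hw2
    have : ρ ∈ arcSet q (w₀ / α₁) (w₀ / α₂) ∩ S ↔ ρ ∈ arcSet q (w / α₁) (w / α₂) ∩ S := by
      simp only [arcSet, mem_inter_iff, mem_ofPred_eq, hw1, hw2]
    by_cases h : ρ ∈ arcSet q (w₀ / α₁) (w₀ / α₂) ∩ S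
    · rw [indicator_of_mem h, indicator_of_mem (this.mp h)]
    · rw [indicator_of_notMem h, indicator_of_notMem (fun h' => h (this.mpr h'))]

/-! #### Nested geodesics -/

theorem rhoMax_zero_mul {q : ℝ} (hq : 1 < q) :
    (q + √(q ^ 2 - 1)) * (q - √(q ^ 2 - 1)) = 1 := by
  linear_combination -(Real.sq_sqrt (show 0 ≤ q ^ 2 - 1 by nlinarith))

theorem rhoMax_zero (q : ℝ) : rhoMax q 0 = q + √(q ^ 2 - 1) := by
  rw [rhoMax]; congr 2; ring

theorem rhoMax_mono {q v : ℝ} : rhoMax q 0 ≤ rhoMax q v := by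
  rw [rhoMax, rhoMax]; gcongr 1
  exact Real.sqrt_le_sqrt (by nlinarith [sq_nonneg v])

/-- The mass between the roots of `ρ² - 2qρ + 1 = 0` and `ρ² - 2qρ + 1 = w²` is of order `w²`. -/
theorem arcMass_Ioi_le (hq : 1 < q) (h2 : 1 ≤ α₂) (w : ℝ) :
    arcMass q α₁ α₂ (Ioi 1) w ≤ (q - √(q ^ 2 - 1)) / (2 * √(q ^ 2 - 1)) * w ^ 2 := by
  have hr : 0 < √(q ^ 2 - 1) := Real.sqrt_pos.mpr (by nlinarith)
  have hr2 := Real.sq_sqrt (show 0 ≤ q ^ 2 - 1 by nlinarith)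
  have h0 := rhoMax_zero_mul hq
  have hP0 := rhoMax_zero q
  have hmono := rhoMax_mono (q := q) (v := w / α₂)
  set v := w / α₂ with hv
  have hvw : v ^ 2 ≤ w ^ 2 := sq_div_le h2 w
  have hPdef : rhoMax q v = q + √(v ^ 2 + q ^ 2 - 1) := rfl
  set r := √(q ^ 2 - 1) with hrdef
  have hs2 := Real.sq_sqrt (show 0 ≤ v ^ 2 + q ^ 2 - 1 by nlinarith [sq_nonneg v])
  have hs0 := Real.sqrt_nonneg (v ^ 2 + q ^ 2 - 1)
  set s := √(v ^ 2 + q ^ 2 - 1) with hsdef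
  have hpos : 0 < q + r := by linarith
  have hpos0 : 0 < rhoMax q 0 := by linarith
  calc arcMass q α₁ α₂ (Ioi 1) w ≤ ∫ ρ in Ioc (rhoMax q 0) (rhoMax q v), ρ⁻¹ := by
        rw [arcMass, arcSet_inter_Ioi hq]
        apply setIntegral_mono_set
        · exact (integrableOn_inv_Icc hpos0).mono_set Ioc_subset_Icc_self
        · refine (ae_restrict_iff' measurableSet_Ioc).mpr (Eventually.of_forall fun ρ hρ => ?_)
          exact inv_nonneg.mpr (hpos0.trans hρ.1).le
        · exact inter_subset_left.eventuallyLE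
    _ = Real.log (rhoMax q v / rhoMax q 0) := by
        rw [setIntegral_inv_Ioc hpos0 hmono, Real.log_div (by linarith) (by linarith)]
    _ ≤ rhoMax q v / rhoMax q 0 - 1 := Real.log_le_sub_one_of_pos (div_pos (by linarith) hpos0)
    _ = (q - r) * (s - r) := by
        have : q - r = 1 / (q + r) := by rw [eq_div_iff hpos.ne']; linarith
        rw [hP0, hPdef, this]; field_simp; ring
    _ ≤ (q - r) * (w ^ 2 / (2 * r)) := by
        have : 0 < q - r := by
          by_contra h; push Not at h; nlinarith
        gcongr
        rw [le_div_iff₀ (by positivity)]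
        nlinarith [sq_nonneg (s - r)]
    _ = _ := by ring

/-- The two terms of the minimum come from the two height conditions, which bind at the upper end of
the arc. -/
theorem tendsto_arcMass_Ioi (hq : 1 < q) (h1 : 1 ≤ α₁) (h2 : 1 ≤ α₂) :
    Tendsto (fun w => arcMass q α₁ α₂ (Ioi 1) w / w ^ 2) (𝓝[≠] 0)
      (𝓝 (min ((q - √(q ^ 2 - 1)) / (2 * √(q ^ 2 - 1)) / α₂ ^ 2)
        ((q + √(q ^ 2 - 1)) / (2 * √(q ^ 2 - 1)) / α₁ ^ 2))) := by
  have hq2 : 0 < q ^ 2 - 1 := by nlinarith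
  have hr : 0 < √(q ^ 2 - 1) := Real.sqrt_pos.mpr hq2
  have hr2 := Real.sq_sqrt hq2.le
  have h0 := rhoMax_zero_mul hq
  have hP0 := rhoMax_zero q
  set r := √(q ^ 2 - 1) with hrdef
  have hpos : 0 < q + r := by linarith
  have hneg : 0 < q - r := by
    by_contra h; push Not at h; nlinarith
  have hinv : q - r = 1 / (q + r) := by rw [eq_div_iff hpos.ne']; linarith
  have hinv' : q + r = 1 / (q - r) := by rw [eq_div_iff hneg.ne']; linarith
  -- the logarithms of the two upper bounds for `ρ`, as functions of `t = w ^ 2`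
  set ℓ₂ : ℝ → ℝ := fun t => Real.log (q + √(t / α₂ ^ 2 + q ^ 2 - 1)) - Real.log (q + r) with hℓ₂
  set ℓ₁ : ℝ → ℝ := fun t => -Real.log (q - √(t / α₁ ^ 2 + q ^ 2 - 1)) - Real.log (q + r) with hℓ₁
  have hsq : ∀ α : ℝ, HasDerivAt (fun t : ℝ => √(t / α ^ 2 + q ^ 2 - 1)) (1 / α ^ 2 / (2 * r)) 0 := by
    intro α
    have h : HasDerivAt (fun t : ℝ => t / α ^ 2 + q ^ 2 - 1) (1 / α ^ 2) 0 :=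
      (((hasDerivAt_id (0 : ℝ)).div_const (α ^ 2)).add_const (q ^ 2)).sub_const 1
    have h' := h.sqrt (by simp [hq2.ne'])
    have e : √(0 / α ^ 2 + q ^ 2 - 1) = r := by rw [zero_div, zero_add]
    rwa [e] at h'
  have e0 : ∀ α : ℝ, √(0 / α ^ 2 + q ^ 2 - 1) = r := fun α => by rw [zero_div, zero_add]
  have d2 : HasDerivAt ℓ₂ ((q - r) / (2 * r) / α₂ ^ 2) 0 := by
    have := (((hsq α₂).const_add q).log (by rw [e0]; exact hpos.ne')).sub_const (Real.log (q + r))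
    refine this.congr_deriv ?_
    rw [e0, hinv]; field_simp
  have d1 : HasDerivAt ℓ₁ ((q + r) / (2 * r) / α₁ ^ 2) 0 := by
    have := (((hsq α₁).const_sub q).log (by rw [e0]; exact hneg.ne')).neg.sub_const (Real.log (q + r))
    refine this.congr_deriv ?_
    rw [e0, hinv']; field_simp
  have z2 : ℓ₂ 0 = 0 := by rw [hℓ₂]; simp only [e0, sub_self]
  have z1 : ℓ₁ 0 = 0 := by
    rw [hℓ₁]; simp only [e0]
    rw [hinv, Real.log_div one_ne_zero hpos.ne', Real.log_one]; ring
  have hw2 : Tendsto (fun w : ℝ => w ^ 2) (𝓝[≠] 0) (𝓝[≠] 0) := by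
    refine tendsto_nhdsWithin_iff.mpr ⟨?_, ?_⟩
    · have : Tendsto (fun w : ℝ => w ^ 2) (𝓝 0) (𝓝 (0 ^ 2)) := (continuous_pow 2).tendsto 0
      rw [zero_pow two_ne_zero] at this
      exact this.mono_left nhdsWithin_le_nhds
    · filter_upwards [self_mem_nhdsWithin] with w hw
      exact pow_ne_zero 2 hw
  have t2 := (hasDerivAt_iff_tendsto_slope_zero.mp d2).comp hw2
  have t1 := (hasDerivAt_iff_tendsto_slope_zero.mp d1).comp hw2
  refine (t2.min t1).congr' ?_
  have hsmall : ∀ᶠ w : ℝ in 𝓝[≠] 0, (w / α₁) ^ 2 < 1 := by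
    have : ContinuousAt (fun w : ℝ => (w / α₁) ^ 2) 0 := by fun_prop
    exact nhdsWithin_le_nhds (this.eventually_lt continuousAt_const (by simp))
  filter_upwards [hsmall, self_mem_nhdsWithin] with w hw hw0
  have hw0' : 0 < w ^ 2 := by have : w ≠ 0 := hw0; positivity
  simp only [Function.comp_apply, zero_add, z1, z2, sub_zero, smul_eq_mul]
  rw [← mul_min_of_nonneg _ _ (inv_nonneg.mpr hw0'.le), mul_comm, ← div_eq_mul_inv]
  congr 1
  have hl1 : ℓ₁ (w ^ 2) = Real.log (1 / (2 * q - rhoMax q (w / α₁))) - Real.log (q + r) := by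
    rw [hℓ₁]; simp only
    rw [one_div, Real.log_inv, rhoMax, div_pow]; congr 3; ring
  have hl2 : ℓ₂ (w ^ 2) = Real.log (rhoMax q (w / α₂)) - Real.log (q + r) := by
    rw [hℓ₂]; simp only
    rw [rhoMax, div_pow]
  have m1 := rhoMax_mono (q := q) (v := w / α₁)
  have m2 := rhoMax_mono (q := q) (v := w / α₂)
  have r1 := rhoMax_root (q := q) (v := w / α₁) (by nlinarith [sq_nonneg (w / α₁)])
  set P1 := rhoMax q (w / α₁)
  set P2 := rhoMax q (w / α₂)
  rw [hP0] at m1 m2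
  have hD : 0 < 2 * q - P1 := by
    by_contra h; push Not at h; nlinarith
  have hD2 : q + r ≤ 1 / (2 * q - P1) := by
    rw [le_div_iff₀ hD]; nlinarith
  have hset : Ioc (q + r) P2 ∩ {ρ | ρ * (2 * q - P1) ≤ 1} = Ioc (q + r) (min P2 (1 / (2 * q - P1))) := by
    ext ρ
    simp only [mem_inter_iff, mem_Ioc, mem_ofPred_eq, le_min_iff, le_div_iff₀ hD, and_assoc]
  rw [arcMass, arcSet_inter_Ioi hq, hP0, hset, setIntegral_inv_Ioc hpos (le_min m2 hD2), hl1, hl2,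
    min_sub_sub_right]
  congr 1
  rcases le_total P2 (1 / (2 * q - P1)) with h | h
  · rw [min_eq_left h, min_eq_left (Real.log_le_log (by linarith) h)]
  · rw [min_eq_right h, min_eq_right (Real.log_le_log (by linarith) h)]

theorem arcMass_Iio (q α₁ α₂ w : ℝ) :
    arcMass q α₁ α₂ (Iio 1) w = arcMass q α₂ α₁ (Ioi 1) w :=
  integral_arcSet_lt_one q _ _

/-- The part of the arc that belongs to a double coset: `x` is the image of the backward
endpoint, and `σ` the sign of the distance. -/
def arcRegion (x q σ : ℝ) : Set ℝ :=
  if 0 < x then {ρ | -1 < q ∧ (1 < q → 1 < ρ) ∧ (q < 1 → σ = 1)}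
  else {ρ | ¬ (-1 < q ∧ (1 < q → 1 < ρ) ∧ (q < 1 → σ = 1))}

theorem measurableSet_arcRegion (x q σ : ℝ) : MeasurableSet (arcRegion x q σ) := by
  have : MeasurableSet {ρ : ℝ | -1 < q ∧ (1 < q → 1 < ρ) ∧ (q < 1 → σ = 1)} := by
    refine (MeasurableSet.const _).inter (MeasurableSet.inter ?_ (MeasurableSet.const _))
    exact (MeasurableSet.const (1 < q)).imp measurableSet_Ioi
  rw [arcRegion]
  split_ifs
  · exact this
  · exact this.compl

theorem Hsign_eq (x : ℝ) {σ w : ℝ} (h1 : 1 ≤ α₁) (h2 : 1 ≤ α₂) (hq1 : q ≠ 1) (hq2 : q ≠ -1)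
    (hσ : σ = 1 ∨ σ = -1) (hw : 0 < σ * w) :
    Hsign x q (w / α₁) (w / α₂) = arcMass q α₁ α₂ (arcRegion x q σ) w := by
  have p1 : 0 < σ * (w / α₁) := by rw [← mul_div_assoc]; exact div_pos hw (by linarith)
  have p2 : 0 < σ * (w / α₂) := by rw [← mul_div_assoc]; exact div_pos hw (by linarith)
  rw [Hsign, arcMass, arcRegion]
  split_ifs
  · rw [Hplus_eq hq1 hq2 hσ p1 p2]
  · rw [Hminus_eq hq1 hq2 hσ p1 p2]

theorem arcMass_arcRegion_of_gt (hq : 1 < q) (x σ w : ℝ) :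
    arcMass q α₁ α₂ (arcRegion x q σ) w =
      if 0 < x then arcMass q α₁ α₂ (Ioi 1) w else arcMass q α₂ α₁ (Ioi 1) w := by
  rw [← arcMass_Iio q α₁ α₂, arcRegion]
  have h : -1 < q := by linarith
  have h' : ¬ q < 1 := by linarith
  split_ifs
  · simp only [hq, h, h', true_and, forall_const, IsEmpty.forall_iff, and_true]; rfl
  · simp only [hq, h, h', true_and, forall_const, IsEmpty.forall_iff, and_true]
    rw [arcMass, arcMass, arcSet_inter_not_gt hq]

/-- The value at the origin of the contribution to the density. -/
def originValue (x q α₁ α₂ : ℝ) : ℝ :=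
  if 1 < q then
    if 0 < x then min ((q - √(q ^ 2 - 1)) / (2 * √(q ^ 2 - 1)) / α₂ ^ 2)
        ((q + √(q ^ 2 - 1)) / (2 * √(q ^ 2 - 1)) / α₁ ^ 2)
    else min ((q - √(q ^ 2 - 1)) / (2 * √(q ^ 2 - 1)) / α₁ ^ 2)
        ((q + √(q ^ 2 - 1)) / (2 * √(q ^ 2 - 1)) / α₂ ^ 2)
  else 0

/-- The contribution of a double coset to the density, extended continuously to the origin. -/
def termDensity (x q α₁ α₂ w : ℝ) : ℝ :=
  if w = 0 then originValue x q α₁ α₂ else Hsign x q (w / α₁) (w / α₂) / w ^ 2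

theorem originValue_self (x : ℝ) {α : ℝ} :
    originValue x q α α =
      (if 1 < q then (q - √(q ^ 2 - 1)) / (2 * √(q ^ 2 - 1)) else 0) / α ^ 2 := by
  rw [originValue]
  have : (q - √(q ^ 2 - 1)) / (2 * √(q ^ 2 - 1)) / α ^ 2 ≤
      (q + √(q ^ 2 - 1)) / (2 * √(q ^ 2 - 1)) / α ^ 2 := by
    gcongr
    linarith [Real.sqrt_nonneg (q ^ 2 - 1)]
  split_ifs
  · exact min_eq_left this
  · exact min_eq_left this
  · simp

theorem originValue_nonneg (x : ℝ) : 0 ≤ originValue x q α₁ α₂ := by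
  rw [originValue]
  split_ifs with hq hx
  · have hneg : 0 ≤ q - √(q ^ 2 - 1) := by
      rw [sub_nonneg, Real.sqrt_le_left (by linarith)]; linarith
    have := Real.sqrt_nonneg (q ^ 2 - 1)
    apply le_min <;> positivity
  · have hneg : 0 ≤ q - √(q ^ 2 - 1) := by
      rw [sub_nonneg, Real.sqrt_le_left (by linarith)]; linarith
    have := Real.sqrt_nonneg (q ^ 2 - 1)
    apply le_min <;> positivity
  · rfl

theorem Hsign_nonneg (x q v₁ v₂ : ℝ) : 0 ≤ Hsign x q v₁ v₂ := by
  rw [Hsign, Hplus, Hminus]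
  have : ∀ S : Set ℝ, 0 ≤ ∫ s in S, integrand q v₁ v₂ s := fun S =>
    integral_nonneg fun s => integrand_nonneg _ _ _ s
  split_ifs
  · exact this _
  · exact add_nonneg (this _) (this _)

theorem termDensity_nonneg (x w : ℝ) : 0 ≤ termDensity x q α₁ α₂ w := by
  rw [termDensity]
  split_ifs
  · exact originValue_nonneg x
  · exact div_nonneg (Hsign_nonneg _ _ _ _) (sq_nonneg w)

/-- A bound for `termDensity` on `[-V, V]`; it vanishes if `q` is far to the left. -/
def termBound (q V : ℝ) : ℝ :=
  if q < 1 then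
    if V ^ 2 < 2 - 2 * q then 0 else 2 * Real.log (V ^ 2 + 2 * |q| + 2) / (2 - 2 * q)
  else (q - √(q ^ 2 - 1)) / (2 * √(q ^ 2 - 1))

theorem termDensity_le (x : ℝ) (h1 : 1 ≤ α₁) (h2 : 1 ≤ α₂) (hq1 : q ≠ 1) (hq2 : q ≠ -1) {V w : ℝ}
    (hw : |w| ≤ V) : termDensity x q α₁ α₂ w ≤ termBound q V := by
  have hV : w ^ 2 ≤ V ^ 2 := by rw [← sq_abs w]; gcongr
  rw [termDensity, termBound]
  rcases lt_or_gt_of_ne hq1 with hq | hq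
  · rw [if_pos hq, originValue, if_neg hq.le.not_gt]
    have hlog : 0 ≤ Real.log (V ^ 2 + 2 * |q| + 2) :=
      Real.log_nonneg (by nlinarith [sq_nonneg V, abs_nonneg q])
    split_ifs with h0 h3 h3
    · rfl
    · exact div_nonneg (by positivity) (by linarith)
    · obtain ⟨σ, hσ, hσw⟩ := exists_sign h0
      rw [Hsign_eq x h1 h2 hq1 hq2 hσ hσw, arcMass_eq_zero h1 h2 (hV.trans_lt h3), zero_div]
    · obtain ⟨σ, hσ, hσw⟩ := exists_sign h0
      rw [Hsign_eq x h1 h2 hq1 hq2 hσ hσw]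
      rcases lt_or_ge (w ^ 2) (2 - 2 * q) with h4 | h4
      · rw [arcMass_eq_zero h1 h2 h4, zero_div]
        exact div_nonneg (by positivity) (by linarith)
      · gcongr
        · linarith
        · exact arcMass_le h1 h2 hw _
  · rw [if_neg hq.le.not_gt, originValue, if_pos hq]
    have hr : 0 < √(q ^ 2 - 1) := Real.sqrt_pos.mpr (by nlinarith)
    have hneg : 0 ≤ q - √(q ^ 2 - 1) := by
      rw [sub_nonneg, Real.sqrt_le_left (by linarith)]; linarith
    split_ifs with h0 hx
    · exact (min_le_left _ _).trans (div_le_self (by positivity) (one_le_pow₀ h2))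
    · exact (min_le_left _ _).trans (div_le_self (by positivity) (one_le_pow₀ h1))
    · obtain ⟨σ, hσ, hσw⟩ := exists_sign h0
      rw [Hsign_eq x h1 h2 hq1 hq2 hσ hσw, arcMass_arcRegion_of_gt hq, div_le_iff₀ (by positivity)]
      split_ifs
      · exact arcMass_Ioi_le hq h2 w
      · exact arcMass_Ioi_le hq h1 w

theorem continuous_termDensity (x : ℝ) (h1 : 1 ≤ α₁) (h2 : 1 ≤ α₂) (hq1 : q ≠ 1) (hq2 : q ≠ -1) :
    Continuous (termDensity x q α₁ α₂) := by
  rw [continuous_iff_continuousAt]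
  intro w₀
  rcases eq_or_ne w₀ 0 with rfl | hw₀
  · rw [continuousAt_iff_punctured_nhds, termDensity, if_pos rfl, originValue]
    rcases lt_or_gt_of_ne hq1 with hq | hq
    · rw [if_neg hq.le.not_gt]
      apply tendsto_const_nhds.congr'
      have : ∀ᶠ w : ℝ in 𝓝 0, w ^ 2 < 2 - 2 * q :=
        (continuous_pow 2).continuousAt.eventually_lt continuousAt_const (by simpa using hq)
      filter_upwards [nhdsWithin_le_nhds this, self_mem_nhdsWithin] with w hw hw0
      replace hw0 : w ≠ 0 := hw0
      obtain ⟨σ, hσ, hσw⟩ := exists_sign hw0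
      rw [termDensity, if_neg hw0, Hsign_eq x h1 h2 hq1 hq2 hσ hσw, arcMass_eq_zero h1 h2 hw, zero_div]
    · rw [if_pos hq]
      have key : ∀ᶠ w in 𝓝[≠] (0 : ℝ), (if 0 < x then arcMass q α₁ α₂ (Ioi 1) w
          else arcMass q α₂ α₁ (Ioi 1) w) / w ^ 2 = termDensity x q α₁ α₂ w := by
        filter_upwards [self_mem_nhdsWithin] with w hw0
        replace hw0 : w ≠ 0 := hw0
        obtain ⟨σ, hσ, hσw⟩ := exists_sign hw0
        rw [termDensity, if_neg hw0, Hsign_eq x h1 h2 hq1 hq2 hσ hσw, arcMass_arcRegion_of_gt hq]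
      refine Tendsto.congr' key ?_
      split_ifs
      · exact tendsto_arcMass_Ioi hq h1 h2
      · exact tendsto_arcMass_Ioi hq h2 h1
  · obtain ⟨σ, hσ, hσw⟩ := exists_sign hw₀
    apply ContinuousAt.congr (f := fun w => arcMass q α₁ α₂ (arcRegion x q σ) w / w ^ 2)
    · exact (continuous_arcMass h1 h2 (measurableSet_arcRegion x q σ)).continuousAt.div
        (continuousAt_id.pow 2) (pow_ne_zero 2 hw₀)
    · have : ∀ᶠ w in 𝓝 w₀, 0 < σ * w :=
        continuousAt_const.eventually_lt (by fun_prop) hσw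
      filter_upwards [this] with w hw
      have hw0 : w ≠ 0 := by rintro rfl; simp at hw
      rw [termDensity, if_neg hw0, Hsign_eq x h1 h2 hq1 hq2 hσ hw]

/-- A geodesic disjoint from the given one contributes an even function. -/
theorem termDensity_neg_of_abs (x : ℝ) (h1 : 1 ≤ α₁) (h2 : 1 ≤ α₂) (hq : 1 < |q|) (w : ℝ) :
    termDensity x q α₁ α₂ (-w) = termDensity x q α₁ α₂ w := by
  have hq1 : q ≠ 1 := by rintro rfl; norm_num at hq
  have hq2 : q ≠ -1 := by rintro rfl; norm_num at hq
  rw [termDensity, termDensity]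
  rcases eq_or_ne w 0 with rfl | hw
  · simp
  obtain ⟨σ, hσ, hσw⟩ := exists_sign hw
  rw [if_neg (neg_ne_zero.mpr hw), if_neg hw, Hsign_eq x h1 h2 hq1 hq2 hσ hσw,
    Hsign_eq (σ := -σ) x h1 h2 hq1 hq2 (by rcases hσ with rfl | rfl <;> simp) (by linarith),
    arcMass_neg, neg_sq]
  have : arcRegion x q (-σ) = arcRegion x q σ := by
    rcases lt_abs.mp hq with h | h
    · have h' : ¬ q < 1 := by linarith
      simp [arcRegion, h']
    · have h' : ¬ -1 < q := by linarith
      simp [arcRegion, h']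
  rw [this]

/-- For intersecting geodesics, reflection of the distance is the change of the sign of the backward
endpoint. -/
theorem termDensity_neg_of_abs_lt {x y : ℝ} (hxy : 0 < x ↔ ¬ 0 < y) (h1 : 1 ≤ α₁) (h2 : 1 ≤ α₂)
    (hq : |q| < 1) (w : ℝ) : termDensity x q α₁ α₂ (-w) = termDensity y q α₁ α₂ w := by
  obtain ⟨hq2, hq1⟩ := abs_lt.mp hq
  rw [termDensity, termDensity]
  rcases eq_or_ne w 0 with rfl | hw
  · simp [originValue, hq1.le.not_gt]
  obtain ⟨σ, hσ, hσw⟩ := exists_sign hw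
  rw [if_neg (neg_ne_zero.mpr hw), if_neg hw, Hsign_eq y h1 h2 hq1.ne hq2.ne' hσ hσw,
    Hsign_eq (σ := -σ) x h1 h2 hq1.ne hq2.ne' (by rcases hσ with rfl | rfl <;> simp) (by linarith),
    arcMass_neg, neg_sq]
  have : arcRegion x q (-σ) = arcRegion y q σ := by
    have h' : ¬ 1 < q := by linarith
    have n1 : ¬ (-1 : ℝ) = 1 := by norm_num
    by_cases hy : 0 < y
    · have hx : ¬ 0 < x := fun h => hxy.mp h hy
      rcases hσ with rfl | rfl <;> simp [arcRegion, hx, hy, hq1, hq2, h', n1]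
    · have hx : 0 < x := hxy.mpr hy
      rcases hσ with rfl | rfl <;> simp [arcRegion, hx, hy, hq1, hq2, h', n1]
  rw [this]

/-! #### Summability of the bounds -/

theorem eventually_lt_abs_of_summable {ι : Type*} {q : ι → ℝ}
    (hs : Summable fun i => ((1 + |q i|) ^ 2)⁻¹) (R : ℝ) : ∀ᶠ i in cofinite, R < |q i| := by
  have h := hs.tendsto_cofinite_zero.eventually_lt_const
    (show (0 : ℝ) < ((1 + |R|) ^ 2)⁻¹ by positivity)
  filter_upwards [h] with i hi
  rw [inv_lt_inv₀ (by positivity) (by positivity)] at hi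
  have := lt_of_pow_lt_pow_left₀ 2 (by positivity) hi
  linarith [le_abs_self R]

/-- As `|q| → ∞`, the bound vanishes on the left and decays like `(4q²)⁻¹` on the right. -/
theorem summable_termBound {ι : Type*} {q : ι → ℝ} (hs : Summable fun i => ((1 + |q i|) ^ 2)⁻¹)
    (V : ℝ) : Summable fun i => termBound (q i) V := by
  apply Summable.of_norm_bounded_eventually (hs.mul_left 9)
  filter_upwards [eventually_lt_abs_of_summable hs (2 + V ^ 2)] with i hi
  have hV := sq_nonneg V
  rw [termBound]
  split_ifs with h1 h2
  · rw [norm_zero]; positivity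
  · have := abs_of_nonneg (a := q i)
    rcases le_or_gt 0 (q i) with h | h
    · rw [abs_of_nonneg h] at hi; linarith
    · rw [abs_of_neg h] at hi; exfalso; apply h2; linarith
  · push Not at h1
    rw [abs_of_pos (by linarith)] at hi ⊢
    have hr2 := Real.sq_sqrt (show 0 ≤ q i ^ 2 - 1 by nlinarith)
    have hr : q i / 2 ≤ √(q i ^ 2 - 1) := Real.le_sqrt_of_sq_le (by nlinarith)
    have hle : √(q i ^ 2 - 1) ≤ q i := by rw [Real.sqrt_le_left (by linarith)]; linarith
    set r := √(q i ^ 2 - 1)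
    have hr0 : 0 < r := by linarith
    rw [Real.norm_of_nonneg (div_nonneg (by linarith) (by linarith)), ← div_eq_mul_inv,
      div_le_div_iff₀ (by positivity) (by positivity)]
    have e : (q i - r) * (q i + r) = 1 := by linear_combination -hr2
    have h3 : (q i - r) * q i ≤ 1 := by nlinarith
    nlinarith [mul_nonneg (sub_nonneg.mpr hle) (show 0 ≤ q i by linarith)]

/-! ### Matrix entries -/

section Entries

variable (A B : SL(2, ℝ))

theorem mul_apply_eq (i j : Fin 2) : (A * B) i j = A i 0 * B 0 j + A i 1 * B 1 j := by
  rw [Matrix.SpecialLinearGroup.coe_mul, Matrix.mul_apply, Fin.sum_univ_two]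

theorem det_eq : A 0 0 * A 1 1 - A 0 1 * A 1 0 = 1 := by
  rw [← Matrix.det_fin_two, A.det_coe]

theorem inv_00 : A⁻¹ 0 0 = A 1 1 := by rw [Matrix.SpecialLinearGroup.SL2_inv_expl]; rfl
theorem inv_01 : A⁻¹ 0 1 = -A 0 1 := by rw [Matrix.SpecialLinearGroup.SL2_inv_expl]; rfl
theorem inv_10 : A⁻¹ 1 0 = -A 1 0 := by rw [Matrix.SpecialLinearGroup.SL2_inv_expl]; rfl
theorem inv_11 : A⁻¹ 1 1 = A 0 0 := by rw [Matrix.SpecialLinearGroup.SL2_inv_expl]; rfl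

theorem neg_apply_eq (i j : Fin 2) : (-A) i j = -A i j := by
  rw [Matrix.SpecialLinearGroup.coe_neg, Matrix.neg_apply]

variable {A B}

theorem ext_entries (h00 : A 0 0 = B 0 0) (h01 : A 0 1 = B 0 1) (h10 : A 1 0 = B 1 0)
    (h11 : A 1 1 = B 1 1) : A = B := by
  ext i j
  fin_cases i <;> fin_cases j <;> assumption

variable {t : ℝ}

theorem dMat_00 (ht : t ≠ 0) : dMat t 0 0 = t := by rw [dMat_val ht]; rfl
theorem dMat_01 (ht : t ≠ 0) : dMat t 0 1 = 0 := by rw [dMat_val ht]; rfl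
theorem dMat_10 (ht : t ≠ 0) : dMat t 1 0 = 0 := by rw [dMat_val ht]; rfl
theorem dMat_11 (ht : t ≠ 0) : dMat t 1 1 = t⁻¹ := by rw [dMat_val ht]; rfl

theorem revMat_00 : revMat 0 0 = 0 := rfl
theorem revMat_01 : revMat 0 1 = -1 := rfl
theorem revMat_10 : revMat 1 0 = 1 := rfl
theorem revMat_11 : revMat 1 1 = 0 := rfl

theorem one_00 : (1 : SL(2, ℝ)) 0 0 = 1 := rfl
theorem one_01 : (1 : SL(2, ℝ)) 0 1 = 0 := rfl
theorem one_10 : (1 : SL(2, ℝ)) 1 0 = 0 := rfl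
theorem one_11 : (1 : SL(2, ℝ)) 1 1 = 1 := rfl

theorem nMat_00 (x : ℝ) : nMat x 0 0 = 1 := rfl
theorem nMat_01 (x : ℝ) : nMat x 0 1 = x := rfl
theorem nMat_10 (x : ℝ) : nMat x 1 0 = 0 := rfl
theorem nMat_11 (x : ℝ) : nMat x 1 1 = 1 := rfl

theorem dMat_zpow (ht : t ≠ 0) (n : ℤ) : dMat t ^ n = dMat (t ^ n) := by
  have hnat : ∀ n : ℕ, dMat t ^ n = dMat (t ^ n) := by
    intro n
    induction n with
    | zero => rw [pow_zero, pow_zero, dMat_one]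
    | succ n ih => rw [pow_succ, pow_succ, ih, dMat_mul (pow_ne_zero n ht) ht]
  cases n with
  | ofNat n => simpa using hnat n
  | negSucc n => rw [zpow_negSucc, zpow_negSucc, hnat, dMat_inv (pow_ne_zero _ ht)]

end Entries

/-! ### Consequences of discreteness -/

theorem neg_one_mem {Γ : Subgroup SL(2, ℝ)} (hcusp : HasCuspOfWidthOne Γ) : -1 ∈ Γ := by
  have : (-1 : SL(2, ℝ)) ∈ {γ : SL(2, ℝ) | γ ∈ Γ ∧ ∃ x : ℝ, γ = nMat x ∨ γ = -nMat x} := by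
    rw [hcusp]
    refine ⟨0, Or.inr ?_⟩
    congr 1
    apply ext_entries <;> simp [nMat]
  exact this.1

theorem neg_mem_iff' {Γ : Subgroup SL(2, ℝ)} (h1 : -1 ∈ Γ) (γ : SL(2, ℝ)) : -γ ∈ Γ ↔ γ ∈ Γ := by
  rw [← neg_one_mul, Subgroup.mul_mem_cancel_left _ h1]

/-- The sum of the squares of the entries, that is `2 cosh d(i, M i)`. -/
def normSq (M : SL(2, ℝ)) : ℝ := M 0 0 ^ 2 + M 0 1 ^ 2 + M 1 0 ^ 2 + M 1 1 ^ 2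

/-- A discrete subgroup is closed, so it meets the compact sets of matrices in finite sets. -/
theorem finite_normSq_le {Γ : Subgroup SL(2, ℝ)} [DiscreteTopology Γ] (g g' : SL(2, ℝ)) (R : ℝ) :
    {γ : Γ | normSq (g⁻¹ * γ * g') ≤ R}.Finite := by
  have hR : IsCompact {M : SL(2, ℝ) | normSq M ≤ R} := by
    have hc : IsCompact {M : Matrix (Fin 2) (Fin 2) ℝ | ∀ i j, M i j ∈ Icc (-√R) √R} := by
      have := isCompact_univ_pi (X := fun _ : Fin 2 => Fin 2 → ℝ) (s := fun _ => {v | ∀ j, v j ∈ Icc (-√R) √R})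
        (fun i => isCompact_pi_infinite fun j => isCompact_Icc)
      refine this.of_isClosed_subset ?_ fun M hM i _ j => hM i j
      have e : {M : Matrix (Fin 2) (Fin 2) ℝ | ∀ i j, M i j ∈ Icc (-√R) √R} =
          ⋂ i, ⋂ j, (fun M : Matrix (Fin 2) (Fin 2) ℝ => M i j) ⁻¹' Icc (-√R) √R := by
        ext M; simp
      rw [e]
      exact isClosed_iInter fun i => isClosed_iInter fun j =>
        isClosed_Icc.preimage (by fun_prop)
    refine (Matrix.SpecialLinearGroup.isClosedEmbedding_val.isCompact_preimage hc).of_isClosed_subset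
      ?_ ?_
    · refine isClosed_le ?_ continuous_const
      unfold normSq
      fun_prop
    · intro (M : SL(2, ℝ)) hM i j
      rw [mem_Icc, ← abs_le]
      apply Real.le_sqrt_of_sq_le
      rw [sq_abs]
      refine le_trans ?_ (show normSq M ≤ R from hM)
      rw [normSq]
      fin_cases i <;> fin_cases j <;> simp <;>
        nlinarith [sq_nonneg (M 0 0), sq_nonneg (M 0 1), sq_nonneg (M 1 0), sq_nonneg (M 1 1)]
  have hK : IsCompact ((fun M => g * M * g'⁻¹) '' {M : SL(2, ℝ) | normSq M ≤ R}) :=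
    hR.image (by fun_prop)
  have hd : IsDiscrete (Γ : Set SL(2, ℝ)) := ⟨by assumption⟩
  have ht := (Subgroup.tendsto_coe_cofinite_of_discrete Γ hd) hK.compl_mem_cocompact
  rw [mem_map, mem_cofinite] at ht
  refine ht.subset fun γ hγ => ?_
  simp only [mem_compl_iff, mem_preimage, not_not]
  exact ⟨_, hγ, by group⟩

theorem isClosedGeodesic_iff {Γ : Subgroup SL(2, ℝ)} (h1 : -1 ∈ Γ) (g : SL(2, ℝ)) :
    IsClosedGeodesic Γ g ↔ ∃ t : ℝ, 1 < t ∧ g * dMat t * g⁻¹ ∈ Γ := by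
  simp only [IsClosedGeodesic, periods, neg_mem_iff' h1, or_self]
  rfl

theorem IsClosedGeodesic.smul {Γ : Subgroup SL(2, ℝ)} {g : SL(2, ℝ)} (h : IsClosedGeodesic Γ g)
    {γ : SL(2, ℝ)} (hγ : γ ∈ Γ) : IsClosedGeodesic Γ (γ * g) := by
  obtain ⟨t, h1, h2⟩ := h
  have e : γ * g * dMat t * (γ * g)⁻¹ = γ * (g * dMat t * g⁻¹) * γ⁻¹ := by group
  refine ⟨t, h1, h2.imp (fun h => ?_) (fun h => ?_)⟩
  · rw [e]; exact Γ.mul_mem (Γ.mul_mem hγ h) (Γ.inv_mem hγ)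
  · rw [e, ← neg_mul, ← mul_neg]
    exact Γ.mul_mem (Γ.mul_mem hγ h) (Γ.inv_mem hγ)

theorem IsClosedGeodesic.rev {Γ : Subgroup SL(2, ℝ)} {g : SL(2, ℝ)} (h1 : -1 ∈ Γ)
    (h : IsClosedGeodesic Γ g) : IsClosedGeodesic Γ (g * revMat) := by
  rw [isClosedGeodesic_iff h1] at h ⊢
  obtain ⟨t, ht, h2⟩ := h
  have ht0 : t ≠ 0 := by linarith
  refine ⟨t, ht, ?_⟩
  have e : revMat * dMat t * revMat⁻¹ = (dMat t)⁻¹ := by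
    rw [dMat_inv ht0]
    have ht1 := inv_ne_zero ht0
    apply ext_entries <;>
    simp [mul_apply_eq, inv_00, inv_01, inv_10, inv_11, dMat_00 ht0, dMat_01 ht0, dMat_10 ht0,
      dMat_11 ht0, dMat_00 ht1, dMat_01 ht1, dMat_10 ht1, dMat_11 ht1, revMat_00, revMat_01,
      revMat_10, revMat_11]
  have : g * revMat * dMat t * (g * revMat)⁻¹ = (g * dMat t * g⁻¹)⁻¹ := by
    calc _ = g * (revMat * dMat t * revMat⁻¹) * g⁻¹ := by group
      _ = _ := by rw [e]; group
  rw [this]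
  exact Γ.inv_mem h2

section Endpoints

variable {Γ : Subgroup SL(2, ℝ)} {g g' : SL(2, ℝ)}

/-- If two closed geodesics share an endpoint, conjugating one translation by the powers of the
other gives infinitely many elements in a bounded set, unless they share both endpoints. -/
theorem entry_01_eq_zero [DiscreteTopology Γ] (h1 : -1 ∈ Γ) (hg : IsClosedGeodesic Γ g)
    (hg' : IsClosedGeodesic Γ g') (h : (g⁻¹ * g') 1 0 = 0) : (g⁻¹ * g') 0 1 = 0 := by
  rw [isClosedGeodesic_iff h1] at hg hg'
  obtain ⟨t, ht, hδ⟩ := hg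
  obtain ⟨s, hs, hδ'⟩ := hg'
  have ht0 : t ≠ 0 := by linarith
  have hs0 : s ≠ 0 := by linarith
  by_contra hb
  set m := g⁻¹ * g' with hm
  have hdet := det_eq m
  rw [h, mul_zero, sub_zero] at hdet
  set δ : Γ := ⟨_, hδ⟩
  set δ' : Γ := ⟨_, hδ'⟩
  set x := m 0 0 * m 0 1 * (s⁻¹ - s) with hx
  have hx0 : x ≠ 0 := by
    have : m 0 0 ≠ 0 := left_ne_zero_of_mul_eq_one hdet
    have h3 : s⁻¹ - s ≠ 0 := by
      have := inv_lt_one_of_one_lt₀ hs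
      intro h; linarith
    positivity
  have hconj : ∀ n : ℕ, g⁻¹ * ((δ ^ (-(n : ℤ)) * δ' * δ ^ (n : ℤ) : Γ) : SL(2, ℝ)) * g =
      dMat (t ^ (-(n : ℤ))) * (m * dMat s * m⁻¹) * dMat (t ^ (n : ℤ)) := by
    intro n
    rw [← dMat_zpow ht0, ← dMat_zpow ht0]
    simp only [Subgroup.coe_mul, Subgroup.coe_zpow, δ, δ', conj_zpow, hm]
    group
  have hent : ∀ n : ℕ, ∀ γ, γ = g⁻¹ * ((δ ^ (-(n : ℤ)) * δ' * δ ^ (n : ℤ) : Γ) : SL(2, ℝ)) * g →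
      γ 0 0 = s ∧ γ 0 1 = ((t ^ n)⁻¹) ^ 2 * x ∧ γ 1 0 = 0 ∧ γ 1 1 = s⁻¹ := by
    rintro n γ rfl
    have htn : t ^ n ≠ 0 := pow_ne_zero n ht0
    rw [hconj, zpow_neg, zpow_natCast]
    simp only [mul_apply_eq, inv_00, inv_01, inv_10, inv_11, dMat_val hs0, dMat_val htn,
      dMat_val (inv_ne_zero htn), h]
    simp only [Matrix.of_apply, Matrix.cons_val', Matrix.cons_val_zero, Matrix.cons_val_one,
      Matrix.cons_val_fin_one]
    refine ⟨?_, ?_, ?_, ?_⟩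
    · field_simp; linear_combination (t ^ n * s ^ 2) * hdet
    · rw [hx]; field_simp; ring
    · ring
    · field_simp; linear_combination t ^ n * hdet
  have hfin := finite_normSq_le (Γ := Γ) g g (s ^ 2 + x ^ 2 + (s⁻¹) ^ 2)
  refine Set.infinite_of_injective_forall_mem (f := fun n : ℕ => δ ^ (-(n : ℤ)) * δ' * δ ^ (n : ℤ))
    ?_ ?_ hfin
  · intro n k hnk
    have e1 := (hent n _ rfl).2.1
    have e2 := (hent k _ rfl).2.1
    simp only at hnk
    rw [hnk, e2] at e1
    have e3 := mul_right_cancel₀ hx0 e1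
    rw [sq_eq_sq₀ (by positivity) (by positivity), inv_inj] at e3
    exact (pow_right_injective₀ (by linarith) ht.ne' e3).symm
  · intro n
    obtain ⟨a, b, c, d⟩ := hent n _ rfl
    rw [mem_ofPred_eq, normSq, a, b, c, d]
    have : ((t ^ n)⁻¹) ≤ 1 := inv_le_one_of_one_le₀ (one_le_pow₀ ht.le)
    have h0 : 0 ≤ (t ^ n)⁻¹ := by positivity
    have h4 : ((t ^ n)⁻¹) ^ 4 ≤ 1 := pow_le_one₀ h0 this
    have : (((t ^ n)⁻¹) ^ 2 * x) ^ 2 ≤ x ^ 2 := by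
      calc _ = ((t ^ n)⁻¹) ^ 4 * x ^ 2 := by ring
        _ ≤ 1 * x ^ 2 := by gcongr
        _ = _ := one_mul _
    linarith

/-- Two closed geodesics that differ, up to orientation, share no endpoint: a zero entry of `g⁻¹ g'`
is a common endpoint, and by `entry_01_eq_zero` the other endpoints then agree as well. -/
theorem entries_ne_zero [DiscreteTopology Γ] (h1 : -1 ∈ Γ) (hg : IsClosedGeodesic Γ g)
    (hg' : IsClosedGeodesic Γ g') (hne : ¬ SameGeodesic g' g) (hne' : ¬ SameGeodesic g' (g * revMat)) :
    (g⁻¹ * g') 0 0 ≠ 0 ∧ (g⁻¹ * g') 0 1 ≠ 0 ∧ (g⁻¹ * g') 1 0 ≠ 0 ∧ (g⁻¹ * g') 1 1 ≠ 0 := by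
  have k1 := entry_01_eq_zero h1 hg hg'
  have k2 := entry_01_eq_zero h1 (hg.rev h1) hg'
  have k3 := entry_01_eq_zero h1 hg (hg'.rev h1)
  have k4 := entry_01_eq_zero h1 (hg.rev h1) (hg'.rev h1)
  rw [mul_inv_rev, mul_assoc] at k2
  rw [← mul_assoc] at k3
  rw [mul_inv_rev, mul_assoc, ← mul_assoc g⁻¹] at k4
  have hdet := det_eq (g⁻¹ * g')
  have hgm : g' = g * (g⁻¹ * g') := by group
  set m := g⁻¹ * g' with hm
  simp only [mul_apply_eq revMat⁻¹, mul_apply_eq m revMat, inv_00, inv_01, inv_10, inv_11, revMat_00, revMat_01,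
    revMat_10, revMat_11, zero_mul, mul_zero, zero_add, add_zero, mul_one, mul_neg, neg_mul, one_mul,
    neg_zero, neg_eq_zero, neg_neg] at k2 k3 k4
  have offdiag : m 0 1 = 0 → m 1 0 = 0 → False := by
    intro hb hc
    rw [hb, zero_mul, sub_zero] at hdet
    have ha : m 0 0 ≠ 0 := left_ne_zero_of_mul_eq_one hdet
    have hd : m 1 1 = (m 0 0)⁻¹ := eq_inv_of_mul_eq_one_right hdet
    apply hne
    refine ⟨|m 0 0|⁻¹, inv_pos.mpr (abs_pos.mpr ha), ?_⟩
    have hz : |m 0 0|⁻¹ ≠ 0 := inv_ne_zero (abs_ne_zero.mpr ha)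
    rw [hgm]
    rcases abs_choice (m 0 0) with h | h
    · left
      have : m * dMat |m 0 0|⁻¹ = 1 := by
        apply ext_entries <;>
        simp only [mul_apply_eq, dMat_00 hz, dMat_01 hz, dMat_10 hz, dMat_11 hz,
          one_00, one_01, one_10, one_11, hb, hc, hd] <;>
        simp [h, ha]
      rw [mul_assoc, this, mul_one]
    · right
      have : -(m * dMat |m 0 0|⁻¹) = 1 := by
        apply ext_entries <;>
        simp only [neg_apply_eq, mul_apply_eq, dMat_00 hz, dMat_01 hz, dMat_10 hz, dMat_11 hz,
          one_00, one_01, one_10, one_11, hb, hc, hd] <;>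
        simp [h, ha]
      rw [mul_assoc, ← mul_neg, this, mul_one]
  have diag : m 0 0 = 0 → m 1 1 = 0 → False := by
    intro ha hd
    rw [ha, zero_mul, zero_sub] at hdet
    have hdet' : m 0 1 * (-m 1 0) = 1 := by linarith
    have hb : m 0 1 ≠ 0 := left_ne_zero_of_mul_eq_one hdet'
    have hc : m 1 0 = -(m 0 1)⁻¹ := by
      rw [← eq_inv_of_mul_eq_one_right hdet', neg_neg]
    apply hne'
    refine ⟨|m 0 1|, abs_pos.mpr hb, ?_⟩
    have hz : |m 0 1| ≠ 0 := abs_ne_zero.mpr hb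
    rw [hgm, mul_assoc]
    rcases abs_choice (m 0 1) with h | h
    · right
      have : revMat = -(m * dMat |m 0 1|) := by
        apply ext_entries <;>
        simp only [neg_apply_eq, mul_apply_eq, dMat_00 hz, dMat_01 hz, dMat_10 hz, dMat_11 hz,
          revMat_00, revMat_01, revMat_10, revMat_11, ha, hc, hd] <;>
        simp [h, hb]
      rw [← mul_neg, ← this]
    · left
      have : revMat = m * dMat |m 0 1| := by
        apply ext_entries <;>
        simp only [mul_apply_eq, dMat_00 hz, dMat_01 hz, dMat_10 hz, dMat_11 hz,
          revMat_00, revMat_01, revMat_10, revMat_11, ha, hc, hd] <;>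
        simp [h, hb]
      rw [← this]
  exact ⟨fun h => diag h (k2 h), fun h => offdiag h (k4 h), fun h => offdiag (k1 h) h, fun h => diag (k3 h) h⟩

/-- No endpoint of a closed geodesic is the cusp `∞`: otherwise conjugation by a translation
along it would shrink `n(1)` to `n(t⁻²)`. -/
theorem entry_10_ne_zero (hcusp : HasCuspOfWidthOne Γ) (hg : IsClosedGeodesic Γ g) : g 1 0 ≠ 0 := by
  intro h
  have h1 := neg_one_mem hcusp
  rw [isClosedGeodesic_iff h1] at hg
  obtain ⟨t, ht, hδ⟩ := hg
  have ht0 : t ≠ 0 := by linarith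
  have hn : nMat 1 ∈ Γ := by
    have : nMat 1 ∈ {γ : SL(2, ℝ) | γ ∈ Γ ∧ ∃ x : ℝ, γ = nMat x ∨ γ = -nMat x} := by
      rw [hcusp]; exact ⟨1, Or.inl (by simp)⟩
    exact this.1
  have hdet := det_eq g
  rw [h, mul_zero, sub_zero] at hdet
  have hconj : nMat ((t ^ 2)⁻¹) ∈ Γ := by
    have e : nMat ((t ^ 2)⁻¹) = (g * dMat t * g⁻¹)⁻¹ * nMat 1 * (g * dMat t * g⁻¹) := by
      rw [mul_assoc, eq_inv_mul_iff_mul_eq]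
      apply ext_entries <;>
      simp only [mul_apply_eq, inv_00, inv_01, inv_10, inv_11, dMat_00 ht0, dMat_01 ht0, dMat_10 ht0,
        dMat_11 ht0, nMat_00, nMat_01, nMat_10, nMat_11, h] <;> field_simp <;> ring_nf
    rw [e]
    exact Γ.mul_mem (Γ.mul_mem (Γ.inv_mem hδ) hn) hδ
  have : nMat ((t ^ 2)⁻¹) ∈ {γ : SL(2, ℝ) | γ ∈ Γ ∧ ∃ x : ℝ, γ = nMat x ∨ γ = -nMat x} :=
    ⟨hconj, _, Or.inl rfl⟩
  rw [hcusp] at this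
  obtain ⟨k, hk | hk⟩ := this
  · have e : (t ^ 2)⁻¹ = (k : ℝ) := by
      have := congrArg (fun M : SL(2, ℝ) => M 0 1) hk
      simpa only [nMat_01] using this
    have l1 : (0 : ℝ) < k := by rw [← e]; positivity
    have l2 : (k : ℝ) < 1 := by rw [← e]; exact inv_lt_one_of_one_lt₀ (one_lt_pow₀ ht two_ne_zero)
    norm_cast at l1 l2
    omega
  · have := congrArg (fun M : SL(2, ℝ) => M 0 0) hk
    simp only [nMat_00, neg_apply_eq] at this
    norm_num at this

theorem entry_11_ne_zero (hcusp : HasCuspOfWidthOne Γ) (hg : IsClosedGeodesic Γ g) : g 1 1 ≠ 0 := by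
  have := entry_10_ne_zero hcusp (hg.rev (neg_one_mem hcusp))
  simpa [mul_apply_eq, revMat_00, revMat_10] using this

end Endpoints

/-! ### The stabiliser of a closed geodesic -/

section Stabiliser

variable {Γ : Subgroup SL(2, ℝ)} {g : SL(2, ℝ)}

theorem normSq_dMat {t : ℝ} (ht : t ≠ 0) : normSq (dMat t) = t ^ 2 + (t⁻¹) ^ 2 := by
  rw [normSq, dMat_00 ht, dMat_01 ht, dMat_10 ht, dMat_11 ht]; ring

theorem epsilon_mem_periods [DiscreteTopology Γ] (h1 : -1 ∈ Γ) (hg : IsClosedGeodesic Γ g) :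
    IsLeast (periods Γ g) (epsilon Γ g) := by
  have hper : ∀ t, t ∈ periods Γ g ↔ 1 < t ∧ g * dMat t * g⁻¹ ∈ Γ := by
    intro t; simp only [periods, mem_ofPred_eq, neg_mem_iff' h1, or_self]
  obtain ⟨t₀, ht₀⟩ := hg
  have hfin : {t | t ∈ periods Γ g ∧ t ≤ t₀}.Finite := by
    have h := finite_normSq_le (Γ := Γ) g g (t₀ ^ 2 + 1)
    refine (h.image fun γ : Γ => (g⁻¹ * (γ : SL(2, ℝ)) * g) 0 0).subset ?_
    rintro t ⟨ht, hle⟩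
    obtain ⟨ht1, hmem⟩ := (hper t).mp ht
    have ht0 : t ≠ 0 := by linarith
    have e : g⁻¹ * (g * dMat t * g⁻¹) * g = dMat t := by group
    refine ⟨⟨_, hmem⟩, ?_, ?_⟩
    · rw [mem_ofPred_eq, e, normSq_dMat ht0]
      have : t⁻¹ ≤ 1 := inv_le_one_of_one_le₀ ht1.le
      have : 0 ≤ t⁻¹ := by positivity
      nlinarith
    · simp only [e, dMat_00 ht0]
  obtain ⟨m, ⟨hm, hmle⟩, hmin⟩ := hfin.exists_minimal ⟨t₀, ht₀, le_rfl⟩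
  have : IsLeast (periods Γ g) m := by
    refine ⟨hm, fun t ht => ?_⟩
    rcases le_total t t₀ with h | h
    · by_contra hlt
      push Not at hlt
      exact hlt.not_ge (hmin ⟨ht, h⟩ hlt.le)
    · exact hmle.trans h
  rw [epsilon, this.csInf_eq]
  exact this

theorem one_lt_epsilon [DiscreteTopology Γ] (h1 : -1 ∈ Γ) (hg : IsClosedGeodesic Γ g) :
    1 < epsilon Γ g := (epsilon_mem_periods h1 hg).1.1

/-- The stabiliser of a closed geodesic is generated, up to sign, by the translation by its
length. -/
theorem exists_generator [DiscreteTopology Γ] (h1 : -1 ∈ Γ) (hg : IsClosedGeodesic Γ g) :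
    ∃ δ : Γ, (δ : SL(2, ℝ)) = g * dMat (epsilon Γ g) * g⁻¹ ∧
      (∀ n : ℤ, ((δ ^ n : Γ) : SL(2, ℝ)) = g * dMat (epsilon Γ g ^ n) * g⁻¹) ∧
      (∀ n : ℤ, δ ^ n ∈ stab Γ g) ∧
      ∀ γ ∈ stab Γ g, ∃ n : ℤ, (γ : SL(2, ℝ)) = (δ ^ n : Γ) ∨ (γ : SL(2, ℝ)) = -(δ ^ n : Γ) := by
  have hle := epsilon_mem_periods h1 hg
  set ε := epsilon Γ g
  have hε1 : 1 < ε := hle.1.1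
  have hε0 : ε ≠ 0 := by linarith
  have hmem : g * dMat ε * g⁻¹ ∈ Γ := hle.1.2.elim id (fun h => (neg_mem_iff' h1 _).mp h)
  have hpow : ∀ n : ℤ, (((⟨_, hmem⟩ : Γ) ^ n : Γ) : SL(2, ℝ)) = g * dMat (ε ^ n) * g⁻¹ := by
    intro n
    rw [Subgroup.coe_zpow, conj_zpow, dMat_zpow hε0]
  refine ⟨⟨_, hmem⟩, rfl, hpow, fun n => ⟨ε ^ n, zpow_pos (by linarith) n, Or.inl (hpow n)⟩, ?_⟩
  rintro γ ⟨t, ht, h⟩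
  have hγ : g * dMat t * g⁻¹ ∈ Γ := by
    rcases h with h | h
    · rw [← h]; exact γ.2
    · rw [← neg_mem_iff' h1, ← h]; exact γ.2
  obtain ⟨n, hn1, hn2⟩ := exists_mem_Ico_zpow ht hε1
  have hεn : 0 < ε ^ n := zpow_pos (by linarith) n
  have hkey : t = ε ^ n := by
    have hdiv : g * dMat (t * (ε ^ n)⁻¹) * g⁻¹ ∈ Γ := by
      have : g * dMat (t * (ε ^ n)⁻¹) * g⁻¹ = g * dMat t * g⁻¹ * (g * dMat (ε ^ n) * g⁻¹)⁻¹ := by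
        rw [← dMat_mul ht.ne' (inv_ne_zero hεn.ne'), ← dMat_inv hεn.ne']; group
      rw [this, ← hpow]
      exact Γ.mul_mem hγ (Γ.inv_mem (Subtype.property _))
    have l1 : 1 ≤ t * (ε ^ n)⁻¹ := by rw [← div_eq_mul_inv, one_le_div hεn]; exact hn1
    have l2 : t * (ε ^ n)⁻¹ < ε := by
      rw [← div_eq_mul_inv, div_lt_iff₀ hεn]
      calc t < ε ^ (n + 1) := hn2
        _ = ε * ε ^ n := by rw [zpow_add_one₀ hε0, mul_comm]
    rcases l1.eq_or_lt with h | h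
    · rw [← div_eq_mul_inv, eq_div_iff hεn.ne'] at h; linarith
    · exact absurd (hle.2 ⟨h, Or.inl hdiv⟩) l2.not_ge
  refine ⟨n, ?_⟩
  rw [hpow, ← hkey]
  exact h

end Stabiliser

/-! ### The tops of the geodesics seen from the section -/

/-- The geodesic `c(M)` has finite endpoints, and its top has real part in `I` and imaginary part
at least `α`. -/
def HasTopIn (I : Set ℝ) (α : ℝ) (M : SL(2, ℝ)) : Prop :=
  M 1 0 ≠ 0 ∧ M 1 1 ≠ 0 ∧ (forwardEnd M + backwardEnd M) / 2 ∈ I ∧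
    α ≤ (forwardEnd M - backwardEnd M) / 2

theorem geodesic_re_im (M : SL(2, ℝ)) {t : ℝ} (ht : 0 < t) :
    ((M * dMat t) • UpperHalfPlane.I).re =
      (M 1 0 * M 0 0 * (t ^ 2) ^ 2 + M 0 1 * M 1 1) / (M 1 0 ^ 2 * (t ^ 2) ^ 2 + M 1 1 ^ 2) ∧
    ((M * dMat t) • UpperHalfPlane.I).im =
      t ^ 2 / (M 1 0 ^ 2 * (t ^ 2) ^ 2 + M 1 1 ^ 2) := by
  have hdet := det_eq M
  have hpos : 0 < M 1 0 ^ 2 * (t ^ 2) ^ 2 + M 1 1 ^ 2 := by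
    by_contra h
    push Not at h
    have e1 : M 1 0 = 0 := by
      by_contra h'
      have : 0 < M 1 0 ^ 2 * (t ^ 2) ^ 2 := by positivity
      nlinarith [sq_nonneg (M 1 1)]
    have e2 : M 1 1 = 0 := by
      rw [e1] at h
      have : M 1 1 ^ 2 ≤ 0 := by nlinarith
      exact pow_eq_zero_iff two_ne_zero |>.mp (le_antisymm this (sq_nonneg _))
    rw [e1, e2] at hdet
    norm_num at hdet
  have hden : Complex.normSq ((M 1 0 * t : ℝ) * Complex.I + (M 1 1 * t⁻¹ : ℝ)) =
      (M 1 0 ^ 2 * (t ^ 2) ^ 2 + M 1 1 ^ 2) / t ^ 2 := by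
    simp [Complex.normSq_apply]
    field_simp
    ring
  have hc := UpperHalfPlane.coe_specialLinearGroup_apply (M * dMat t) UpperHalfPlane.I
  simp only [mul_apply_eq, dMat_00 ht.ne', dMat_01 ht.ne', dMat_10 ht.ne', dMat_11 ht.ne', mul_zero,
    add_zero, zero_add, Algebra.algebraMap_self, RingHom.id_apply, UpperHalfPlane.coe_I] at hc
  constructor
  · rw [← UpperHalfPlane.coe_re, hc, Complex.div_re, hden]
    simp
    field_simp
    ring
  · rw [← UpperHalfPlane.coe_im, hc, Complex.div_im, hden]
    simp
    field_simp
    linear_combination (M 1 1 ^ 2 + M 1 0 ^ 2 * t ^ 4)⁻¹ * hdet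

/-- The top of a geodesic lies over the midpoint of its endpoints, at the height of the radius. -/
theorem isTop_strip_iff {I : Set ℝ} {α : ℝ} (hα : 0 < α) (M : SL(2, ℝ)) :
    (IsPositivelyOriented M ∧ ∃ z ∈ strip I α, IsTop M z) ↔ HasTopIn I α M := by
  have hdet := det_eq M
  have hdiff : M 1 0 ≠ 0 → M 1 1 ≠ 0 → forwardEnd M - backwardEnd M = 1 / (M 1 0 * M 1 1) := by
    intro hc hd
    rw [forwardEnd, backwardEnd]; field_simp; linarith
  have hsum : M 1 0 ≠ 0 → M 1 1 ≠ 0 →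
      forwardEnd M + backwardEnd M = (M 0 0 * M 1 1 + M 0 1 * M 1 0) / (M 1 0 * M 1 1) := by
    intro hc hd
    rw [forwardEnd, backwardEnd]; field_simp
  set a := M 0 0
  set b := M 0 1
  set c := M 1 0
  set d := M 1 1
  have him : ∀ τ : ℝ, 0 < c * d → 0 < τ → τ / (c ^ 2 * τ ^ 2 + d ^ 2) ≤ 1 / (2 * (c * d)) := by
    intro τ hcd hτ
    have hd : d ≠ 0 := right_ne_zero_of_mul hcd.ne'
    rw [div_le_div_iff₀ (by positivity) (by positivity)]
    nlinarith [sq_nonneg (c * τ - d)]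
  have htop : ∀ τ : ℝ, 0 < c * d → τ = d / c → τ / (c ^ 2 * τ ^ 2 + d ^ 2) = 1 / (2 * (c * d)) ∧
      (c * a * τ ^ 2 + b * d) / (c ^ 2 * τ ^ 2 + d ^ 2) = (a * d + b * c) / (c * d) / 2 := by
    rintro τ hcd rfl
    have hd : d ≠ 0 := right_ne_zero_of_mul hcd.ne'
    have hc : c ≠ 0 := left_ne_zero_of_mul hcd.ne'
    have e : c ^ 2 * (d / c) ^ 2 + d ^ 2 = 2 * d ^ 2 := by field_simp; ring
    rw [e]
    constructor <;> field_simp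
  constructor
  · rintro ⟨⟨hc, hd, hlt⟩, z, hz, ⟨t, ht, rfl⟩, hmax⟩
    have hcd : 0 < c * d := by
      have := hdiff hc hd
      have h2 : 0 < 1 / (c * d) := by linarith
      exact one_div_pos.mp h2
    obtain ⟨hre, him1⟩ := geodesic_re_im M ht
    have hτ0 : 0 < d / c := by
      have : d / c = c * d / c ^ 2 := by field_simp
      rw [this]; positivity
    have hsqrt : √(d / c) ^ 2 = d / c := Real.sq_sqrt hτ0.le
    have hm := hmax _ ⟨√(d / c), Real.sqrt_pos.mpr hτ0, rfl⟩
    rw [(geodesic_re_im M (Real.sqrt_pos.mpr hτ0)).2, him1, hsqrt, (htop _ hcd rfl).1] at hm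
    have hτ : t ^ 2 = d / c := by
      have hd' : d ≠ 0 := hd
      rw [div_le_div_iff₀ (by positivity) (by positivity)] at hm
      have : (c * t ^ 2 - d) ^ 2 ≤ 0 := by nlinarith
      have : c * t ^ 2 - d = 0 := pow_eq_zero_iff two_ne_zero |>.mp (le_antisymm this (sq_nonneg _))
      rw [eq_div_iff hc]; linarith
    obtain ⟨hz1, hz2⟩ := hz
    rw [hre, (htop _ hcd hτ).2] at hz1
    rw [him1, (htop _ hcd hτ).1] at hz2
    refine ⟨hc, hd, ?_, ?_⟩
    · rw [hsum hc hd]; exact hz1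
    · rw [hdiff hc hd]; refine hz2.trans_eq ?_; field_simp
  · rintro ⟨hc, hd, hI, hle⟩
    have hlt : backwardEnd M < forwardEnd M := by linarith
    have hcd : 0 < c * d := by
      have := hdiff hc hd
      have h2 : 0 < 1 / (c * d) := by linarith
      exact one_div_pos.mp h2
    have hτ0 : 0 < d / c := by
      have : d / c = c * d / c ^ 2 := by field_simp
      rw [this]; positivity
    have hsqrt : √(d / c) ^ 2 = d / c := Real.sq_sqrt hτ0.le
    obtain ⟨hre, him1⟩ := geodesic_re_im M (Real.sqrt_pos.mpr hτ0)
    rw [hsqrt, (htop _ hcd rfl).2] at hre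
    rw [hsqrt, (htop _ hcd rfl).1] at him1
    refine ⟨⟨hc, hd, hlt⟩, _, ⟨?_, ?_⟩, ⟨√(d / c), Real.sqrt_pos.mpr hτ0, rfl⟩, ?_⟩
    · rw [hre, ← hsum hc hd]; exact hI
    · rw [him1]
      refine hle.trans_eq ?_
      rw [hdiff hc hd]; field_simp
    · rintro w ⟨t, ht, rfl⟩
      rw [him1, (geodesic_re_im M ht).2]
      exact him _ hcd (by positivity)

theorem hasTopIn_mul_dMat {I : Set ℝ} {α : ℝ} (M : SL(2, ℝ)) {t : ℝ} (ht : 0 < t) :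
    HasTopIn I α (M * dMat t) ↔ HasTopIn I α M := by
  have h1 : forwardEnd (M * dMat t) = forwardEnd M := by
    simp only [forwardEnd, mul_apply_eq, dMat_00 ht.ne', dMat_10 ht.ne', mul_zero, add_zero]
    rw [mul_div_mul_right _ _ ht.ne']
  have h2 : backwardEnd (M * dMat t) = backwardEnd M := by
    simp only [backwardEnd, mul_apply_eq, dMat_01 ht.ne', dMat_11 ht.ne', mul_zero, zero_add]
    rw [mul_div_mul_right _ _ (inv_ne_zero ht.ne')]
  rw [HasTopIn, HasTopIn, h1, h2]
  simp [mul_apply_eq, dMat_00 ht.ne', dMat_01 ht.ne', dMat_10 ht.ne', dMat_11 ht.ne', ht.ne']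

theorem hasTopIn_neg {I : Set ℝ} {α : ℝ} (M : SL(2, ℝ)) :
    HasTopIn I α (-M) ↔ HasTopIn I α M := by
  simp [HasTopIn, forwardEnd, backwardEnd, neg_apply_eq, neg_div_neg_eq]

theorem mem_countSet_iff {Γ : Subgroup SL(2, ℝ)} {g₀ u : SL(2, ℝ)} {I : Set ℝ} {α : ℝ} (hα : 0 < α)
    (γ : Γ) : (γ : Γ ⧸ stab Γ g₀) ∈ countSet Γ g₀ (strip I α) u ↔
      HasTopIn I α (u⁻¹ * γ * g₀) := by
  rw [countSet, mem_ofPred_eq]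
  simp only [isTop_strip_iff hα]
  constructor
  · rintro ⟨γ', h, hγ'⟩
    obtain ⟨t, ht, h' | h'⟩ := QuotientGroup.eq.mp h
    · have : (γ : SL(2, ℝ)) = γ' * (g₀ * dMat t * g₀⁻¹) := by
        rw [← h', Subgroup.coe_mul, Subgroup.coe_inv]; group
      have e : u⁻¹ * γ * g₀ = u⁻¹ * γ' * g₀ * dMat t := by rw [this]; group
      rwa [e, hasTopIn_mul_dMat _ ht]
    · have : (γ : SL(2, ℝ)) = -(γ' * (g₀ * dMat t * g₀⁻¹)) := by
        rw [← mul_neg, ← h', Subgroup.coe_mul, Subgroup.coe_inv]; group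
      have e : u⁻¹ * γ * g₀ = -(u⁻¹ * γ' * g₀ * dMat t) := by
        rw [this, mul_neg, neg_mul]; congr 1; group
      rwa [e, hasTopIn_neg, hasTopIn_mul_dMat _ ht]
  · intro h
    exact ⟨γ, rfl, h⟩

/-- The parameters `(s, v)` for which the geodesic `c(m)` has its top in the strip, when it is
seen from the point of the section with these parameters. -/
def topSet (I : Set ℝ) (α : ℝ) (m : SL(2, ℝ)) : Set (ℝ × ℝ) :=
  {p | p.2 * ((m 0 0 * m 0 1 - m 1 0 * m 1 1 * p.1 ^ 2) /
      ((m 0 0 + m 1 0 * p.1) * (m 0 1 + m 1 1 * p.1))) ∈ I ∧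
    α ≤ p.2 * (p.1 / ((m 0 0 + m 1 0 * p.1) * (m 0 1 + m 1 1 * p.1)))}

/-- Seen from the point of the section, the geodesic `c(g)` is moved along itself by `a(s)⁻¹`,
rotated by `k(π/2)` to the geodesic from `-1` to `1`, and scaled by `a(v)` to the height `v`. -/
theorem hasTopIn_iff_mem_topSet {I : Set ℝ} {α : ℝ} (hα : 0 < α) (g γ g' : SL(2, ℝ)) {s v : ℝ}
    (hs : 0 < s) (hv : 0 < v) :
    HasTopIn I α ((g * aMat s * kMat (-(Real.pi / 2)) * aMat v⁻¹)⁻¹ * γ * g') ↔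
      (s, v) ∈ topSet I α (g⁻¹ * γ * g') := by
  have e : (g * aMat s * kMat (-(Real.pi / 2)) * aMat v⁻¹)⁻¹ * γ * g' =
      (aMat v⁻¹)⁻¹ * ((kMat (-(Real.pi / 2)))⁻¹ * ((aMat s)⁻¹ * (g⁻¹ * γ * g'))) := by group
  rw [e]
  set m := g⁻¹ * γ * g'
  have hdet := det_eq m
  have hx : √s ≠ 0 := (Real.sqrt_pos.mpr hs).ne'
  have hy : √v⁻¹ ≠ 0 := (Real.sqrt_pos.mpr (inv_pos.mpr hv)).ne'
  have hx2 : √s ^ 2 = s := Real.sq_sqrt hs.le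
  have hy2 : √v⁻¹ ^ 2 = v⁻¹ := Real.sq_sqrt (inv_pos.mpr hv).le
  have hcos : Real.cos (-(Real.pi / 2) / 2) = √2 / 2 := by
    rw [show -(Real.pi / 2) / 2 = -(Real.pi / 4) by ring, Real.cos_neg, Real.cos_pi_div_four]
  have hsin : Real.sin (-(Real.pi / 2) / 2) = -(√2 / 2) := by
    rw [show -(Real.pi / 2) / 2 = -(Real.pi / 4) by ring, Real.sin_neg, Real.sin_pi_div_four]
  have k00 : kMat (-(Real.pi / 2)) 0 0 = √2 / 2 := hcos
  have k01 : kMat (-(Real.pi / 2)) 0 1 = √2 / 2 := by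
    change -Real.sin _ = _; rw [hsin, neg_neg]
  have k10 : kMat (-(Real.pi / 2)) 1 0 = -(√2 / 2) := hsin
  have k11 : kMat (-(Real.pi / 2)) 1 1 = √2 / 2 := hcos
  rw [aMat, aMat, dMat_inv hx, dMat_inv hy]
  set κ := √2 / 2 with hκ
  have hκ0 : κ ≠ 0 := by rw [hκ]; positivity
  set x := √s
  set y := √v⁻¹
  have hx' := inv_ne_zero hx
  have hy' := inv_ne_zero hy
  rw [HasTopIn, topSet, mem_ofPred_eq, forwardEnd, backwardEnd]
  simp only [mul_apply_eq, inv_00, inv_01, inv_10, inv_11, dMat_00 hx', dMat_01 hx', dMat_10 hx',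
    dMat_11 hx', dMat_00 hy', dMat_01 hy', dMat_10 hy', dMat_11 hy', k00, k01, k10, k11, zero_mul,
    add_zero, zero_add, inv_inv, neg_neg]
  set a := m 0 0
  set b := m 0 1
  set c := m 1 0
  set d := m 1 1
  have f1 : y * (κ * (x⁻¹ * a) + κ * (x * c)) = y * κ * x⁻¹ * (a + c * s) := by
    rw [← hx2]; field_simp
  have f2 : y * (κ * (x⁻¹ * b) + κ * (x * d)) = y * κ * x⁻¹ * (b + d * s) := by
    rw [← hx2]; field_simp
  have f3 : y⁻¹ * (κ * (x⁻¹ * a) + -κ * (x * c)) = y⁻¹ * κ * x⁻¹ * (a - c * s) := by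
    rw [← hx2]; field_simp; ring
  have f4 : y⁻¹ * (κ * (x⁻¹ * b) + -κ * (x * d)) = y⁻¹ * κ * x⁻¹ * (b - d * s) := by
    rw [← hx2]; field_simp; ring
  rw [f1, f2, f3, f4]
  have hv2 : y⁻¹ ^ 2 = v := by rw [inv_pow, hy2, inv_inv]
  have hne : y * κ * x⁻¹ ≠ 0 := mul_ne_zero (mul_ne_zero hy hκ0) hx'
  have g1 : ∀ p r : ℝ, y⁻¹ * κ * x⁻¹ * p / (y * κ * x⁻¹ * r) = v * (p / r) := by
    intro p r
    rw [← hv2]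
    rcases eq_or_ne r 0 with rfl | hr
    · simp
    · field_simp
  have g2 : ∀ r : ℝ, y * κ * x⁻¹ * r ≠ 0 ↔ r ≠ 0 :=
    fun r => ⟨right_ne_zero_of_mul, mul_ne_zero hne⟩
  rw [g1, g1, g2, g2]
  by_cases h1 : a + c * s = 0
  · simp [h1, hα.not_ge]
  by_cases h2 : b + d * s = 0
  · simp [h2, hα.not_ge]
  rw [and_iff_right h1, and_iff_right h2]
  have e1 : (v * ((a - c * s) / (a + c * s)) + v * ((b - d * s) / (b + d * s))) / 2 =
      v * ((a * b - c * d * s ^ 2) / ((a + c * s) * (b + d * s))) := by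
    rw [← mul_add, div_add_div _ _ h1 h2, show (a - c * s) * (b + d * s) + (a + c * s) *
      (b - d * s) = 2 * (a * b - c * d * s ^ 2) by ring]
    ring
  have e2 : (v * ((a - c * s) / (a + c * s)) - v * ((b - d * s) / (b + d * s))) / 2 =
      v * (s / ((a + c * s) * (b + d * s))) := by
    rw [← mul_sub, div_sub_div _ _ h1 h2, show (a - c * s) * (b + d * s) - (a + c * s) *
      (b - d * s) = 2 * s by linear_combination (2 * s) * hdet]
    ring
  rw [e1, e2]

/-! ### The contribution of a double coset to the intensity -/

theorem lintegral_comp_mul_inv {k : ℝ} (hk : k ≠ 0) (f : ℝ → ℝ≥0∞) :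
    ∫⁻ v, f v = ∫⁻ w, ENNReal.ofReal |k⁻¹| * f (w * k⁻¹) := by
  have hk' := inv_ne_zero hk
  have h := lintegral_image_eq_lintegral_abs_deriv_mul (f := fun w => w * k⁻¹) (f' := fun _ => k⁻¹)
    MeasurableSet.univ (fun w _ => (by simpa using (hasDerivAt_id w).mul_const k⁻¹ :
      HasDerivAt (fun w => w * k⁻¹) k⁻¹ w).hasDerivWithinAt)
    (mul_left_injective₀ hk').injOn f
  have himg : (fun w => w * k⁻¹) '' univ = univ := by
    rw [image_univ]; exact (mul_right_surjective₀ hk').range_eq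
  rwa [himg, setLIntegral_univ, setLIntegral_univ] at h

section

variable (a b c d : ℝ)

/-- The real part of the top, for `v = 1`. -/
def topRe (s : ℝ) : ℝ := (a * b - c * d * s ^ 2) / ((a + c * s) * (b + d * s))

/-- The imaginary part of the top, for `v = 1`. -/
def topIm (s : ℝ) : ℝ := s / ((a + c * s) * (b + d * s))

/-- The pairs `(s, w)` for which, at the height `v` that places the top over `w`, both `v` and the
height of the top are large enough. -/
def levelSet (α₁ α₂ : ℝ) : Set (ℝ × ℝ) :=
  {p | α₁ ≤ p.2 * (topRe a b c d p.1)⁻¹ ∧ α₂ ≤ p.2 * (topRe a b c d p.1)⁻¹ * topIm a b c d p.1}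

theorem measurable_topRe : Measurable (topRe a b c d) := by unfold topRe; fun_prop

theorem measurable_topIm : Measurable (topIm a b c d) := by unfold topIm; fun_prop

theorem measurableSet_levelSet (α₁ α₂ : ℝ) : MeasurableSet (levelSet a b c d α₁ α₂) := by
  have h1 : Measurable (fun p : ℝ × ℝ => topRe a b c d p.1) :=
    (measurable_topRe a b c d).comp measurable_fst
  have h2 : Measurable (fun p : ℝ × ℝ => topIm a b c d p.1) :=
    (measurable_topIm a b c d).comp measurable_fst
  have h3 : Measurable (fun p : ℝ × ℝ => p.2 * (topRe a b c d p.1)⁻¹) := measurable_snd.mul h1.inv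
  exact (measurableSet_le measurable_const h3).inter (measurableSet_le measurable_const (h3.mul h2))

/-- The substitution of the distance `w` between the tops for the height `v`. -/
theorem lintegral_height {α₁ α₂ s : ℝ} (hα : 1 ≤ α₁) (hs : 0 < s) (hk : topRe a b c d s ≠ 0) {I : Set ℝ}
    (hI : MeasurableSet I) :
    ∫⁻ v in Ici α₁, {v | v * topRe a b c d s ∈ I ∧ α₂ ≤ v * topIm a b c d s}.indicator
        (fun v => ENNReal.ofReal (1 / (s * v ^ 2))) v =
      ∫⁻ w in I, (levelSet a b c d α₁ α₂).indicator
        (fun p => ENNReal.ofReal (|topRe a b c d p.1| / (p.1 * p.2 ^ 2))) (s, w) := by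
  set k := topRe a b c d s with hkdef
  rw [← lintegral_indicator measurableSet_Ici, ← lintegral_indicator hI, lintegral_comp_mul_inv hk]
  refine lintegral_congr fun w => ?_
  have hw : w * k⁻¹ * k = w := by field_simp
  by_cases h1 : w ∈ I
  swap
  · rw [indicator_of_notMem h1]
    by_cases h2 : w * k⁻¹ ∈ Ici α₁
    · rw [indicator_of_mem h2, indicator_of_notMem, mul_zero]
      rintro ⟨h, -⟩
      rw [hw] at h
      exact h1 h
    · rw [indicator_of_notMem h2, mul_zero]
  rw [indicator_of_mem h1]
  by_cases h2 : w * k⁻¹ ∈ Ici α₁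
  swap
  · rw [indicator_of_notMem h2, indicator_of_notMem (fun h => h2 h.1), mul_zero]
  rw [indicator_of_mem h2]
  by_cases h3 : α₂ ≤ w * k⁻¹ * topIm a b c d s
  swap
  · rw [indicator_of_notMem (fun h => h3 h.2), indicator_of_notMem (fun h => h3 h.2), mul_zero]
  rw [indicator_of_mem (show w * k⁻¹ ∈ {v | v * k ∈ I ∧ α₂ ≤ v * topIm a b c d s} from
      ⟨by rw [hw]; exact h1, h3⟩),
    indicator_of_mem (show (s, w) ∈ levelSet a b c d α₁ α₂ from ⟨h2, h3⟩),
    ← ENNReal.ofReal_mul (abs_nonneg _)]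
  congr 1
  have hw0 : w ≠ 0 := by
    rintro rfl
    rw [zero_mul, mem_Ici] at h2
    linarith
  simp only
  rw [← hkdef, abs_inv]
  have : k ^ 2 = |k| ^ 2 := (sq_abs k).symm
  have hk0 : |k| ≠ 0 := abs_ne_zero.mpr hk
  field_simp
  rw [this]

end

/-- The Möbius transformation `σ ↦ A (1 - σ) / (1 + σ)`, which sends `-1`, `1` to `∞`, `0`. -/
def cayley (A σ : ℝ) : ℝ := A * ((1 - σ) / (1 + σ))

/-- The domain of integration of `H_+` if `A > 0`, and of `H_-` otherwise. -/
def cayleyDomain (A : ℝ) : Set ℝ := if 0 < A then Ioo (-1) 1 else Iio (-1) ∪ Ioi 1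

theorem measurableSet_cayleyDomain (A : ℝ) : MeasurableSet (cayleyDomain A) := by
  rw [cayleyDomain]; split_ifs
  · exact measurableSet_Ioo
  · exact measurableSet_Iio.union measurableSet_Ioi

theorem cayleyDomain_ne {A σ : ℝ} (h : σ ∈ cayleyDomain A) : 1 + σ ≠ 0 ∧ 1 - σ ≠ 0 := by
  rw [cayleyDomain] at h
  split_ifs at h
  · exact ⟨by linarith [h.1], by linarith [h.2]⟩
  · rcases h with h | h
    · rw [mem_Iio] at h; exact ⟨by linarith, by linarith⟩
    · rw [mem_Ioi] at h; exact ⟨by linarith, by linarith⟩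

theorem cayley_pos {A σ : ℝ} (hA : A ≠ 0) (h : σ ∈ cayleyDomain A) : 0 < cayley A σ := by
  rw [cayleyDomain] at h
  rw [cayley]
  split_ifs at h with hA'
  · exact mul_pos hA' (div_pos (by linarith [h.2]) (by linarith [h.1]))
  · have hA'' : A < 0 := lt_of_le_of_ne (not_lt.mp hA') hA
    apply mul_pos_of_neg_of_neg hA''
    rcases h with h | h
    · rw [mem_Iio] at h; exact div_neg_of_pos_of_neg (by linarith) (by linarith)
    · rw [mem_Ioi] at h; exact div_neg_of_neg_of_pos (by linarith) (by linarith)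

theorem cayley_image {A : ℝ} (hA : A ≠ 0) : cayley A '' cayleyDomain A = Ioi 0 \ {-A} := by
  ext s
  constructor
  · rintro ⟨σ, hσ, rfl⟩
    refine ⟨cayley_pos hA hσ, fun h => ?_⟩
    obtain ⟨h1, h2⟩ := cayleyDomain_ne hσ
    rw [mem_singleton_iff, cayley] at h
    field_simp at h
    linarith
  · rintro ⟨hs, hsA⟩
    rw [mem_Ioi] at hs
    rw [mem_singleton_iff] at hsA
    have hne : A + s ≠ 0 := fun h => hsA (by linarith)
    refine ⟨(A - s) / (A + s), ?_, ?_⟩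
    · rw [cayleyDomain]
      split_ifs with hA'
      · constructor
        · rw [lt_div_iff₀ (by linarith)]; linarith
        · rw [div_lt_one (by linarith)]; linarith
      · have hA'' : A < 0 := lt_of_le_of_ne (not_lt.mp hA') hA
        rcases lt_or_gt_of_ne hne with h | h
        · right; rw [mem_Ioi, lt_div_iff_of_neg h]; linarith
        · left; rw [mem_Iio, div_lt_iff₀ h]; linarith
    · have e1 : 1 - (A - s) / (A + s) = 2 * s / (A + s) := by field_simp; ring
      have e2 : 1 + (A - s) / (A + s) = 2 * A / (A + s) := by field_simp; ring
      rw [cayley, e1, e2]; field_simp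

theorem hasDerivAt_cayley (A : ℝ) {σ : ℝ} (h : 1 + σ ≠ 0) :
    HasDerivAt (cayley A) (A * (-2 / (1 + σ) ^ 2)) σ := by
  have h1 : HasDerivAt (fun σ : ℝ => 1 - σ) (-1) σ := (hasDerivAt_id σ).const_sub 1
  have h2 : HasDerivAt (fun σ : ℝ => 1 + σ) 1 σ := (hasDerivAt_id σ).const_add 1
  refine ((h1.div h2 h).const_mul A).congr_deriv ?_
  congr 2
  ring

theorem cayley_injOn {A : ℝ} (hA : A ≠ 0) : InjOn (cayley A) (cayleyDomain A) := by
  intro σ hσ τ hτ h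
  obtain ⟨h1, -⟩ := cayleyDomain_ne hσ
  obtain ⟨h2, -⟩ := cayleyDomain_ne hτ
  have h3 := mul_left_cancel₀ hA h
  rw [div_eq_div_iff h1 h2] at h3
  linarith

theorem lintegral_integrand {x q v₁ v₂ : ℝ} (h1 : q ≠ 1) (h2 : q ≠ -1) :
    ∫⁻ σ in cayleyDomain x, ENNReal.ofReal (integrand q v₁ v₂ σ) =
      ENNReal.ofReal (Hsign x q v₁ v₂) := by
  have key : ∀ S : Set ℝ, ∫⁻ σ in S, ENNReal.ofReal (integrand q v₁ v₂ σ) =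
      ENNReal.ofReal (∫ σ in S, integrand q v₁ v₂ σ) := fun S => by
    rw [ofReal_integral_eq_lintegral_ofReal (integrableOn_integrand h1 h2 S)
      (Eventually.of_forall fun σ => integrand_nonneg _ _ _ σ)]
  rw [cayleyDomain, Hsign]
  split_ifs
  · rw [key, Hplus]
  · rw [key, Hminus, setIntegral_union _ measurableSet_Ioi (integrableOn_integrand h1 h2 _)
      (integrableOn_integrand h1 h2 _)]
    rw [Set.disjoint_left]
    intro y hy hy'
    rw [mem_Iio] at hy
    rw [mem_Ioi] at hy'
    linarith

section

variable {a b c d : ℝ}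

/-- The substitution `s = cayley (b / d) σ` turns the integral along the geodesic into the one that
defines `H_±`. -/
theorem lintegral_level {α₁ α₂ w : ℝ} (h1 : 1 ≤ α₁) (h2 : 1 ≤ α₂) (hw : w ≠ 0)
    (hdet : a * d - b * c = 1) (ha : a ≠ 0) (hb : b ≠ 0) (hc : c ≠ 0) (hd : d ≠ 0) :
    ∫⁻ s in Ioi 0, (levelSet a b c d α₁ α₂).indicator
        (fun p => ENNReal.ofReal (|topRe a b c d p.1| / (p.1 * p.2 ^ 2))) (s, w) =
      ENNReal.ofReal (Hsign (b / d) (a * d + b * c) (w / α₁) (w / α₂) / w ^ 2) := by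
  set A := b / d with hA
  have hA0 : A ≠ 0 := div_ne_zero hb hd
  set q := a * d + b * c with hq
  have hq1 : q ≠ 1 := by
    intro h
    have : b * c = 0 := by linarith
    rcases mul_eq_zero.mp this with h | h <;> contradiction
  have hq2 : q ≠ -1 := by
    intro h
    have : a * d = 0 := by linarith
    rcases mul_eq_zero.mp this with h | h <;> contradiction
  have hae : (Ioi 0 \ {-A} : Set ℝ) =ᵐ[volume] Ioi 0 := by
    apply sdiff_null_ae_eq_self; simp
  rw [← setLIntegral_congr hae, ← cayley_image hA0,
    lintegral_image_eq_lintegral_abs_deriv_mul (measurableSet_cayleyDomain A)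
      (fun σ hσ => (hasDerivAt_cayley A (cayleyDomain_ne hσ).1).hasDerivWithinAt) (cayley_injOn hA0)]
  rw [ENNReal.ofReal_div_of_pos (by positivity), ← lintegral_integrand hq1 hq2, div_eq_mul_inv,
    ← lintegral_mul_const' _ _ (by
      rw [ne_eq, ENNReal.inv_eq_top, ENNReal.ofReal_eq_zero]
      exact (show 0 < w ^ 2 by positivity).not_ge)]
  refine setLIntegral_congr_fun (measurableSet_cayleyDomain A) fun σ hσ => ?_
  rw [← div_eq_mul_inv, ← ENNReal.ofReal_div_of_pos (by positivity)]
  obtain ⟨hσ1, hσ2⟩ := cayleyDomain_ne hσ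
  have hs := cayley_pos hA0 hσ
  set s := cayley A σ with hsdef
  set D := σ ^ 2 + 2 * q * σ + 1 with hD
  have hsd : d * s * (1 + σ) = b * (1 - σ) := by rw [hsdef, cayley, hA]; field_simp
  have hnum : (a * b - c * d * s ^ 2) = A * D / (1 + σ) ^ 2 := by
    rw [eq_div_iff (pow_ne_zero 2 hσ1), hA, div_mul_eq_mul_div, eq_div_iff hd]
    have e1 : c * d * s ^ 2 * (1 + σ) ^ 2 * d = c * (b * (1 - σ)) ^ 2 := by rw [← hsd]; ring
    rw [hD, hq]
    linear_combination -e1 + b * (σ ^ 2 + 1) * hdet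
  have hden : (a + c * s) * (b + d * s) = A * (2 * (σ + q)) / (1 + σ) ^ 2 := by
    rw [eq_div_iff (pow_ne_zero 2 hσ1), hA, div_mul_eq_mul_div, eq_div_iff hd]
    have e1 : (a + c * s) * (1 + σ) * d = a * d * (1 + σ) + c * (b * (1 - σ)) := by
      rw [← hsd]; ring
    have e2 : (b + d * s) * (1 + σ) = 2 * b := by linear_combination hsd
    calc (a + c * s) * (b + d * s) * (1 + σ) ^ 2 * d =
        ((a + c * s) * (1 + σ) * d) * ((b + d * s) * (1 + σ)) := by ring
      _ = _ := by rw [e1, e2, hq]; linear_combination (2 * b * σ) * hdet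
  have hRe : topRe a b c d s = D / (2 * (σ + q)) := by
    rw [topRe, hnum, hden, div_div_div_cancel_right₀ (pow_ne_zero 2 hσ1), mul_div_mul_left _ _ hA0]
  have c1 : α₁ ≤ w * (topRe a b c d s)⁻¹ ↔ 1 ≤ 2 * (w / α₁) * ((σ + q) / D) := by
    rw [hRe, inv_div, show 2 * (w / α₁) * ((σ + q) / D) = w * (2 * (σ + q) / D) / α₁ by ring,
      one_le_div (by linarith)]
  have c2 : σ + q ≠ 0 → D ≠ 0 → (α₂ ≤ w * (topRe a b c d s)⁻¹ * topIm a b c d s ↔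
      1 ≤ w / α₂ * ((1 - σ ^ 2) / D)) := by
    intro hq0 hD0
    have : (topRe a b c d s)⁻¹ * topIm a b c d s = (1 - σ ^ 2) / D := by
      rw [hRe, topIm, hden, hsdef, cayley]; field_simp; ring
    rw [mul_assoc, this, div_mul_eq_mul_div, one_le_div (by linarith)]
  rw [integrand_eq_indicator]
  by_cases hmem : σ ∈ activeSet q (w / α₁) (w / α₂)
  · obtain ⟨hD0, hσq, -⟩ := activeSet_ne hmem
    have : (s, w) ∈ levelSet a b c d α₁ α₂ := ⟨c1.mpr hmem.1, (c2 hσq hD0).mpr hmem.2⟩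
    rw [indicator_of_mem hmem, indicator_of_mem this, ← ENNReal.ofReal_mul (abs_nonneg _)]
    congr 1
    simp only
    rw [hRe, ← abs_of_pos hs, hsdef, cayley]
    simp only [abs_mul, abs_div, abs_neg, abs_two, abs_pow]
    have n1 := abs_ne_zero.mpr hA0
    have n2 := abs_ne_zero.mpr hσ1
    have n3 := abs_ne_zero.mpr hσ2
    have n4 := abs_ne_zero.mpr hσq
    have e : |σ ^ 2 - 1| = |1 + σ| * |1 - σ| := by
      rw [← abs_mul, ← abs_neg]; congr 1; ring
    rw [e, ← hD]
    have n5 : |D| ≠ 0 := abs_ne_zero.mpr hD0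
    field_simp
  · rw [indicator_of_notMem hmem, indicator_of_notMem, mul_zero, zero_div, ENNReal.ofReal_zero]
    rintro ⟨m1, m2⟩
    have hDq : D ≠ 0 ∧ σ + q ≠ 0 := by
      simp only at m1
      rw [hRe] at m1
      constructor
      · intro h; rw [h] at m1; simp at m1; linarith
      · intro h; rw [h] at m1; simp at m1; linarith
    exact hmem ⟨c1.mp m1, (c2 hDq.2 hDq.1).mp m2⟩

end

/-- The pairs of parameters that count a generic double coset contribute to the intensity the
integral of its term over `I`. -/
theorem lintegral_topSet {m : SL(2, ℝ)} (h00 : m 0 0 ≠ 0) (h01 : m 0 1 ≠ 0) (h10 : m 1 0 ≠ 0)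
    (h11 : m 1 1 ≠ 0) {α₁ α₂ : ℝ} (h1 : 1 ≤ α₁) (h2 : 1 ≤ α₂) {I : Set ℝ} (hI : MeasurableSet I) :
    ∫⁻ s in Ioi 0, ∫⁻ v in Ici α₁, (topSet I α₂ m).indicator
        (fun p => ENNReal.ofReal (1 / (p.1 * p.2 ^ 2))) (s, v) =
      ∫⁻ w in I, ENNReal.ofReal (Hsign (m 0 1 / m 1 1) (m 0 0 * m 1 1 + m 0 1 * m 1 0)
        (w / α₁) (w / α₂) / w ^ 2) := by
  have hdet := det_eq m
  set a := m 0 0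
  set b := m 0 1
  set c := m 1 0
  set d := m 1 1
  have hfin : {s : ℝ | topRe a b c d s = 0}.Finite := by
    have : {s : ℝ | topRe a b c d s = 0} ⊆
        {s | s = -a / c} ∪ {s | s = -b / d} ∪ {s : ℝ | s ^ 2 = a * b / (c * d)} := by
      intro s hs
      rw [mem_ofPred_eq, topRe, div_eq_zero_iff, mul_eq_zero] at hs
      rcases hs with h | h | h
      · right; rw [mem_ofPred_eq]; field_simp; linarith
      · left; left; rw [mem_ofPred_eq]; field_simp; linarith
      · left; right; rw [mem_ofPred_eq]; field_simp; linarith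
    refine Finite.subset ?_ this
    refine ((Set.toFinite {-a / c}).union (Set.toFinite {-b / d})).union ?_
    have := finite_setOf_quadratic_eq 0 (a * b / (c * d) + 1)
    simpa using this
  have hae : ∀ᵐ s : ℝ, topRe a b c d s ≠ 0 := by
    have := hfin.measure_zero volume
    rwa [measure_eq_zero_iff_ae_notMem] at this
  calc _ = ∫⁻ s in Ioi 0, ∫⁻ w in I, (levelSet a b c d α₁ α₂).indicator
        (fun p => ENNReal.ofReal (|topRe a b c d p.1| / (p.1 * p.2 ^ 2))) (s, w) := by
        apply setLIntegral_congr_fun_ae measurableSet_Ioi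
        filter_upwards [hae] with s hs hs0
        rw [← lintegral_height a b c d h1 hs0 hs hI]
        rfl
    _ = ∫⁻ w in I, ∫⁻ s in Ioi 0, (levelSet a b c d α₁ α₂).indicator
        (fun p => ENNReal.ofReal (|topRe a b c d p.1| / (p.1 * p.2 ^ 2))) (s, w) := by
        apply lintegral_lintegral_swap
        apply Measurable.aemeasurable
        refine Measurable.indicator ?_ (measurableSet_levelSet a b c d α₁ α₂)
        have : Measurable (fun p : ℝ × ℝ => topRe a b c d p.1) :=
          (measurable_topRe a b c d).comp measurable_fst
        refine ENNReal.measurable_ofReal.comp ?_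
        refine Measurable.div ?_ (by fun_prop)
        exact continuous_abs.measurable.comp this
    _ = _ := by
        apply setLIntegral_congr_fun_ae hI
        have : ∀ᵐ w : ℝ, w ≠ 0 := by
          have := measure_singleton (μ := volume) (0 : ℝ)
          rwa [measure_eq_zero_iff_ae_notMem] at this
        filter_upwards [this] with w hw _
        exact lintegral_level h1 h2 hw hdet h00 h01 h10 h11

/-! ### Cosets and double cosets -/

/-- The stabiliser in `SL(2, ℝ)` of the oriented geodesic from `0` to `∞`. -/
def diagGroup : Subgroup SL(2, ℝ) where
  carrier := {m | ∃ t : ℝ, 0 < t ∧ (m = dMat t ∨ m = -dMat t)}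
  one_mem' := ⟨1, one_pos, Or.inl dMat_one.symm⟩
  mul_mem' := by
    rintro x y ⟨s, hs, hx⟩ ⟨t, ht, hy⟩
    refine ⟨s * t, mul_pos hs ht, ?_⟩
    rcases hx with rfl | rfl <;> rcases hy with rfl | rfl <;>
      simp only [neg_mul, mul_neg, neg_neg, dMat_mul hs.ne' ht.ne', true_or, or_true]
  inv_mem' := by
    rintro x ⟨s, hs, hx⟩
    refine ⟨s⁻¹, inv_pos.mpr hs, ?_⟩
    rcases hx with rfl | rfl
    · exact Or.inl (dMat_inv hs.ne')
    · exact Or.inr (by rw [inv_neg, dMat_inv hs.ne'])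

theorem sameGeodesic_iff {g g' : SL(2, ℝ)} : SameGeodesic g g' ↔ g⁻¹ * g' ∈ diagGroup := by
  refine exists_congr fun t => and_congr_right fun _ => or_congr ?_ ?_
  · rw [inv_mul_eq_iff_eq_mul]
  · rw [inv_mul_eq_iff_eq_mul, mul_neg]

theorem mem_stab_iff {Γ : Subgroup SL(2, ℝ)} {g : SL(2, ℝ)} {γ : Γ} :
    γ ∈ stab Γ g ↔ g⁻¹ * γ * g ∈ diagGroup := by
  have key : ∀ m : SL(2, ℝ), (γ : SL(2, ℝ)) = g * m * g⁻¹ ↔ g⁻¹ * γ * g = m := fun m => by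
    rw [eq_mul_inv_iff_mul_eq, ← inv_mul_eq_iff_eq_mul, ← mul_assoc]
  refine exists_congr fun t => and_congr_right fun _ => or_congr (key _) ?_
  rw [← neg_mul, ← mul_neg, key]

theorem neg_mem_diagGroup {m : SL(2, ℝ)} (h : m ∈ diagGroup) : -m ∈ diagGroup := by
  obtain ⟨t, ht, h⟩ := h
  refine ⟨t, ht, ?_⟩
  rcases h with rfl | rfl
  · exact Or.inr rfl
  · exact Or.inl (neg_neg _)

theorem revMat_conj_mem {m : SL(2, ℝ)} (hm : m ∈ diagGroup) :
    revMat⁻¹ * m * revMat ∈ diagGroup := by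
  obtain ⟨t, ht, h⟩ := hm
  have key : revMat⁻¹ * dMat t * revMat = dMat t⁻¹ := by
    have ht' := inv_ne_zero ht.ne'
    apply ext_entries <;>
    simp [mul_apply_eq, inv_00, inv_01, inv_10, inv_11, revMat_00, revMat_01, revMat_10, revMat_11,
      dMat_00 ht.ne', dMat_01 ht.ne', dMat_10 ht.ne', dMat_11 ht.ne', dMat_00 ht', dMat_01 ht',
      dMat_10 ht', dMat_11 ht']
  refine ⟨t⁻¹, inv_pos.mpr ht, ?_⟩
  rcases h with rfl | rfl
  · exact Or.inl key
  · right; rw [mul_neg, neg_mul, key]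

section

variable {Γ : Subgroup SL(2, ℝ)} {g₁ g₂ : SL(2, ℝ)}

/-- The matrix that carries the standard geodesic to `γ c₂`, in the coordinates adapted to `c₁`. -/
def AdmissibleCoset.mat (x : AdmissibleCoset Γ g₁ g₂) : SL(2, ℝ) := g₁⁻¹ * x.rep * g₂

theorem AdmissibleCoset.mat_notMem (x : AdmissibleCoset Γ g₁ g₂) :
    x.mat ∉ diagGroup ∧ x.mat⁻¹ * revMat ∉ diagGroup := by
  obtain ⟨h1, h2⟩ := x.2
  rw [sameGeodesic_iff] at h1 h2
  constructor
  · intro h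
    apply h1
    convert diagGroup.inv_mem h using 1
    simp only [AdmissibleCoset.mat, AdmissibleCoset.rep]; group
  · intro h
    apply h2
    convert h using 1
    simp only [AdmissibleCoset.mat, AdmissibleCoset.rep]; group

theorem AdmissibleCoset.exists_eq (γ : Γ) (h1 : g₁⁻¹ * γ * g₂ ∉ diagGroup)
    (h2 : (g₁⁻¹ * γ * g₂)⁻¹ * revMat ∉ diagGroup) :
    ∃ x : AdmissibleCoset Γ g₁ g₂, DoubleCoset.mk (stab Γ g₁) (stab Γ g₂) γ = x.1 ∧
      ∃ e ∈ stab Γ g₁, ∃ f ∈ stab Γ g₂, γ = e * Quotient.out x.1 * f := by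
  set y := DoubleCoset.mk (stab Γ g₁) (stab Γ g₂) γ with hy
  obtain ⟨e, he, f, hf, hef⟩ := (DoubleCoset.eq (stab Γ g₁) (stab Γ g₂) y.out γ).mp
    (by rw [DoubleCoset.out_eq'])
  have he' := mem_stab_iff.mp he
  have hf' := mem_stab_iff.mp hf
  have key : g₁⁻¹ * γ * g₂ = (g₁⁻¹ * e * g₁) * (g₁⁻¹ * (y.out : Γ) * g₂) * (g₂⁻¹ * f * g₂) := by
    rw [hef]; simp only [Subgroup.coe_mul]; group
  refine ⟨⟨y, ?_, ?_⟩, rfl, e, he, f, hf, hef⟩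
  · rw [sameGeodesic_iff]
    intro h
    apply h1
    rw [key]
    refine diagGroup.mul_mem (diagGroup.mul_mem he' ?_) hf'
    convert diagGroup.inv_mem h using 1
    group
  · rw [sameGeodesic_iff]
    intro h
    apply h2
    have : (g₁⁻¹ * γ * g₂)⁻¹ * revMat = (g₂⁻¹ * f * g₂)⁻¹ * (((y.out : Γ) * g₂)⁻¹ * (g₁ * revMat)) *
        (revMat⁻¹ * (g₁⁻¹ * e * g₁)⁻¹ * revMat) := by rw [key]; group
    rw [this]
    exact diagGroup.mul_mem (diagGroup.mul_mem (diagGroup.inv_mem hf') h)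
      (revMat_conj_mem (diagGroup.inv_mem he'))

/-- The coset of `δⁿ γ`, with `γ` the representative of a double coset. -/
def AdmissibleCoset.coset (δ : Γ) (x : AdmissibleCoset Γ g₁ g₂) (n : ℤ) : Γ ⧸ stab Γ g₂ :=
  ((δ ^ n * Quotient.out x.1 : Γ) : Γ ⧸ stab Γ g₂)

/-- The cosets of the form `δⁿ γ` are all those that do not send `c₂` to `c₁` or its reverse. -/
theorem AdmissibleCoset.mem_range_coset {δ : Γ}
    (hδ : ∀ γ ∈ stab Γ g₁, ∃ n : ℤ, (γ : SL(2, ℝ)) = (δ ^ n : Γ) ∨ (γ : SL(2, ℝ)) = -(δ ^ n : Γ))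
    (γ : Γ) (h1 : g₁⁻¹ * γ * g₂ ∉ diagGroup) (h2 : (g₁⁻¹ * γ * g₂)⁻¹ * revMat ∉ diagGroup) :
    (γ : Γ ⧸ stab Γ g₂) ∈
      range fun p : AdmissibleCoset Γ g₁ g₂ × ℤ => p.1.coset δ p.2 := by
  obtain ⟨x, -, e, he, f, hf, hγ⟩ := AdmissibleCoset.exists_eq γ h1 h2
  obtain ⟨n, hn⟩ := hδ e he
  refine ⟨(x, n), ?_⟩
  change x.coset δ n = _
  rw [AdmissibleCoset.coset, QuotientGroup.eq, mem_stab_iff]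
  have hf' := mem_stab_iff.mp hf
  rcases hn with hn | hn
  · have : e = δ ^ n := Subtype.ext hn
    convert hf' using 1
    rw [hγ, this]
    simp only [Subgroup.coe_mul, Subgroup.coe_inv]; group
  · convert neg_mem_diagGroup hf' using 1
    rw [hγ]
    simp only [Subgroup.coe_mul, Subgroup.coe_inv, hn, neg_mul, mul_neg]; group

variable [DiscreteTopology Γ]

theorem AdmissibleCoset.mat_ne_zero (h1 : -1 ∈ Γ) (hg₁ : IsClosedGeodesic Γ g₁)
    (hg₂ : IsClosedGeodesic Γ g₂) (x : AdmissibleCoset Γ g₁ g₂) :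
    x.mat 0 0 ≠ 0 ∧ x.mat 0 1 ≠ 0 ∧ x.mat 1 0 ≠ 0 ∧ x.mat 1 1 ≠ 0 := by
  have := entries_ne_zero h1 hg₁ (hg₂.smul (Subtype.property (Quotient.out x.1 : Γ))) x.2.1 x.2.2
  rwa [← mul_assoc] at this

/-- If two powers of `δ` gave the same coset, `γ⁻¹ δᵏ γ` would fix `c₂`, although `δᵏ` fixes no
endpoint of `γ c₂` unless `k = 0`. -/
theorem AdmissibleCoset.coset_injective (h1 : -1 ∈ Γ) (hg₁ : IsClosedGeodesic Γ g₁)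
    (hg₂ : IsClosedGeodesic Γ g₂) {δ : Γ}
    (hδ : ∀ n : ℤ, ((δ ^ n : Γ) : SL(2, ℝ)) = g₁ * dMat (epsilon Γ g₁ ^ n) * g₁⁻¹) :
    Function.Injective fun p : AdmissibleCoset Γ g₁ g₂ × ℤ => p.1.coset δ p.2 := by
  have hε := one_lt_epsilon h1 hg₁
  have hεp : ∀ n : ℤ, 0 < epsilon Γ g₁ ^ n := fun n => zpow_pos (by linarith) n
  have hmem : ∀ n : ℤ, δ ^ n ∈ stab Γ g₁ := fun n => ⟨_, hεp n, Or.inl (hδ n)⟩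
  rintro ⟨x, n⟩ ⟨x', n'⟩ h
  simp only [AdmissibleCoset.coset] at h
  have hs := QuotientGroup.eq.mp h
  have hx : x = x' := by
    apply Subtype.ext
    rw [← DoubleCoset.out_eq' _ _ x.1, ← DoubleCoset.out_eq' _ _ x'.1, DoubleCoset.eq]
    refine ⟨_, hmem (n - n'), _, hs, ?_⟩
    rw [sub_eq_neg_add, zpow_add, zpow_neg]; group
  subst hx
  simp only [Prod.mk.injEq, true_and]
  obtain ⟨h00, -, h10, -⟩ := x.mat_ne_zero h1 hg₁ hg₂
  have hconj : x.mat⁻¹ * dMat (epsilon Γ g₁ ^ (n' - n)) * x.mat ∈ diagGroup := by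
    convert mem_stab_iff.mp hs using 1
    have e : (δ ^ n * Quotient.out x.1)⁻¹ * (δ ^ n' * Quotient.out x.1) =
        (Quotient.out x.1)⁻¹ * δ ^ (n' - n) * Quotient.out x.1 := by
      rw [sub_eq_neg_add, zpow_add, zpow_neg]; group
    rw [e, Subgroup.coe_mul, Subgroup.coe_mul, Subgroup.coe_inv, hδ]
    simp only [AdmissibleCoset.mat, AdmissibleCoset.rep]; group
  have hε' := (hεp (n' - n)).ne'
  have hzero : epsilon Γ g₁ ^ (n' - n) = (epsilon Γ g₁ ^ (n' - n))⁻¹ := by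
    obtain ⟨t, ht, h | h⟩ := hconj
    · rw [mul_assoc, inv_mul_eq_iff_eq_mul] at h
      have e0 := congrArg (fun A : SL(2, ℝ) => A 0 0) h
      have e1 := congrArg (fun A : SL(2, ℝ) => A 1 0) h
      simp only [mul_apply_eq, dMat_00 hε', dMat_01 hε', dMat_10 hε', dMat_11 hε', dMat_00 ht.ne',
        dMat_10 ht.ne', zero_mul, mul_zero, add_zero, zero_add, mul_comm (x.mat 0 0),
        mul_comm (x.mat 1 0)] at e0 e1
      exact (mul_right_cancel₀ h00 e0).trans (mul_right_cancel₀ h10 e1).symm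
    · rw [mul_assoc, inv_mul_eq_iff_eq_mul, mul_neg] at h
      have e0 := congrArg (fun A : SL(2, ℝ) => A 0 0) h
      have e1 := congrArg (fun A : SL(2, ℝ) => A 1 0) h
      simp only [neg_apply_eq, mul_apply_eq, dMat_00 hε', dMat_01 hε', dMat_10 hε', dMat_11 hε',
        dMat_00 ht.ne', dMat_10 ht.ne', zero_mul, mul_zero, add_zero, zero_add, ← neg_mul,
        mul_comm _ t] at e0 e1
      have e0' : epsilon Γ g₁ ^ (n' - n) * x.mat 0 0 = -t * x.mat 0 0 := by rw [e0]; ring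
      have e1' : (epsilon Γ g₁ ^ (n' - n))⁻¹ * x.mat 1 0 = -t * x.mat 1 0 := by rw [e1]; ring
      exact (mul_right_cancel₀ h00 e0').trans (mul_right_cancel₀ h10 e1').symm
  rw [← zpow_neg] at hzero
  have := zpow_right_injective₀ (by linarith) (by linarith) hzero
  omega

end

/-! ### Unfolding the intensity over the double cosets -/

theorem measurableSet_topSet {I : Set ℝ} (hI : MeasurableSet I) (α : ℝ) (m : SL(2, ℝ)) :
    MeasurableSet (topSet I α m) := by
  have h1 : Measurable fun p : ℝ × ℝ => p.2 * ((m 0 0 * m 0 1 - m 1 0 * m 1 1 * p.1 ^ 2) /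
      ((m 0 0 + m 1 0 * p.1) * (m 0 1 + m 1 1 * p.1))) := by fun_prop
  have h2 : Measurable fun p : ℝ × ℝ => p.2 * (p.1 /
      ((m 0 0 + m 1 0 * p.1) * (m 0 1 + m 1 1 * p.1))) := by fun_prop
  exact (h1 hI).inter (measurableSet_le measurable_const h2)

theorem mem_topSet_dMat_mul {I : Set ℝ} {α t : ℝ} (ht : 0 < t) (m : SL(2, ℝ)) (s v : ℝ) :
    (s, v) ∈ topSet I α (dMat t * m) ↔ (s / t ^ 2, v) ∈ topSet I α m := by
  have ht' := ht.ne'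
  simp only [topSet, mem_ofPred_eq, mul_apply_eq, dMat_00 ht', dMat_01 ht', dMat_10 ht',
    dMat_11 ht', zero_mul, add_zero, zero_add]
  have e0 : (t * m 0 0 + t⁻¹ * m 1 0 * s) * (t * m 0 1 + t⁻¹ * m 1 1 * s) =
      t ^ 2 * ((m 0 0 + m 1 0 * (s / t ^ 2)) * (m 0 1 + m 1 1 * (s / t ^ 2))) := by
    field_simp
  have e1 : t * m 0 0 * (t * m 0 1) - t⁻¹ * m 1 0 * (t⁻¹ * m 1 1) * s ^ 2 =
      t ^ 2 * (m 0 0 * m 0 1 - m 1 0 * m 1 1 * (s / t ^ 2) ^ 2) := by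
    field_simp
  rw [e0, e1, mul_div_mul_left _ _ (pow_ne_zero 2 ht'), div_mul_eq_div_div s (t ^ 2)]

/-- The density of the measure `(ds / s) (dv / v²)`. -/
def paramDensity (p : ℝ × ℝ) : ℝ≥0∞ := ENNReal.ofReal (1 / (p.1 * p.2 ^ 2))

theorem measurable_paramDensity : Measurable paramDensity := by
  unfold paramDensity; fun_prop

/-- The measure of the set of parameters in the section that count a coset with matrix `m`. -/
def cellMass (ε α₁ : ℝ) (I : Set ℝ) (α₂ : ℝ) (m : SL(2, ℝ)) : ℝ≥0∞ :=
  ∫⁻ s in Ico 1 (ε ^ 2), ∫⁻ v in Ici α₁, (topSet I α₂ m).indicator paramDensity (s, v)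

/-- The translates by the powers of `ε²` of the period `[1, ε²)` tile the half-line. -/
theorem tsum_lintegral_Ico {ε : ℝ} (hε : 1 < ε) (f : ℝ → ℝ≥0∞) :
    ∑' n : ℤ, ∫⁻ s in Ico 1 (ε ^ 2), ENNReal.ofReal (1 / s) * f (s / (ε ^ n) ^ 2) =
      ∫⁻ s in Ioi 0, ENNReal.ofReal (1 / s) * f s := by
  have hb : 1 < ε ^ 2 := one_lt_pow₀ hε two_ne_zero
  have hb0 : 0 < ε ^ 2 := by linarith
  have hU : ⋃ n : ℤ, Ico ((ε ^ 2) ^ n) ((ε ^ 2) ^ (n + 1)) = Ioi 0 := by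
    ext s
    simp only [mem_iUnion, mem_Ioi]
    constructor
    · rintro ⟨n, hn⟩
      exact (zpow_pos hb0 n).trans_le hn.1
    · exact fun hs => exists_mem_Ico_zpow hs hb
  have hdisj : Pairwise (Function.onFun Disjoint fun n : ℤ =>
      Ico ((ε ^ 2) ^ n) ((ε ^ 2) ^ (n + 1))) :=
    (zpow_right_strictMono₀ hb).monotone.pairwise_disjoint_on_Ico_succ
  rw [← hU, lintegral_iUnion (s := fun n : ℤ => Ico ((ε ^ 2) ^ n) ((ε ^ 2) ^ (n + 1)))
      (fun n => measurableSet_Ico) hdisj,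
    ← (Equiv.neg ℤ).tsum_eq]
  refine tsum_congr fun n => ?_
  have hc : 0 < (ε ^ 2) ^ n := zpow_pos hb0 n
  have himg : (fun s => s / (ε ^ (-n)) ^ 2) '' Ico 1 (ε ^ 2) =
      Ico ((ε ^ 2) ^ n) ((ε ^ 2) ^ (n + 1)) := by
    have e : ∀ s : ℝ, s / (ε ^ (-n)) ^ 2 = (ε ^ 2) ^ n * s := by
      intro s
      rw [zpow_neg, inv_pow, div_inv_eq_mul, ← zpow_natCast (ε ^ n), ← zpow_natCast ε, zpow_comm,
        mul_comm]
    simp only [e]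
    rw [image_mul_left_Ico hc, mul_one, zpow_add_one₀ hb0.ne']
  have hder : ∀ s ∈ Ico 1 (ε ^ 2), HasDerivWithinAt (fun s => s / (ε ^ (-n)) ^ 2)
      (1 / (ε ^ (-n)) ^ 2) (Ico 1 (ε ^ 2)) s := fun s _ =>
    ((hasDerivAt_id s).div_const _).hasDerivWithinAt
  have hk : 0 < (ε ^ (-n)) ^ 2 := pow_pos (zpow_pos (by linarith) _) 2
  have hinj : InjOn (fun s => s / (ε ^ (-n)) ^ 2) (Ico 1 (ε ^ 2)) :=
    
    fun x _ y _ h => (div_left_inj' hk.ne').mp h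
  rw [← himg, lintegral_image_eq_lintegral_abs_deriv_mul measurableSet_Ico hder hinj]
  refine setLIntegral_congr_fun measurableSet_Ico fun s hs => ?_
  have hs0 : 0 < s := by linarith [hs.1]
  rw [Equiv.neg_apply, ← mul_assoc, ← ENNReal.ofReal_mul (abs_nonneg _)]
  congr 2
  rw [abs_of_pos (by positivity)]
  field_simp

theorem indicator_paramDensity {S : Set (ℝ × ℝ)} {s v : ℝ} (hs : 0 < s) :
    S.indicator paramDensity (s, v) =
      ENNReal.ofReal (1 / s) * S.indicator (fun p => ENNReal.ofReal (1 / p.2 ^ 2)) (s, v) := by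
  by_cases h : (s, v) ∈ S
  · rw [indicator_of_mem h, indicator_of_mem h, ← ENNReal.ofReal_mul (by positivity), paramDensity]
    congr 1
    simp only
    rw [div_mul_div_comm, one_mul]
  · rw [indicator_of_notMem h, indicator_of_notMem h, mul_zero]

/-- Unfolding: the translates by the stabiliser of `c₁` turn the integral over one period into the
one over the whole geodesic. -/
theorem tsum_cellMass {ε α₁ α₂ : ℝ} (hε : 1 < ε) (I : Set ℝ) (m : SL(2, ℝ)) :
    ∑' n : ℤ, cellMass ε α₁ I α₂ (dMat (ε ^ n) * m) =
      ∫⁻ s in Ioi 0, ∫⁻ v in Ici α₁, (topSet I α₂ m).indicator paramDensity (s, v) := by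
  set f : ℝ → ℝ≥0∞ := fun s => ∫⁻ v in Ici α₁,
    (topSet I α₂ m).indicator (fun p => ENNReal.ofReal (1 / p.2 ^ 2)) (s, v) with hf
  have h1 : ∀ s ∈ Ioi (0 : ℝ), ∫⁻ v in Ici α₁, (topSet I α₂ m).indicator paramDensity (s, v) =
      ENNReal.ofReal (1 / s) * f s := by
    intro s hs
    rw [hf, ← lintegral_const_mul' _ _ ENNReal.ofReal_ne_top]
    exact lintegral_congr fun v => indicator_paramDensity hs
  rw [setLIntegral_congr_fun measurableSet_Ioi h1, ← tsum_lintegral_Ico hε f]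
  refine tsum_congr fun n => ?_
  refine setLIntegral_congr_fun measurableSet_Ico fun s hs => ?_
  have hs0 : 0 < s := by linarith [hs.1]
  simp only [hf]
  rw [← lintegral_const_mul' _ _ ENNReal.ofReal_ne_top]
  refine lintegral_congr fun v => ?_
  rw [indicator_paramDensity hs0]
  congr 1
  have := mem_topSet_dMat_mul (I := I) (α := α₂) (t := ε ^ n) (zpow_pos (by linarith) n) m s v
  by_cases h : (s, v) ∈ topSet I α₂ (dMat (ε ^ n) * m)
  · rw [indicator_of_mem h, indicator_of_mem (this.mp h)]
  · rw [indicator_of_notMem h, indicator_of_notMem (fun h' => h (this.mpr h'))]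

theorem cellMass_congr {Γ : Subgroup SL(2, ℝ)} {g₁ g₂ : SL(2, ℝ)} {ε α₁ α₂ : ℝ} (h1 : 0 < α₁)
    (h2 : 0 < α₂) (I : Set ℝ) {γ γ' : Γ} (h : (γ : Γ ⧸ stab Γ g₂) = γ') :
    cellMass ε α₁ I α₂ (g₁⁻¹ * γ * g₂) = cellMass ε α₁ I α₂ (g₁⁻¹ * γ' * g₂) := by
  refine setLIntegral_congr_fun measurableSet_Ico fun s hs => ?_
  refine setLIntegral_congr_fun measurableSet_Ici fun v hv => ?_
  have hs0 : 0 < s := by linarith [hs.1]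
  have hv0 : 0 < v := by linarith [mem_Ici.mp hv]
  have key : (s, v) ∈ topSet I α₂ (g₁⁻¹ * γ * g₂) ↔ (s, v) ∈ topSet I α₂ (g₁⁻¹ * γ' * g₂) := by
    rw [← hasTopIn_iff_mem_topSet h2 _ _ _ hs0 hv0, ← hasTopIn_iff_mem_topSet h2 _ _ _ hs0 hv0,
      ← mem_countSet_iff h2, ← mem_countSet_iff h2, h]
  by_cases h : (s, v) ∈ topSet I α₂ (g₁⁻¹ * γ * g₂)
  · rw [indicator_of_mem h, indicator_of_mem (key.mp h)]
  · rw [indicator_of_notMem h, indicator_of_notMem (fun h' => h (key.mpr h'))]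

/-- The mean number of cosets counted is the sum over the cosets of the mass of the parameters that
count them. -/
theorem lintegral_encard {Γ : Subgroup SL(2, ℝ)} [Countable Γ] {g₁ g₂ : SL(2, ℝ)} {ε α₁ α₂ : ℝ}
    (h1 : 0 < α₁) (h2 : 0 < α₂) {I : Set ℝ} (hI : MeasurableSet I) :
    ∫⁻ p, ((countSet Γ g₂ (strip I α₂)
        (g₁ * aMat p.1 * kMat (-(Real.pi / 2)) * aMat p.2⁻¹)).encard : ℝ≥0∞)
        ∂(paramMeasure ε α₁) =
      ∑' y : Γ ⧸ stab Γ g₂, cellMass ε α₁ I α₂ (g₁⁻¹ * (Quotient.out y : Γ) * g₂) := by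
  have : Countable (Γ ⧸ stab Γ g₂) := Quotient.countable
  set T : Γ ⧸ stab Γ g₂ → Set (ℝ × ℝ) := fun y => topSet I α₂ (g₁⁻¹ * (Quotient.out y : Γ) * g₂)
  have hT : ∀ y, MeasurableSet (T y) := fun y => measurableSet_topSet hI _ _
  have hS : MeasurableSet (Ico 1 (ε ^ 2) ×ˢ Ici α₁) := measurableSet_Ico.prod measurableSet_Ici
  have hcount : ∀ p ∈ Ico 1 (ε ^ 2) ×ˢ Ici α₁, ((countSet Γ g₂ (strip I α₂)
      (g₁ * aMat p.1 * kMat (-(Real.pi / 2)) * aMat p.2⁻¹)).encard : ℝ≥0∞) =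
      ∑' y, (T y).indicator 1 p := by
    rintro ⟨s, v⟩ ⟨hs, hv⟩
    have hs0 : 0 < s := by linarith [hs.1]
    have hv0 : 0 < v := by linarith [mem_Ici.mp hv]
    rw [← ENNReal.tsum_set_one, tsum_subtype (f := fun _ => (1 : ℝ≥0∞))]
    refine tsum_congr fun y => ?_
    have key : y ∈ countSet Γ g₂ (strip I α₂)
        (g₁ * aMat s * kMat (-(Real.pi / 2)) * aMat v⁻¹) ↔ (s, v) ∈ T y := by
      rw [← hasTopIn_iff_mem_topSet h2 _ _ _ hs0 hv0, ← mem_countSet_iff h2, QuotientGroup.out_eq']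
    by_cases h : (s, v) ∈ T y
    · rw [indicator_of_mem h, indicator_of_mem (key.mpr h)]; rfl
    · rw [indicator_of_notMem h, indicator_of_notMem (fun h' => h (key.mp h'))]
  have hae : (fun p : ℝ × ℝ => ((countSet Γ g₂ (strip I α₂)
      (g₁ * aMat p.1 * kMat (-(Real.pi / 2)) * aMat p.2⁻¹)).encard : ℝ≥0∞))
      =ᵐ[paramMeasure ε α₁] fun p => ∑' y, (T y).indicator 1 p := by
    refine (withDensity_absolutelyContinuous _ _).ae_eq ?_
    filter_upwards [ae_restrict_mem hS] with p hp using hcount p hp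
  rw [lintegral_congr_ae hae, lintegral_tsum fun y => (measurable_one.indicator (hT y)).aemeasurable]
  refine tsum_congr fun y => ?_
  have hmeas : Measurable ((T y).indicator paramDensity) := measurable_paramDensity.indicator (hT y)
  have hpm : paramMeasure ε α₁ =
      (volume.restrict (Ico 1 (ε ^ 2) ×ˢ Ici α₁)).withDensity paramDensity := rfl
  rw [hpm, lintegral_withDensity_eq_lintegral_mul _ measurable_paramDensity
    (measurable_one.indicator (hT y)), cellMass, Measure.volume_eq_prod, ← Measure.prod_restrict]
  have : paramDensity * (T y).indicator 1 = (T y).indicator paramDensity := by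
    ext p
    by_cases h : p ∈ T y <;> simp [h]
  rw [this, lintegral_prod _ hmeas.aemeasurable]

/-- The coset that fixes the geodesic contributes a point mass at the origin. -/
theorem cellMass_one {ε α₁ α₂ : ℝ} (hε : 1 < ε) (h1 : 0 < α₁) (I : Set ℝ) :
    cellMass ε α₁ I α₂ 1 =
      ENNReal.ofReal (2 * Real.log ε * (1 / max α₁ α₂) * I.indicator (fun _ => 1) 0) := by
  by_cases h0 : (0 : ℝ) ∈ I
  swap
  · rw [indicator_of_notMem h0, mul_zero, ENNReal.ofReal_zero, cellMass]
    have : topSet I α₂ 1 = ∅ := by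
      ext p
      simp only [topSet, mem_ofPred_eq, one_00, one_01, one_10, one_11]
      simp [h0]
    simp [this]
  set M := max α₁ α₂ with hM
  have hM0 : 0 < M := h1.trans_le (le_max_left _ _)
  have hε2 : 1 < ε ^ 2 := one_lt_pow₀ hε two_ne_zero
  have hmem : ∀ s v : ℝ, 0 < s → ((s, v) ∈ topSet I α₂ 1 ↔ α₂ ≤ v) := by
    intro s v hs
    simp only [topSet, mem_ofPred_eq, one_00, one_01, one_10, one_11]
    simp [h0, hs.ne']
  have hv : ∫⁻ v in Ici M, ENNReal.ofReal (1 / v ^ 2) = ENNReal.ofReal (1 / M) := by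
    have e : ∀ v ∈ Ioi M, v ^ (-2 : ℝ) = 1 / v ^ 2 := by
      intro v hv
      have hv0 : 0 < v := hM0.trans hv
      rw [Real.rpow_neg hv0.le, one_div]; norm_cast
    have hint := (integrableOn_Ioi_rpow_of_lt (by norm_num : (-2 : ℝ) < -1) hM0).congr_fun e
      measurableSet_Ioi
    have hval := integral_Ioi_rpow_of_lt (by norm_num : (-2 : ℝ) < -1) hM0
    rw [setIntegral_congr_fun measurableSet_Ioi e] at hval
    rw [setLIntegral_congr Ioi_ae_eq_Ici.symm, ← ofReal_integral_eq_lintegral_ofReal hint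
      (Eventually.of_forall fun v => by positivity), hval]
    congr 1
    norm_num
    rw [Real.rpow_neg_one]
  have hs : ∫⁻ s in Ico 1 (ε ^ 2), ENNReal.ofReal (1 / s) = ENNReal.ofReal (2 * Real.log ε) := by
    have hint : IntervalIntegrable (fun s : ℝ => 1 / s) volume 1 (ε ^ 2) := by
      refine intervalIntegral.intervalIntegrable_one_div (fun x hx => ?_) continuousOn_id
      rw [uIcc_of_le hε2.le] at hx
      exact (by linarith [hx.1] : (0 : ℝ) < x).ne'
    rw [intervalIntegrable_iff_integrableOn_Ioc_of_le hε2.le] at hint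
    have hval := integral_one_div_of_pos one_pos (by linarith : 0 < ε ^ 2)
    rw [intervalIntegral.integral_of_le hε2.le] at hval
    rw [setLIntegral_congr Ico_ae_eq_Ioc, ← ofReal_integral_eq_lintegral_ofReal hint, hval]
    · rw [div_one, Real.log_pow]; norm_num
    · filter_upwards [ae_restrict_mem measurableSet_Ioc] with x hx
      have : 0 < x := by linarith [hx.1]
      positivity
  rw [indicator_of_mem h0, mul_one, ENNReal.ofReal_mul (by have := Real.log_pos hε; positivity), ← hs,
    ← hv, ← lintegral_mul_const' _ _ (by rw [hv]; exact ENNReal.ofReal_ne_top)]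
  refine setLIntegral_congr_fun measurableSet_Ico fun s hs => ?_
  have hs0 : 0 < s := by linarith [hs.1]
  simp only [indicator_paramDensity hs0]
  rw [lintegral_const_mul' _ _ ENNReal.ofReal_ne_top]
  congr 1
  rw [← lintegral_indicator measurableSet_Ici, ← lintegral_indicator measurableSet_Ici]
  refine lintegral_congr fun v => ?_
  by_cases hv1 : v ∈ Ici α₁
  · rw [indicator_of_mem hv1]
    by_cases hv2 : α₂ ≤ v
    · rw [indicator_of_mem ((hmem s v hs0).mpr hv2), indicator_of_mem (show v ∈ Ici M from max_le hv1 hv2)]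
    · rw [indicator_of_notMem (fun h => hv2 ((hmem s v hs0).mp h)),
        indicator_of_notMem (fun h : v ∈ Ici M => hv2 ((le_max_right _ _).trans h))]
  · rw [indicator_of_notMem hv1,
      indicator_of_notMem (fun h : v ∈ Ici M => hv1 ((le_max_left α₁ α₂).trans h))]

/-- The reverse of a geodesic is never positively oriented when the geodesic is, so it is not
counted. -/
theorem cellMass_eq_zero_of_rev {ε α₁ α₂ : ℝ} (h1 : 0 < α₁) (h2 : 0 < α₂) (I : Set ℝ)
    {m : SL(2, ℝ)} (hm : m⁻¹ * revMat ∈ diagGroup) : cellMass ε α₁ I α₂ m = 0 := by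
  have hm' : m 0 0 = 0 ∧ m 1 1 = 0 := by
    obtain ⟨t, ht, h⟩ := diagGroup.inv_mem hm
    have e : m = revMat * (m⁻¹ * revMat)⁻¹ := by group
    rcases h with h | h <;> rw [e, h]
    · simp [mul_apply_eq, revMat_00, revMat_01, revMat_10, revMat_11, dMat_01 ht.ne', dMat_10 ht.ne']
    · simp [mul_apply_eq, neg_apply_eq, revMat_00, revMat_01, revMat_10, revMat_11, dMat_01 ht.ne',
        dMat_10 ht.ne']
  have hdet := det_eq m
  rw [hm'.1, hm'.2] at hdet
  have hbc : m 1 0 * m 0 1 = -1 := by linarith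
  rw [cellMass]
  have : ∀ s ∈ Ico 1 (ε ^ 2), ∫⁻ v in Ici α₁, (topSet I α₂ m).indicator paramDensity (s, v) = 0 := by
    intro s hs
    have hs0 : 0 < s := by linarith [hs.1]
    rw [setLIntegral_congr_fun measurableSet_Ici (g := 0), lintegral_zero_fun]
    intro v hv
    have hv0 : 0 < v := by linarith [mem_Ici.mp hv]
    refine indicator_of_notMem ?_ _
    rintro ⟨-, h⟩
    simp only [hm'.1, hm'.2, zero_add, zero_mul, add_zero] at h
    rw [show m 1 0 * s * m 0 1 = -s by linear_combination s * hbc] at h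
    rw [div_neg, div_self hs0.ne'] at h
    linarith
  rw [setLIntegral_congr_fun measurableSet_Ico this, lintegral_zero]

section

variable {Γ : Subgroup SL(2, ℝ)} [DiscreteTopology Γ]

theorem countable_of_discrete : Countable Γ := by
  have h : (univ : Set Γ) = ⋃ n : ℕ, {γ : Γ | normSq (1⁻¹ * (γ : SL(2, ℝ)) * 1) ≤ n} := by
    ext γ
    simp only [mem_univ, mem_iUnion, true_iff]
    exact exists_nat_ge (normSq (1⁻¹ * (γ : SL(2, ℝ)) * 1))
  rw [← countable_univ_iff, h]
  exact countable_iUnion fun n => (finite_normSq_le 1 1 n).countable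

variable {g₁ g₂ : SL(2, ℝ)} {α₁ α₂ : ℝ} {I : Set ℝ}

/-- The contribution of the admissible double cosets to the intensity. -/
def densityMass (Γ : Subgroup SL(2, ℝ)) (g₁ g₂ : SL(2, ℝ)) (α₁ α₂ : ℝ) (I : Set ℝ) : ℝ≥0∞ :=
  ∑' x : AdmissibleCoset Γ g₁ g₂, ∫⁻ w in I, ENNReal.ofReal
    (Hsign (x.mat 0 1 / x.mat 1 1) (x.mat 0 0 * x.mat 1 1 + x.mat 0 1 * x.mat 1 0)
      (w / α₁) (w / α₂) / w ^ 2)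

/-- The cosets outside `S` fix or reverse the geodesic `c₁`; those in `S` are grouped by double
cosets and unfolded. -/
theorem tsum_cellMass_coset (h1 : -1 ∈ Γ) (hg₁ : IsClosedGeodesic Γ g₁) (hg₂ : IsClosedGeodesic Γ g₂)
    (hα₁ : 1 ≤ α₁) (hα₂ : 1 ≤ α₂) (hI : MeasurableSet I) :
    ∃ S : Set (Γ ⧸ stab Γ g₂),
      (∀ γ : Γ, (γ : Γ ⧸ stab Γ g₂) ∉ S →
        g₁⁻¹ * γ * g₂ ∈ diagGroup ∨ (g₁⁻¹ * γ * g₂)⁻¹ * revMat ∈ diagGroup) ∧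
      (∀ γ : Γ, (γ : Γ ⧸ stab Γ g₂) ∈ S → g₁⁻¹ * γ * g₂ ∉ diagGroup) ∧
      ∑' y : S, cellMass (epsilon Γ g₁) α₁ I α₂ (g₁⁻¹ * (Quotient.out y.1 : Γ) * g₂) =
        densityMass Γ g₁ g₂ α₁ α₂ I := by
  obtain ⟨δ, -, hδ, hδs, hδg⟩ := exists_generator h1 hg₁
  have hinj := AdmissibleCoset.coset_injective (g₂ := g₂) h1 hg₁ hg₂ hδ
  have hε := one_lt_epsilon h1 hg₁
  refine ⟨range fun p : AdmissibleCoset Γ g₁ g₂ × ℤ => p.1.coset δ p.2, fun γ hγ => ?_,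
    fun γ hγ hd => ?_, ?_⟩
  · by_contra! h
    exact hγ (AdmissibleCoset.mem_range_coset hδg γ h.1 h.2)
  · obtain ⟨⟨x, n⟩, hx⟩ := hγ
    have hs := mem_stab_iff.mp (QuotientGroup.eq.mp hx)
    have hn := mem_stab_iff.mp (hδs n)
    refine x.mat_notMem.1 ?_
    have : x.mat = (g₁⁻¹ * (δ ^ n : Γ) * g₁)⁻¹ * (g₁⁻¹ * γ * g₂) *
        (g₂⁻¹ * ((δ ^ n * Quotient.out x.1)⁻¹ * γ : Γ) * g₂)⁻¹ := by
      simp only [AdmissibleCoset.mat, AdmissibleCoset.rep, Subgroup.coe_mul, Subgroup.coe_inv]; group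
    rw [this]
    exact diagGroup.mul_mem (diagGroup.mul_mem (diagGroup.inv_mem hn) hd) (diagGroup.inv_mem hs)
  · rw [tsum_range (f := fun y : Γ ⧸ stab Γ g₂ =>
      cellMass (epsilon Γ g₁) α₁ I α₂ (g₁⁻¹ * (Quotient.out y : Γ) * g₂)) hinj]
    refine (ENNReal.tsum_prod (f := fun (x : AdmissibleCoset Γ g₁ g₂) n => cellMass (epsilon Γ g₁) α₁ I α₂
      (g₁⁻¹ * (Quotient.out (x.coset δ n) : Γ) * g₂))).trans ?_
    refine tsum_congr fun x => ?_
    obtain ⟨n1, n2, n3, n4⟩ := x.mat_ne_zero h1 hg₁ hg₂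
    rw [← lintegral_topSet n1 n2 n3 n4 hα₁ hα₂ hI]
    refine Eq.trans ?_ (tsum_cellMass hε I x.mat)
    refine tsum_congr fun n => ?_
    have e : (((Quotient.out (x.coset δ n) : Γ)) : Γ ⧸ stab Γ g₂) =
        ((δ ^ n * Quotient.out x.1 : Γ) : Γ ⧸ stab Γ g₂) := QuotientGroup.out_eq' _
    rw [cellMass_congr (by linarith) (by linarith) I e]
    congr 1
    rw [Subgroup.coe_mul, hδ, AdmissibleCoset.mat, AdmissibleCoset.rep]; group

/-- The mean number of lifts of `c₂` counted from the section of `c₁ ≠ c₂`. -/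
theorem lintegral_encard_of_ne (h1 : -1 ∈ Γ) (hg₁ : IsClosedGeodesic Γ g₁)
    (hg₂ : IsClosedGeodesic Γ g₂) (hα₁ : 1 ≤ α₁) (hα₂ : 1 ≤ α₂) (hI : MeasurableSet I)
    (hne : ∀ γ ∈ Γ, ¬ SameGeodesic (γ * g₂) g₁) :
    ∫⁻ p, ((countSet Γ g₂ (strip I α₂)
        (g₁ * aMat p.1 * kMat (-(Real.pi / 2)) * aMat p.2⁻¹)).encard : ℝ≥0∞)
        ∂(paramMeasure (epsilon Γ g₁) α₁) = densityMass Γ g₁ g₂ α₁ α₂ I := by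
  have := countable_of_discrete (Γ := Γ)
  rw [lintegral_encard (by linarith) (by linarith) hI]
  obtain ⟨S, hS, -, hsum⟩ := tsum_cellMass_coset h1 hg₁ hg₂ hα₁ hα₂ hI
  rw [← Summable.tsum_add_tsum_compl (s := S) ENNReal.summable ENNReal.summable]
  refine (congrArg₂ (· + ·) hsum ?_).trans (add_zero _)
  rw [ENNReal.tsum_eq_zero]
  rintro ⟨y, hy⟩
  rw [mem_compl_iff, ← QuotientGroup.out_eq' y] at hy
  refine cellMass_eq_zero_of_rev (by linarith) (by linarith) I ((hS _ hy).resolve_left fun h => ?_)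
  refine hne _ (Subtype.property (Quotient.out y : Γ)) (sameGeodesic_iff.mpr ?_)
  convert diagGroup.inv_mem h using 1
  group

/-- The mean number of lifts of `c₁` counted from the section of `c₁` itself. -/
theorem lintegral_encard_self (h1 : -1 ∈ Γ) (hg₁ : IsClosedGeodesic Γ g₁) (hα₁ : 1 ≤ α₁)
    (hα₂ : 1 ≤ α₂) (hI : MeasurableSet I) :
    ∫⁻ p, ((countSet Γ g₁ (strip I α₂)
        (g₁ * aMat p.1 * kMat (-(Real.pi / 2)) * aMat p.2⁻¹)).encard : ℝ≥0∞)
        ∂(paramMeasure (epsilon Γ g₁) α₁) =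
      ENNReal.ofReal (2 * Real.log (epsilon Γ g₁) * (1 / max α₁ α₂) *
        I.indicator (fun _ => 1) 0) + densityMass Γ g₁ g₁ α₁ α₂ I := by
  have := countable_of_discrete (Γ := Γ)
  rw [lintegral_encard (by linarith) (by linarith) hI]
  obtain ⟨S, hS, hS', hsum⟩ := tsum_cellMass_coset h1 hg₁ hg₁ hα₁ hα₂ hI
  rw [← Summable.tsum_add_tsum_compl (s := S) ENNReal.summable ENNReal.summable, add_comm]
  refine congrArg₂ (· + ·) ?_ hsum
  have hone : ((1 : Γ) : Γ ⧸ stab Γ g₁) ∈ Sᶜ := fun h => hS' 1 h (by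
    simp [diagGroup.one_mem])
  rw [tsum_eq_single ⟨_, hone⟩]
  · rw [← cellMass_one (one_lt_epsilon h1 hg₁) (by linarith) I]
    refine (cellMass_congr (by linarith) (by linarith) I (QuotientGroup.out_eq' _)).trans ?_
    simp
  · rintro ⟨y, hy⟩ hne
    rw [mem_compl_iff, ← QuotientGroup.out_eq' y] at hy
    refine cellMass_eq_zero_of_rev (by linarith) (by linarith) I
      ((hS _ hy).resolve_left fun h => hne ?_)
    apply Subtype.ext
    change y = _
    rw [← QuotientGroup.out_eq' y, eq_comm, QuotientGroup.eq, mem_stab_iff, inv_one, one_mul]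
    exact h

end

/-! ### Convergence of a Poincaré series -/

theorem normSq_eq_cosh_dist (M : SL(2, ℝ)) :
    normSq M = 2 * Real.cosh (dist (M • UpperHalfPlane.I) UpperHalfPlane.I) := by
  have hdet := det_eq M
  have hpos : 0 < M 1 0 ^ 2 + M 1 1 ^ 2 := by
    by_contra! h
    have e1 : M 1 0 = 0 := by nlinarith [sq_nonneg (M 1 0), sq_nonneg (M 1 1)]
    have e2 : M 1 1 = 0 := by nlinarith [sq_nonneg (M 1 0), sq_nonneg (M 1 1)]
    rw [e1, e2] at hdet
    norm_num at hdet
  obtain ⟨hre, him⟩ := geodesic_re_im M one_pos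
  rw [dMat_one, mul_one] at hre him
  norm_num at hre him
  rw [UpperHalfPlane.cosh_dist, Complex.dist_eq, ← Complex.normSq_eq_norm_sq, Complex.normSq_apply]
  simp only [Complex.sub_re, Complex.sub_im, UpperHalfPlane.coe_re, UpperHalfPlane.coe_im,
    UpperHalfPlane.I_re, UpperHalfPlane.I_im, hre, him, normSq]
  field_simp
  linear_combination (M 0 0 * M 1 1 - M 0 1 * M 1 0 + 1) * hdet

instance smulInvariantMeasure_SL : SMulInvariantMeasure SL(2, ℝ) ℍ volume :=
  ⟨fun c _ hs => measure_preimage_smul_of_nullMeasurableSet hs.nullMeasurableSet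
    (Matrix.SpecialLinearGroup.mapGL ℝ c)⟩

theorem volume_ball_pos (z : ℍ) : 0 < volume (Metric.ball z 1) := by
  rw [UpperHalfPlane.volume_eq_lintegral]
  have ho : IsOpen (UpperHalfPlane.coe '' Metric.ball z 1) :=
    isOpenEmbedding_coe.isOpenMap _ Metric.isOpen_ball
  rw [setLIntegral_pos_iff (by fun_prop)]
  have : (Function.support fun z : ℂ => (((1 / ‖z.im‖₊) ^ 2 : NNReal) : ℝ≥0∞)) ∩
      UpperHalfPlane.coe '' Metric.ball z 1 = UpperHalfPlane.coe '' Metric.ball z 1 := by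
    apply inter_eq_self_of_subset_right
    rintro _ ⟨w, -, rfl⟩
    simp [w.im_ne_zero]
  rw [this]
  exact ho.measure_pos _ ⟨_, z, Metric.mem_ball_self one_pos, rfl⟩

/-- The function `exp(-2 d(z, i))` is at most `(2y / (1 + |z|²))²`, and `y²` cancels the density of
the hyperbolic area. -/
theorem lintegral_exp_neg_dist_lt_top :
    ∫⁻ z : ℍ, ENNReal.ofReal (Real.exp (-(2 * dist z UpperHalfPlane.I))) < ⊤ := by
  have hint : ∫⁻ z : ℂ, ENNReal.ofReal (4 * (1 + ‖z‖ ^ 2) ^ (-4 / 2 : ℝ)) < ⊤ := by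
    have := (integrable_rpow_neg_one_add_norm_sq (E := ℂ) (μ := volume) (r := 4)
      (by rw [Complex.finrank_real_complex]; norm_num)).const_mul 4
    exact this.lintegral_lt_top
  refine lt_of_le_of_lt ?_ hint
  have hmeas : Measurable fun z : ℍ => ENNReal.ofReal (Real.exp (-(2 * dist z UpperHalfPlane.I))) := by
    fun_prop
  have h3 : ∀ z : ℍ, (((1 / NNReal.mk z.im z.im_pos.le : NNReal) ^ 2 : NNReal) : ℝ≥0∞) =
      ENNReal.ofReal ((1 / z.im) ^ 2) := by
    intro z
    rw [← ENNReal.ofReal_coe_nnreal]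
    simp
  have hw : Measurable fun z : ℍ => (((1 / NNReal.mk z.im z.im_pos.le : NNReal) ^ 2 : NNReal) : ℝ≥0∞) := by
    have : Measurable fun z : ℍ => ENNReal.ofReal ((1 / z.im) ^ 2) :=
      ENNReal.measurable_ofReal.comp
        ((measurable_const.div continuous_im.measurable).pow_const 2)
    rwa [← funext h3] at this
  rw [UpperHalfPlane.volume_def, lintegral_withDensity_eq_lintegral_mul _ hw hmeas]
  have hle : ∀ z : ℍ, ((fun z : ℍ => (((1 / NNReal.mk z.im z.im_pos.le : NNReal) ^ 2 : NNReal) : ℝ≥0∞)) *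
      fun z : ℍ => ENNReal.ofReal (Real.exp (-(2 * dist z UpperHalfPlane.I)))) z ≤
      ENNReal.ofReal (4 * (1 + ‖(z : ℂ)‖ ^ 2) ^ (-4 / 2 : ℝ)) := by
    intro z
    have him := z.im_pos
    have e : Real.cosh (dist z UpperHalfPlane.I) = (1 + ‖(z : ℂ)‖ ^ 2) / (2 * z.im) := by
      rw [UpperHalfPlane.cosh_dist, Complex.dist_eq, ← Complex.normSq_eq_norm_sq,
        ← Complex.normSq_eq_norm_sq, Complex.normSq_apply, Complex.normSq_apply]
      simp only [Complex.sub_re, Complex.sub_im, UpperHalfPlane.coe_re, UpperHalfPlane.coe_im,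
        UpperHalfPlane.I_re, UpperHalfPlane.I_im]
      field_simp
      ring
    have h1 : Real.cosh (dist z UpperHalfPlane.I) ≤ Real.exp (dist z UpperHalfPlane.I) := by
      rw [Real.cosh_eq]
      have : Real.exp (-dist z UpperHalfPlane.I) ≤ Real.exp (dist z UpperHalfPlane.I) :=
        Real.exp_le_exp.mpr (by linarith [dist_nonneg (x := z) (y := UpperHalfPlane.I)])
      linarith
    have h2 : Real.exp (-(2 * dist z UpperHalfPlane.I)) ≤ ((1 + ‖(z : ℂ)‖ ^ 2) / (2 * z.im))⁻¹ ^ 2 := by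
      rw [← e, show -(2 * dist z UpperHalfPlane.I) = -dist z UpperHalfPlane.I + -dist z UpperHalfPlane.I
        by ring, Real.exp_add, ← sq, Real.exp_neg]
      gcongr
    rw [Pi.mul_apply, h3 z, ← ENNReal.ofReal_mul (by positivity)]
    apply ENNReal.ofReal_le_ofReal
    calc _ ≤ (1 / z.im) ^ 2 * ((1 + ‖(z : ℂ)‖ ^ 2) / (2 * z.im))⁻¹ ^ 2 := by gcongr
      _ = _ := by
        rw [show (-4 / 2 : ℝ) = -2 by norm_num, Real.rpow_neg (by positivity)]
        norm_cast
        field_simp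
        norm_num
  refine (lintegral_mono hle).trans ?_
  rw [← measurableEmbedding_coe.lintegral_map (f := fun z : ℂ => ENNReal.ofReal (4 * (1 + ‖z‖ ^ 2) ^ (-4 / 2 : ℝ))),
    measurableEmbedding_coe.map_comap]
  exact setLIntegral_le_lintegral _ _

/-- The sum of `exp(-2 d(z, i))` over an orbit is at most a multiple of the integral of the function
over `ℍ`, as the unit balls around the points of the orbit overlap boundedly. -/
theorem summable_inv_normSq_sq {Γ : Subgroup SL(2, ℝ)} [DiscreteTopology Γ] (g₁ g₂ : SL(2, ℝ)) :
    Summable fun γ : Γ => (normSq (g₁⁻¹ * γ * g₂) ^ 2)⁻¹ := by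
  have := countable_of_discrete (Γ := Γ)
  set f : ℍ → ℝ≥0∞ := fun z => ENNReal.ofReal (Real.exp (-(2 * dist z UpperHalfPlane.I))) with hf
  have hfm : Measurable f := by fun_prop
  set B := Metric.ball UpperHalfPlane.I 1 with hB
  set M : Γ → SL(2, ℝ) := fun γ => g₁⁻¹ * γ * g₂ with hM
  set F := {γ : Γ | normSq (g₂⁻¹ * γ * g₂) ≤ 2 * Real.cosh 2} with hF
  have hFfin : F.Finite := finite_normSq_le g₂ g₂ _
  -- a point lies in boundedly many of the translates of the ball
  have hmult : ∀ w : ℍ, ∑' γ : Γ, B.indicator 1 ((M γ)⁻¹ • w) ≤ (F.encard : ℝ≥0∞) := by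
    intro w
    have e : ∑' γ : Γ, B.indicator (1 : ℍ → ℝ≥0∞) ((M γ)⁻¹ • w) =
        ({γ : Γ | (M γ)⁻¹ • w ∈ B}.encard : ℝ≥0∞) := by
      rw [← ENNReal.tsum_set_one, tsum_subtype (f := fun _ => (1 : ℝ≥0∞))]
      rfl
    rw [e]
    rcases Set.eq_empty_or_nonempty {γ : Γ | (M γ)⁻¹ • w ∈ B} with h | ⟨γ', hγ'⟩
    · rw [h]; simp
    norm_cast
    refine encard_le_encard_of_injOn (f := fun γ => γ'⁻¹ * γ) ?_ (mul_right_injective _).injOn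
    intro γ hγ
    rw [mem_ofPred_eq, hB, Metric.mem_ball] at hγ hγ'
    rw [hF, mem_ofPred_eq, normSq_eq_cosh_dist]
    have e : g₂⁻¹ * ((γ'⁻¹ * γ : Γ) : SL(2, ℝ)) * g₂ = (M γ')⁻¹ * M γ := by
      simp only [hM, Subgroup.coe_mul, Subgroup.coe_inv]; group
    rw [e, mul_smul]
    have h1 : dist ((M γ')⁻¹ • M γ • UpperHalfPlane.I) UpperHalfPlane.I ≤ 2 := by
      calc _ ≤ dist ((M γ')⁻¹ • M γ • UpperHalfPlane.I) ((M γ')⁻¹ • w) +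
            dist ((M γ')⁻¹ • w) UpperHalfPlane.I := dist_triangle _ _ _
        _ = dist UpperHalfPlane.I ((M γ)⁻¹ • w) + dist ((M γ')⁻¹ • w) UpperHalfPlane.I := by
          rw [dist_smul, ← dist_smul (M γ)⁻¹ (M γ • UpperHalfPlane.I) w, inv_smul_smul]
        _ ≤ 2 := by rw [dist_comm UpperHalfPlane.I]; linarith
    have h2 : Real.cosh (dist ((M γ')⁻¹ • M γ • UpperHalfPlane.I) UpperHalfPlane.I) ≤ Real.cosh 2 := by
      rw [Real.cosh_le_cosh, abs_of_nonneg dist_nonneg, abs_of_pos two_pos]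
      exact h1
    linarith
  have hterm : ∀ γ : Γ, ENNReal.ofReal ((normSq (M γ) ^ 2)⁻¹) * (ENNReal.ofReal (Real.exp (-2)) *
      volume B) ≤ ∫⁻ w, B.indicator 1 ((M γ)⁻¹ • w) * f w := by
    intro γ
    rw [← (measurePreserving_smul (M γ) (volume : Measure ℍ)).lintegral_comp_emb
      (measurableEmbedding_const_smul _)]
    simp only [inv_smul_smul]
    rw [← mul_assoc, ← setLIntegral_const, ← lintegral_indicator Metric.isOpen_ball.measurableSet]
    refine lintegral_mono fun z => ?_
    by_cases hz : z ∈ B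
    · rw [indicator_of_mem hz, indicator_of_mem hz, Pi.one_apply, one_mul, hf,
        ← ENNReal.ofReal_mul (by positivity)]
      apply ENNReal.ofReal_le_ofReal
      have h1 : dist (M γ • z) UpperHalfPlane.I ≤ 1 + dist (M γ • UpperHalfPlane.I) UpperHalfPlane.I := by
        refine (dist_triangle _ (M γ • UpperHalfPlane.I) _).trans ?_
        rw [dist_smul]
        have := Metric.mem_ball.mp hz
        linarith
      set D := dist (M γ • UpperHalfPlane.I) UpperHalfPlane.I with hD
      have h2 : Real.exp D ≤ normSq (M γ) := by
        rw [normSq_eq_cosh_dist, Real.cosh_eq]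
        have := Real.exp_pos (-D)
        linarith
      calc (normSq (M γ) ^ 2)⁻¹ * Real.exp (-2) ≤ (Real.exp D ^ 2)⁻¹ * Real.exp (-2) := by gcongr
        _ = Real.exp (-(2 * (1 + D))) := by
          rw [← Real.exp_nat_mul, ← Real.exp_neg, ← Real.exp_add]; congr 1; push_cast; ring
        _ ≤ _ := Real.exp_le_exp.mpr (by linarith)
    · rw [indicator_of_notMem hz, indicator_of_notMem hz, zero_mul]
  have hsum : (∑' γ : Γ, ENNReal.ofReal ((normSq (M γ) ^ 2)⁻¹)) * (ENNReal.ofReal (Real.exp (-2)) *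
      volume B) < ⊤ := by
    rw [← ENNReal.tsum_mul_right]
    refine lt_of_le_of_lt (ENNReal.tsum_le_tsum hterm) ?_
    have hm : ∀ γ : Γ, AEMeasurable (fun w => B.indicator (1 : ℍ → ℝ≥0∞) ((M γ)⁻¹ • w) * f w) volume := by
      intro γ
      refine Measurable.aemeasurable (Measurable.mul ?_ hfm)
      exact (measurable_one.indicator Metric.isOpen_ball.measurableSet).comp (measurable_const_smul _)
    rw [← lintegral_tsum hm]
    simp_rw [ENNReal.tsum_mul_right]
    refine lt_of_le_of_lt (lintegral_mono fun w => mul_le_mul_left (hmult w) (f w)) ?_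
    rw [lintegral_const_mul _ hfm]
    exact ENNReal.mul_lt_top (by rw [hFfin.encard_eq_coe_toFinset_card]; simp) lintegral_exp_neg_dist_lt_top
  have hne : ENNReal.ofReal (Real.exp (-2)) * volume B ≠ 0 :=
    mul_ne_zero (ENNReal.ofReal_pos.mpr (Real.exp_pos _)).ne' (volume_ball_pos _).ne'
  have hfinal : ∑' γ : Γ, ENNReal.ofReal ((normSq (M γ) ^ 2)⁻¹) ≠ ⊤ := by
    intro h
    rw [h, ENNReal.top_mul hne] at hsum
    exact lt_irrefl _ hsum
  have := ENNReal.summable_toReal hfinal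
  refine this.congr fun γ => ?_
  rw [ENNReal.toReal_ofReal (by positivity)]

/-! ### The invariants of a double coset -/

/-- The quantity `ad + bc`; for the matrix of a double coset it is the parameter `q`. -/
def matQ (m : SL(2, ℝ)) : ℝ := m 0 0 * m 1 1 + m 0 1 * m 1 0

/-- The cross-ratio of the endpoints does not change under `g⁻¹`, which sends those of `c₁` to `0`
and `∞`. -/
theorem qParam_eq_matQ {g K : SL(2, ℝ)} (h1 : g 1 0 ≠ 0) (h2 : g 1 1 ≠ 0) (h3 : K 1 0 ≠ 0)
    (h4 : K 1 1 ≠ 0) (h5 : (g⁻¹ * K) 0 1 ≠ 0) (h6 : (g⁻¹ * K) 1 0 ≠ 0) :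
    qParam g K = matQ (g⁻¹ * K) := by
  have hdet := det_eq (g⁻¹ * K)
  have e00 : (g⁻¹ * K) 0 0 = g 1 1 * K 0 0 - g 0 1 * K 1 0 := by
    rw [mul_apply_eq, inv_00, inv_01]; ring
  have e01 : (g⁻¹ * K) 0 1 = g 1 1 * K 0 1 - g 0 1 * K 1 1 := by
    rw [mul_apply_eq, inv_00, inv_01]; ring
  have e10 : (g⁻¹ * K) 1 0 = g 0 0 * K 1 0 - g 1 0 * K 0 0 := by
    rw [mul_apply_eq, inv_10, inv_11]; ring
  have e11 : (g⁻¹ * K) 1 1 = g 0 0 * K 1 1 - g 1 0 * K 0 1 := by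
    rw [mul_apply_eq, inv_10, inv_11]; ring
  have f1 : forwardEnd K - backwardEnd g = (g⁻¹ * K) 0 0 / (K 1 0 * g 1 1) := by
    rw [e00, forwardEnd, backwardEnd]; field_simp
  have f2 : backwardEnd K - forwardEnd g = -(g⁻¹ * K) 1 1 / (K 1 1 * g 1 0) := by
    rw [e11, forwardEnd, backwardEnd]; field_simp; ring
  have f3 : forwardEnd K - forwardEnd g = -(g⁻¹ * K) 1 0 / (K 1 0 * g 1 0) := by
    rw [e10, forwardEnd, forwardEnd]; field_simp; ring
  have f4 : backwardEnd K - backwardEnd g = (g⁻¹ * K) 0 1 / (K 1 1 * g 1 1) := by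
    rw [e01, backwardEnd, backwardEnd]; field_simp
  have hr : crossRatio g K = (g⁻¹ * K) 0 0 * (g⁻¹ * K) 1 1 / ((g⁻¹ * K) 0 1 * (g⁻¹ * K) 1 0) := by
    rw [crossRatio, f1, f2, f3, f4]; field_simp
  rw [qParam, hr, matQ]
  set m := g⁻¹ * K
  have hbc : m 0 1 * m 1 0 ≠ 0 := mul_ne_zero h5 h6
  rw [div_add_one hbc, div_sub_one hbc, div_div_div_cancel_right₀ hbc, hdet, div_one]

/-- Multiplication by diagonal matrices, up to sign, does not change `ad`, `bc` and the sign of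
`b / d`. -/
theorem diagGroup_mul_mul {e f m : SL(2, ℝ)} (he : e ∈ diagGroup) (hf : f ∈ diagGroup) :
    matQ (e * m * f) = matQ m ∧
      (0 < (e * m * f) 0 1 / (e * m * f) 1 1 ↔ 0 < m 0 1 / m 1 1) := by
  have key : ∀ s t : ℝ, 0 < s → 0 < t → matQ (dMat s * m * dMat t) = matQ m ∧
      (0 < (dMat s * m * dMat t) 0 1 / (dMat s * m * dMat t) 1 1 ↔ 0 < m 0 1 / m 1 1) := by
    intro s t hs ht
    have e01 : (dMat s * m * dMat t) 0 1 / (dMat s * m * dMat t) 1 1 = s ^ 2 * (m 0 1 / m 1 1) := by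
      simp only [mul_apply_eq, dMat_00 hs.ne', dMat_01 hs.ne', dMat_10 hs.ne', dMat_11 hs.ne',
        dMat_01 ht.ne', dMat_11 ht.ne', zero_mul, mul_zero, add_zero, zero_add]
      field_simp
    refine ⟨?_, by rw [e01]; exact mul_pos_iff_of_pos_left (by positivity)⟩
    simp only [matQ, mul_apply_eq, dMat_00 hs.ne', dMat_01 hs.ne', dMat_10 hs.ne', dMat_11 hs.ne',
      dMat_00 ht.ne', dMat_10 ht.ne', dMat_01 ht.ne', dMat_11 ht.ne', zero_mul, mul_zero, add_zero,
      zero_add]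
    field_simp
  have hneg : ∀ M : SL(2, ℝ), matQ (-M) = matQ M ∧ (-M) 0 1 / (-M) 1 1 = M 0 1 / M 1 1 := by
    intro M
    simp only [matQ, neg_apply_eq]
    exact ⟨by ring, neg_div_neg_eq _ _⟩
  obtain ⟨s, hs, rfl | rfl⟩ := he <;> obtain ⟨t, ht, rfl | rfl⟩ := hf
  · exact key s t hs ht
  · rw [mul_neg, (hneg _).1, (hneg _).2]; exact key s t hs ht
  · rw [neg_mul, neg_mul, (hneg _).1, (hneg _).2]; exact key s t hs ht
  · rw [neg_mul, neg_mul, mul_neg, neg_neg]; exact key s t hs ht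

theorem inv_mul_revMat_mem {m : SL(2, ℝ)} (h : m * revMat ∈ diagGroup) :
    m⁻¹ * revMat ∈ diagGroup := by
  have hrev : revMat * revMat = -1 := by
    apply ext_entries <;> simp [mul_apply_eq, neg_apply_eq, revMat_00, revMat_01, revMat_10,
      revMat_11, one_00, one_01, one_10, one_11]
  have h2 := neg_mem_diagGroup (diagGroup.inv_mem (revMat_conj_mem h))
  have : -(revMat⁻¹ * (m * revMat) * revMat)⁻¹ = m⁻¹ * revMat := by
    rw [mul_assoc, mul_assoc, hrev, mul_neg, mul_one, mul_neg, inv_neg, neg_neg, mul_inv_rev, inv_inv]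
  rwa [this] at h2

section

variable {Γ : Subgroup SL(2, ℝ)} {g₁ g₂ : SL(2, ℝ)}

theorem AdmissibleCoset.exists_inv (x : AdmissibleCoset Γ g₁ g₂) :
    ∃ y : AdmissibleCoset Γ g₂ g₁,
      DoubleCoset.mk (stab Γ g₂) (stab Γ g₁) (Quotient.out x.1)⁻¹ = y.1 ∧
      ∃ e ∈ stab Γ g₂, ∃ f ∈ stab Γ g₁, (Quotient.out x.1)⁻¹ = e * Quotient.out y.1 * f := by
  obtain ⟨h1, h2⟩ := x.mat_notMem
  have e : g₂⁻¹ * ((Quotient.out x.1)⁻¹ : Γ) * g₁ = x.mat⁻¹ := by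
    simp only [AdmissibleCoset.mat, AdmissibleCoset.rep, Subgroup.coe_inv]; group
  refine AdmissibleCoset.exists_eq _ ?_ ?_ <;> rw [e]
  · exact fun h => h1 (by simpa using diagGroup.inv_mem h)
  · rw [inv_inv]
    exact fun h => h2 (inv_mul_revMat_mem h)

/-- The inverse of a double coset. -/
def AdmissibleCoset.inv (x : AdmissibleCoset Γ g₁ g₂) : AdmissibleCoset Γ g₂ g₁ :=
  x.exists_inv.choose

theorem AdmissibleCoset.inv_inv (x : AdmissibleCoset Γ g₁ g₂) : x.inv.inv = x := by
  obtain ⟨-, e, he, f, hf, h⟩ := x.exists_inv.choose_spec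
  have h2 := x.inv.exists_inv.choose_spec.1
  apply Subtype.ext
  change x.inv.exists_inv.choose.1 = x.1
  rw [← h2, ← DoubleCoset.out_eq' _ _ x.1, DoubleCoset.eq]
  refine ⟨f⁻¹, (stab Γ g₁).inv_mem hf, e⁻¹, (stab Γ g₂).inv_mem he, ?_⟩
  rw [← _root_.inv_inv (Quotient.out x.1), h]
  simp only [AdmissibleCoset.inv]; group

/-- Inversion of double cosets, as a bijection. -/
def AdmissibleCoset.invEquiv : AdmissibleCoset Γ g₁ g₂ ≃ AdmissibleCoset Γ g₂ g₁ :=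
  ⟨AdmissibleCoset.inv, AdmissibleCoset.inv, AdmissibleCoset.inv_inv, AdmissibleCoset.inv_inv⟩

theorem AdmissibleCoset.exists_mat_inv (x : AdmissibleCoset Γ g₁ g₂) :
    ∃ e ∈ diagGroup, ∃ f ∈ diagGroup, x.inv.mat = e * x.mat⁻¹ * f := by
  obtain ⟨-, e, he, f, hf, h⟩ := x.exists_inv.choose_spec
  refine ⟨_, diagGroup.inv_mem (mem_stab_iff.mp he), _, diagGroup.inv_mem (mem_stab_iff.mp hf), ?_⟩
  have h' : Quotient.out x.exists_inv.choose.1 = e⁻¹ * (Quotient.out x.1)⁻¹ * f⁻¹ :=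
    eq_mul_inv_iff_mul_eq.mpr (eq_inv_mul_iff_mul_eq.mpr ((mul_assoc _ _ _).symm.trans h.symm))
  simp only [AdmissibleCoset.mat, AdmissibleCoset.rep, AdmissibleCoset.inv, h', Subgroup.coe_mul,
    Subgroup.coe_inv]
  group

theorem AdmissibleCoset.matQ_inv (x : AdmissibleCoset Γ g₁ g₂) : matQ x.inv.mat = matQ x.mat := by
  obtain ⟨e, he, f, hf, h⟩ := x.exists_mat_inv
  rw [h, (diagGroup_mul_mul he hf).1]
  simp only [matQ, inv_00, inv_01, inv_10, inv_11]; ring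

/-- If the geodesics intersect, inversion changes the sign of the double coset. -/
theorem AdmissibleCoset.sign_inv (x : AdmissibleCoset Γ g₁ g₂) (h01 : x.mat 0 1 ≠ 0)
    (hq : |matQ x.mat| < 1) :
    0 < x.mat 0 1 / x.mat 1 1 ↔ ¬ 0 < x.inv.mat 0 1 / x.inv.mat 1 1 := by
  obtain ⟨e, he, f, hf, h⟩ := x.exists_mat_inv
  rw [h, (diagGroup_mul_mul he hf).2, inv_01, inv_11]
  have hdet := det_eq x.mat
  rw [abs_lt, matQ] at hq
  have had : 0 < x.mat 0 0 * x.mat 1 1 := by linarith [hq.1]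
  have ha : x.mat 0 0 ≠ 0 := left_ne_zero_of_mul had.ne'
  have hd : x.mat 1 1 ≠ 0 := right_ne_zero_of_mul had.ne'
  generalize x.mat 0 0 = a at *
  generalize x.mat 0 1 = b at *
  generalize x.mat 1 1 = d at *
  have key : -b / a = -(b / d) * (a * d / a ^ 2) := by field_simp
  rw [key, mul_pos_iff_of_pos_right (div_pos had (by positivity)), neg_pos, not_lt]
  have : b / d ≠ 0 := div_ne_zero h01 hd
  exact ⟨le_of_lt, fun h => lt_of_le_of_ne h this.symm⟩

end

/-! ### Summability over the double cosets -/

/-- Diagonal matrices from given cyclic groups balance the entries of a matrix, so that its size is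
controlled by the invariant `ad + bc`. -/
theorem exists_normSq_le {ε₁ ε₂ : ℝ} (h1 : 1 < ε₁) (h2 : 1 < ε₂) {m : SL(2, ℝ)} (h00 : m 0 0 ≠ 0)
    (h01 : m 0 1 ≠ 0) (h10 : m 1 0 ≠ 0) (h11 : m 1 1 ≠ 0) :
    ∃ n₁ n₂ : ℤ, normSq (dMat (ε₁ ^ n₁) * m * dMat (ε₂ ^ n₂)) ≤
      2 * (ε₁ * ε₂) ^ 2 * (1 + |matQ m|) := by
  have hdet := det_eq m
  have e10 : 0 < ε₁ := by linarith
  have e20 : 0 < ε₂ := by linarith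
  -- `λ⁴ ≈ |cd / ab|` and `μ⁴ ≈ |bd / ac|` make `aλμ ≈ d / λμ` and `bλ / μ ≈ cμ / λ`
  obtain ⟨n₁, hn1, hn1'⟩ := exists_mem_Ico_zpow
    (show 0 < |m 1 0 * m 1 1 / (m 0 0 * m 0 1)| from abs_pos.mpr (by positivity))
    (one_lt_pow₀ h1 (four_ne_zero))
  obtain ⟨n₂, hn2, hn2'⟩ := exists_mem_Ico_zpow
    (show 0 < |m 0 1 * m 1 1 / (m 0 0 * m 1 0)| from abs_pos.mpr (by positivity))
    (one_lt_pow₀ h2 (four_ne_zero))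
  refine ⟨n₁, n₂, ?_⟩
  have c1 : (ε₁ ^ 4) ^ n₁ = (ε₁ ^ n₁) ^ 4 := by
    rw [← zpow_natCast (ε₁ ^ n₁), ← zpow_natCast ε₁, zpow_comm]
  have c2 : (ε₂ ^ 4) ^ n₂ = (ε₂ ^ n₂) ^ 4 := by
    rw [← zpow_natCast (ε₂ ^ n₂), ← zpow_natCast ε₂, zpow_comm]
  rw [zpow_add_one₀ (by positivity), c1] at hn1'
  rw [zpow_add_one₀ (by positivity), c2] at hn2'
  rw [c1] at hn1
  rw [c2] at hn2
  have hl : 0 < ε₁ ^ n₁ := zpow_pos e10 _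
  have hm : 0 < ε₂ ^ n₂ := zpow_pos e20 _
  have hE1 : 1 ≤ (ε₁ * ε₂) ^ 2 := one_le_pow₀ (by nlinarith)
  simp only [normSq, mul_apply_eq, dMat_00 hl.ne', dMat_01 hl.ne', dMat_10 hl.ne', dMat_11 hl.ne',
    dMat_00 hm.ne', dMat_01 hm.ne', dMat_10 hm.ne', dMat_11 hm.ne', zero_mul, mul_zero, add_zero,
    zero_add]
  rw [matQ]
  generalize m 0 0 = a at *
  generalize m 0 1 = b at *
  generalize m 1 0 = c at *
  generalize m 1 1 = d at *
  generalize ε₁ ^ n₁ = l at *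
  generalize ε₂ ^ n₂ = k at *
  rw [abs_div, abs_mul, abs_mul] at hn1 hn1' hn2 hn2'
  have ha := abs_pos.mpr h00
  have hb := abs_pos.mpr h01
  have hc := abs_pos.mpr h10
  have hd := abs_pos.mpr h11
  rw [le_div_iff₀ (by positivity)] at hn1 hn2
  rw [div_lt_iff₀ (by positivity)] at hn1' hn2'
  have hsum : |a| * |d| + |b| * |c| ≤ 1 + |a * d + b * c| := by
    have q1 : a * d = (1 + (a * d + b * c)) / 2 := by linarith
    have q2 : b * c = ((a * d + b * c) - 1) / 2 := by linarith
    rw [← abs_mul, ← abs_mul]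
    rcases abs_cases (a * d) with ⟨h, _⟩ | ⟨h, _⟩ <;> rcases abs_cases (b * c) with ⟨h', _⟩ | ⟨h', _⟩ <;>
      rcases abs_cases (a * d + b * c) with ⟨h'', _⟩ | ⟨h'', _⟩ <;> rw [h, h', h''] <;> linarith
  set E := ε₁ * ε₂ with hE
  have hE0 : 0 < E := by positivity
  have hE1' : ε₁ ^ 2 ≤ E ^ 2 := by
    rw [hE]; exact pow_le_pow_left₀ e10.le (le_mul_of_one_le_right e10.le h2.le) 2
  have hE2' : ε₂ ^ 2 ≤ E ^ 2 := by
    rw [hE]; exact pow_le_pow_left₀ e20.le (le_mul_of_one_le_left e20.le h1.le) 2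
  have s1 : l ^ 2 * k ^ 2 * |a| ≤ |d| := by
    rw [← pow_le_pow_iff_left₀ (by positivity) (by positivity) two_ne_zero]
    have := mul_le_mul hn1 hn2 (by positivity) (by positivity)
    refine le_of_mul_le_mul_right ?_ (mul_pos hb hc)
    linarith
  have s2 : |d| ≤ l ^ 2 * k ^ 2 * |a| * E ^ 2 := by
    rw [← pow_le_pow_iff_left₀ (by positivity) (by positivity) two_ne_zero]
    have := mul_le_mul hn1'.le hn2'.le (by positivity) (by positivity)
    refine le_of_mul_le_mul_right ?_ (mul_pos hb hc)
    rw [hE]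
    linarith
  have s3 : l ^ 2 * |b| ≤ |c| * k ^ 2 * ε₂ ^ 2 := by
    rw [← pow_le_pow_iff_left₀ (by positivity) (by positivity) two_ne_zero]
    have := mul_le_mul hn1 hn2'.le (by positivity) (by positivity)
    refine le_of_mul_le_mul_right ?_ (mul_pos ha hd)
    linarith
  have s4 : k ^ 2 * |c| ≤ |b| * l ^ 2 * ε₁ ^ 2 := by
    rw [← pow_le_pow_iff_left₀ (by positivity) (by positivity) two_ne_zero]
    have := mul_le_mul hn2 hn1'.le (by positivity) (by positivity)
    refine le_of_mul_le_mul_right ?_ (mul_pos ha hd)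
    linarith
  have had : 0 < |a| * |d| := mul_pos ha hd
  have hbc : 0 < |b| * |c| := mul_pos hb hc
  have t1 : (l * a * k) ^ 2 ≤ E ^ 2 * (|a| * |d|) := by
    calc (l * a * k) ^ 2 = |a| * (l ^ 2 * k ^ 2 * |a|) := by
          rw [mul_pow, mul_pow, ← sq_abs a]; ring
      _ ≤ |a| * |d| := by gcongr
      _ ≤ _ := le_mul_of_one_le_left had.le hE1
  have t2 : (l⁻¹ * d * k⁻¹) ^ 2 ≤ E ^ 2 * (|a| * |d|) := by
    calc (l⁻¹ * d * k⁻¹) ^ 2 = |d| * |d| / (l ^ 2 * k ^ 2) := by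
          rw [mul_pow, mul_pow, ← sq_abs d]; field_simp
      _ ≤ |d| * (l ^ 2 * k ^ 2 * |a| * E ^ 2) / (l ^ 2 * k ^ 2) := by gcongr
      _ = _ := by field_simp
  have t3 : (l * b * k⁻¹) ^ 2 ≤ E ^ 2 * (|b| * |c|) := by
    calc (l * b * k⁻¹) ^ 2 = |b| * (l ^ 2 * |b|) / k ^ 2 := by
          rw [mul_pow, mul_pow, ← sq_abs b]; field_simp
      _ ≤ |b| * (|c| * k ^ 2 * ε₂ ^ 2) / k ^ 2 := by gcongr
      _ = ε₂ ^ 2 * (|b| * |c|) := by field_simp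
      _ ≤ _ := by gcongr
  have t4 : (l⁻¹ * c * k) ^ 2 ≤ E ^ 2 * (|b| * |c|) := by
    calc (l⁻¹ * c * k) ^ 2 = |c| * (k ^ 2 * |c|) / l ^ 2 := by
          rw [mul_pow, mul_pow, ← sq_abs c]; field_simp
      _ ≤ |c| * (|b| * l ^ 2 * ε₁ ^ 2) / l ^ 2 := by gcongr
      _ = ε₁ ^ 2 * (|b| * |c|) := by field_simp
      _ ≤ _ := by gcongr
  have := mul_le_mul_of_nonneg_left hsum (sq_nonneg E)
  linarith

section

variable {Γ : Subgroup SL(2, ℝ)} [DiscreteTopology Γ] {g₁ g₂ : SL(2, ℝ)}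

/-- By `exists_normSq_le` each double coset has a representative of size at most a multiple of `1 +
|q|`, and distinct double cosets have distinct representatives. -/
theorem AdmissibleCoset.summable_matQ (h1 : -1 ∈ Γ) (hg₁ : IsClosedGeodesic Γ g₁)
    (hg₂ : IsClosedGeodesic Γ g₂) :
    Summable fun x : AdmissibleCoset Γ g₁ g₂ => ((1 + |matQ x.mat|) ^ 2)⁻¹ := by
  obtain ⟨δ₁, -, hδ₁, hs₁, -⟩ := exists_generator h1 hg₁
  obtain ⟨δ₂, -, hδ₂, hs₂, -⟩ := exists_generator h1 hg₂
  have hε₁ := one_lt_epsilon h1 hg₁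
  have hε₂ := one_lt_epsilon h1 hg₂
  set E := epsilon Γ g₁ * epsilon Γ g₂ with hE
  have key : ∀ x : AdmissibleCoset Γ g₁ g₂, ∃ n₁ n₂ : ℤ,
      normSq (g₁⁻¹ * ((δ₁ ^ n₁ * Quotient.out x.1 * δ₂ ^ n₂ : Γ) : SL(2, ℝ)) * g₂) ≤
        2 * E ^ 2 * (1 + |matQ x.mat|) := by
    intro x
    obtain ⟨a, b, c, d⟩ := x.mat_ne_zero h1 hg₁ hg₂
    obtain ⟨n₁, n₂, h⟩ := exists_normSq_le hε₁ hε₂ a b c d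
    refine ⟨n₁, n₂, ?_⟩
    convert h using 2
    rw [Subgroup.coe_mul, Subgroup.coe_mul, hδ₁, hδ₂]
    simp only [AdmissibleCoset.mat, AdmissibleCoset.rep]; group
  choose n₁ n₂ hn using key
  set φ : AdmissibleCoset Γ g₁ g₂ → Γ := fun x => δ₁ ^ n₁ x * Quotient.out x.1 * δ₂ ^ n₂ x with hφ
  have hinj : Function.Injective φ := by
    intro x y h
    have hmk : ∀ x, DoubleCoset.mk (stab Γ g₁) (stab Γ g₂) (φ x) = x.1 := by
      intro x
      conv_rhs => rw [← DoubleCoset.out_eq' _ _ x.1]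
      rw [eq_comm, DoubleCoset.eq]
      exact ⟨_, hs₁ _, _, hs₂ _, rfl⟩
    apply Subtype.ext
    rw [← hmk x, ← hmk y, h]
  have hsum := ((summable_inv_normSq_sq (Γ := Γ) g₁ g₂).comp_injective hinj).mul_left ((2 * E ^ 2) ^ 2)
  refine Summable.of_nonneg_of_le (fun x => by positivity) (fun x => ?_) hsum
  have hpos : 0 < normSq (g₁⁻¹ * (φ x : SL(2, ℝ)) * g₂) := by
    rw [normSq_eq_cosh_dist]
    exact mul_pos two_pos (Real.cosh_pos _)
  have h := hn x
  simp only [Function.comp_apply]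
  rw [← div_eq_mul_inv, le_div_iff₀ (by positivity), inv_mul_le_iff₀ (by positivity), ← mul_pow,
    mul_comm (1 + _)]
  exact pow_le_pow_left₀ hpos.le h 2

end

/-! ### The density -/

theorem matQ_ne {m : SL(2, ℝ)} (h00 : m 0 0 ≠ 0) (h01 : m 0 1 ≠ 0) (h10 : m 1 0 ≠ 0)
    (h11 : m 1 1 ≠ 0) : matQ m ≠ 1 ∧ matQ m ≠ -1 := by
  have hdet := det_eq m
  rw [matQ]
  constructor
  · intro h
    exact mul_ne_zero h01 h10 (by linarith)
  · intro h
    exact mul_ne_zero h00 h11 (by linarith)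

section

variable {Γ : Subgroup SL(2, ℝ)} {g₁ g₂ : SL(2, ℝ)}

/-- The contribution of a double coset to the density. -/
def AdmissibleCoset.density (x : AdmissibleCoset Γ g₁ g₂) (α₁ α₂ w : ℝ) : ℝ :=
  termDensity (x.mat 0 1 / x.mat 1 1) (matQ x.mat) α₁ α₂ w

/-- The contribution of a pair of geodesics to the density. -/
def pairDensity (Γ : Subgroup SL(2, ℝ)) (g₁ g₂ : SL(2, ℝ)) (α₁ α₂ w : ℝ) : ℝ :=
  ∑' x : AdmissibleCoset Γ g₁ g₂, x.density α₁ α₂ w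

theorem pairDensity_nonneg (α₁ α₂ w : ℝ) : 0 ≤ pairDensity Γ g₁ g₂ α₁ α₂ w :=
  tsum_nonneg fun _ => termDensity_nonneg _ _

variable [DiscreteTopology Γ]

theorem AdmissibleCoset.matQ_ne_one (h1 : -1 ∈ Γ) (hg₁ : IsClosedGeodesic Γ g₁)
    (hg₂ : IsClosedGeodesic Γ g₂) (x : AdmissibleCoset Γ g₁ g₂) :
    matQ x.mat ≠ 1 ∧ matQ x.mat ≠ -1 := by
  obtain ⟨a, b, c, d⟩ := x.mat_ne_zero h1 hg₁ hg₂
  exact matQ_ne a b c d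

theorem AdmissibleCoset.q_eq (hcusp : HasCuspOfWidthOne Γ) (hg₁ : IsClosedGeodesic Γ g₁)
    (hg₂ : IsClosedGeodesic Γ g₂) (x : AdmissibleCoset Γ g₁ g₂) : x.q = matQ x.mat := by
  have h1 := neg_one_mem hcusp
  obtain ⟨-, b, c, -⟩ := x.mat_ne_zero h1 hg₁ hg₂
  have hK : IsClosedGeodesic Γ (x.rep * g₂) := hg₂.smul (Subtype.property (Quotient.out x.1 : Γ))
  rw [AdmissibleCoset.mat, mul_assoc] at b c ⊢
  exact qParam_eq_matQ (entry_10_ne_zero hcusp hg₁) (entry_11_ne_zero hcusp hg₁)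
    (entry_10_ne_zero hcusp hK) (entry_11_ne_zero hcusp hK) b c

variable {α₁ α₂ : ℝ}

theorem AdmissibleCoset.density_le (h1 : -1 ∈ Γ) (hg₁ : IsClosedGeodesic Γ g₁)
    (hg₂ : IsClosedGeodesic Γ g₂) (hα₁ : 1 ≤ α₁) (hα₂ : 1 ≤ α₂) (x : AdmissibleCoset Γ g₁ g₂) {V w : ℝ}
    (hw : |w| ≤ V) : ‖x.density α₁ α₂ w‖ ≤ termBound (matQ x.mat) V := by
  obtain ⟨hq1, hq2⟩ := x.matQ_ne_one h1 hg₁ hg₂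
  rw [AdmissibleCoset.density, Real.norm_of_nonneg (termDensity_nonneg _ _)]
  exact termDensity_le _ hα₁ hα₂ hq1 hq2 hw

theorem summable_density (h1 : -1 ∈ Γ) (hg₁ : IsClosedGeodesic Γ g₁)
    (hg₂ : IsClosedGeodesic Γ g₂) (hα₁ : 1 ≤ α₁) (hα₂ : 1 ≤ α₂) (w : ℝ) :
    Summable fun x : AdmissibleCoset Γ g₁ g₂ => x.density α₁ α₂ w :=
  Summable.of_norm_bounded
    (summable_termBound (AdmissibleCoset.summable_matQ h1 hg₁ hg₂) |w|)
    fun x => x.density_le h1 hg₁ hg₂ hα₁ hα₂ le_rfl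

/-- The series converges locally uniformly. -/
theorem continuous_pairDensity (h1 : -1 ∈ Γ) (hg₁ : IsClosedGeodesic Γ g₁)
    (hg₂ : IsClosedGeodesic Γ g₂) (hα₁ : 1 ≤ α₁) (hα₂ : 1 ≤ α₂) :
    Continuous (pairDensity Γ g₁ g₂ α₁ α₂) := by
  refine continuous_iff_continuousAt.mpr fun w => ?_
  have hc : ContinuousOn (pairDensity Γ g₁ g₂ α₁ α₂) {v | |v| < |w| + 1} :=
    continuousOn_tsum (fun x : AdmissibleCoset Γ g₁ g₂ =>
        (continuous_termDensity _ hα₁ hα₂ (x.matQ_ne_one h1 hg₁ hg₂).1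
          (x.matQ_ne_one h1 hg₁ hg₂).2).continuousOn)
      (summable_termBound (AdmissibleCoset.summable_matQ h1 hg₁ hg₂) (|w| + 1))
      fun x v hv => x.density_le h1 hg₁ hg₂ hα₁ hα₂ (le_of_lt hv)
  exact hc.continuousAt ((isOpen_lt continuous_abs continuous_const).mem_nhds (lt_add_one |w|))

/-- Reflection exchanges the two orders of a pair of geodesics, up to a symmetric term: the
contribution of the disjoint pairs is even, and the one of the intersecting pairs is
reflected by the inversion of double cosets. -/
theorem pairDensity_neg_add (h1 : -1 ∈ Γ) (hg₁ : IsClosedGeodesic Γ g₁)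
    (hg₂ : IsClosedGeodesic Γ g₂) (hα₁ : 1 ≤ α₁) (hα₂ : 1 ≤ α₂) (w : ℝ) :
    pairDensity Γ g₁ g₂ α₁ α₂ (-w) + pairDensity Γ g₂ g₁ α₁ α₂ (-w) =
      pairDensity Γ g₁ g₂ α₁ α₂ w + pairDensity Γ g₂ g₁ α₁ α₂ w := by
  have split : ∀ {g₁ g₂ : SL(2, ℝ)}, IsClosedGeodesic Γ g₁ → IsClosedGeodesic Γ g₂ → ∀ w,
      pairDensity Γ g₁ g₂ α₁ α₂ w =
        (∑' x : AdmissibleCoset Γ g₁ g₂, if 1 < |matQ x.mat| then x.density α₁ α₂ w else 0) +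
        ∑' x : AdmissibleCoset Γ g₁ g₂, if 1 < |matQ x.mat| then 0 else x.density α₁ α₂ w := by
    intro g₁ g₂ hg₁ hg₂ w
    have hs := summable_density h1 hg₁ hg₂ hα₁ hα₂ w
    rw [← Summable.tsum_add]
    · refine tsum_congr fun x => ?_
      split_ifs <;> simp
    · refine Summable.of_nonneg_of_le (fun x => ?_) (fun x => ?_) hs
      · split_ifs; exacts [termDensity_nonneg _ _, le_rfl]
      · split_ifs; exacts [le_rfl, termDensity_nonneg _ _]
    · refine Summable.of_nonneg_of_le (fun x => ?_) (fun x => ?_) hs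
      · split_ifs; exacts [le_rfl, termDensity_nonneg _ _]
      · split_ifs; exacts [termDensity_nonneg _ _, le_rfl]
  have even : ∀ {g₁ g₂ : SL(2, ℝ)},
      (∑' x : AdmissibleCoset Γ g₁ g₂, if 1 < |matQ x.mat| then x.density α₁ α₂ (-w) else 0) =
        ∑' x : AdmissibleCoset Γ g₁ g₂, if 1 < |matQ x.mat| then x.density α₁ α₂ w else 0 := by
    intro g₁ g₂
    refine tsum_congr fun x => ?_
    split_ifs with h
    · exact termDensity_neg_of_abs _ hα₁ hα₂ h w
    · rfl
  have refl : ∀ {g₁ g₂ : SL(2, ℝ)}, IsClosedGeodesic Γ g₁ → IsClosedGeodesic Γ g₂ →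
      (∑' x : AdmissibleCoset Γ g₁ g₂, if 1 < |matQ x.mat| then 0 else x.density α₁ α₂ (-w)) =
        ∑' x : AdmissibleCoset Γ g₂ g₁, if 1 < |matQ x.mat| then 0 else x.density α₁ α₂ w := by
    intro g₁ g₂ hg₁ hg₂
    refine Eq.trans ?_ (AdmissibleCoset.invEquiv.tsum_eq _)
    refine tsum_congr fun x => ?_
    change _ = if 1 < |matQ x.inv.mat| then 0 else x.inv.density α₁ α₂ w
    rw [x.matQ_inv]
    split_ifs with h
    · rfl
    · obtain ⟨hq1, hq2⟩ := x.matQ_ne_one h1 hg₁ hg₂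
      have hlt : |matQ x.mat| < 1 := by
        refine lt_of_le_of_ne (not_lt.mp h) fun h' => ?_
        rcases eq_or_eq_neg_of_abs_eq h' with h' | h'
        exacts [hq1 h', hq2 h']
      rw [AdmissibleCoset.density, AdmissibleCoset.density, x.matQ_inv]
      exact termDensity_neg_of_abs_lt (x.sign_inv (x.mat_ne_zero h1 hg₁ hg₂).2.1 hlt) hα₁ hα₂ hlt w
  rw [split hg₁ hg₂, split hg₂ hg₁, split hg₁ hg₂, split hg₂ hg₁, even, even, refl hg₁ hg₂,
    refl hg₂ hg₁]
  ring

theorem AdmissibleCoset.density_of_ne_zero (hcusp : HasCuspOfWidthOne Γ)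
    (hg₁ : IsClosedGeodesic Γ g₁) (hg₂ : IsClosedGeodesic Γ g₂) {w : ℝ} (hw : w ≠ 0)
    (x : AdmissibleCoset Γ g₁ g₂) : x.density α₁ α₂ w = x.term (w / α₁) (w / α₂) / w ^ 2 := by
  rw [AdmissibleCoset.density, termDensity, if_neg hw, AdmissibleCoset.term,
    x.q_eq hcusp hg₁ hg₂]
  rfl

theorem AdmissibleCoset.density_zero (hcusp : HasCuspOfWidthOne Γ)
    (hg₁ : IsClosedGeodesic Γ g₁) (hg₂ : IsClosedGeodesic Γ g₂) (α : ℝ)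
    (x : AdmissibleCoset Γ g₁ g₂) : x.density α α 0 = x.originTerm / α ^ 2 := by
  rw [AdmissibleCoset.density, termDensity, if_pos rfl, originValue_self, AdmissibleCoset.originTerm,
    x.q_eq hcusp hg₁ hg₂]

/-- The mass of the double cosets of a pair is the integral of the density of the pair. -/
theorem densityMass_eq (h1 : -1 ∈ Γ) (hg₁ : IsClosedGeodesic Γ g₁)
    (hg₂ : IsClosedGeodesic Γ g₂) (hα₁ : 1 ≤ α₁) (hα₂ : 1 ≤ α₂) {I : Set ℝ} (hI : MeasurableSet I)
    (hint : IntegrableOn (pairDensity Γ g₁ g₂ α₁ α₂) I) :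
    densityMass Γ g₁ g₂ α₁ α₂ I = ENNReal.ofReal (∫ w in I, pairDensity Γ g₁ g₂ α₁ α₂ w) := by
  have : Countable Γ := countable_of_discrete
  have : Countable (DoubleCoset.Quotient (stab Γ g₁ : Set Γ) (stab Γ g₂ : Set Γ)) :=
    Quotient.countable
  have : Countable (AdmissibleCoset Γ g₁ g₂) := Subtype.countable
  have hcont : ∀ x : AdmissibleCoset Γ g₁ g₂, Continuous (x.density α₁ α₂) := fun x =>
    continuous_termDensity _ hα₁ hα₂ (x.matQ_ne_one h1 hg₁ hg₂).1 (x.matQ_ne_one h1 hg₁ hg₂).2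
  rw [ofReal_integral_eq_lintegral_ofReal hint
    (Eventually.of_forall fun w => pairDensity_nonneg _ _ _)]
  have e : ∀ w, ENNReal.ofReal (pairDensity Γ g₁ g₂ α₁ α₂ w) =
      ∑' x : AdmissibleCoset Γ g₁ g₂, ENNReal.ofReal (x.density α₁ α₂ w) := fun w =>
    ENNReal.ofReal_tsum_of_nonneg (fun x => termDensity_nonneg _ _)
      (summable_density h1 hg₁ hg₂ hα₁ hα₂ w)
  simp_rw [e]
  rw [lintegral_tsum fun x => (hcont x).measurable.ennreal_ofReal.aemeasurable, densityMass]
  refine tsum_congr fun x => setLIntegral_congr_fun_ae hI ?_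
  have : ∀ᵐ w : ℝ, w ≠ 0 := by
    have := measure_singleton (μ := volume) (0 : ℝ)
    rwa [measure_eq_zero_iff_ae_notMem] at this
  filter_upwards [this] with w hw _
  rw [AdmissibleCoset.density, termDensity, if_neg hw, matQ]

end

/-! ### The intensity as an integral over the sections -/

theorem continuous_entry (i j : Fin 2) : Continuous fun u : SL(2, ℝ) => u i j := by fun_prop

theorem measurableSet_hasTopIn {I : Set ℝ} (hI : MeasurableSet I) (α : ℝ) (A B : SL(2, ℝ)) :
    MeasurableSet {u : SL(2, ℝ) | HasTopIn I α (u⁻¹ * A * B)} := by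
  have he : ∀ i j : Fin 2, Measurable fun u : SL(2, ℝ) => (u⁻¹ * A * B) i j := fun i j =>
    ((continuous_entry i j).comp (by fun_prop : Continuous fun u : SL(2, ℝ) => u⁻¹ * A * B)).measurable
  have hf : Measurable fun u : SL(2, ℝ) => forwardEnd (u⁻¹ * A * B) := (he 0 0).div (he 1 0)
  have hb : Measurable fun u : SL(2, ℝ) => backwardEnd (u⁻¹ * A * B) := (he 0 1).div (he 1 1)
  have h1 : MeasurableSet {u : SL(2, ℝ) | (u⁻¹ * A * B) 1 0 ≠ 0} :=
    (he 1 0) (measurableSet_singleton 0).compl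
  have h2 : MeasurableSet {u : SL(2, ℝ) | (u⁻¹ * A * B) 1 1 ≠ 0} :=
    (he 1 1) (measurableSet_singleton 0).compl
  have h3 : MeasurableSet {u : SL(2, ℝ) |
      (forwardEnd (u⁻¹ * A * B) + backwardEnd (u⁻¹ * A * B)) / 2 ∈ I} :=
    ((hf.add hb).div_const 2) hI
  have h4 : MeasurableSet {u : SL(2, ℝ) |
      α ≤ (forwardEnd (u⁻¹ * A * B) - backwardEnd (u⁻¹ * A * B)) / 2} :=
    measurableSet_le measurable_const ((hf.sub hb).div_const 2)
  exact h1.inter (h2.inter (h3.inter h4))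

theorem measurable_encard {Γ : Subgroup SL(2, ℝ)} [Countable Γ] (g₀ : SL(2, ℝ)) {I : Set ℝ}
    (hI : MeasurableSet I) {α : ℝ} (hα : 0 < α) :
    Measurable fun u => ((countSet Γ g₀ (strip I α) u).encard : ℝ≥0∞) := by
  have : Countable (Γ ⧸ stab Γ g₀) := Quotient.countable
  have e : (fun u => ((countSet Γ g₀ (strip I α) u).encard : ℝ≥0∞)) = fun u =>
      ∑' y : Γ ⧸ stab Γ g₀, {u : SL(2, ℝ) |
        HasTopIn I α (u⁻¹ * (Quotient.out y : Γ) * g₀)}.indicator 1 u := by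
    ext u
    rw [← ENNReal.tsum_set_one, tsum_subtype (f := fun _ => (1 : ℝ≥0∞))]
    refine tsum_congr fun y => ?_
    have key : y ∈ countSet Γ g₀ (strip I α) u ↔ HasTopIn I α (u⁻¹ * (Quotient.out y : Γ) * g₀) := by
      rw [← mem_countSet_iff hα, QuotientGroup.out_eq']
    by_cases h : HasTopIn I α (u⁻¹ * (Quotient.out y : Γ) * g₀)
    · rw [indicator_of_mem (key.mpr h), indicator_of_mem (by exact h)]; rfl
    · rw [indicator_of_notMem (fun h' => h (key.mp h')), indicator_of_notMem (by exact h)]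
  rw [e]
  exact Measurable.tsum fun y => measurable_one.indicator (measurableSet_hasTopIn hI _ _ _)

theorem continuousOn_aMat : ContinuousOn aMat (Ioi 0) := by
  have hind : Topology.IsInducing (fun A : SL(2, ℝ) => (A : Matrix (Fin 2) (Fin 2) ℝ)) :=
    Matrix.SpecialLinearGroup.isClosedEmbedding_val.isInducing
  rw [hind.continuousOn_iff]
  have hc : ContinuousOn (fun y : ℝ => !![√y, 0; 0, (√y)⁻¹]) (Ioi 0) := by
    refine continuousOn_pi.mpr fun i => continuousOn_pi.mpr fun j => ?_
    have h1 : ContinuousOn (fun y : ℝ => √y) (Ioi 0) := Real.continuous_sqrt.continuousOn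
    have h2 : ContinuousOn (fun y : ℝ => (√y)⁻¹) (Ioi 0) :=
      h1.inv₀ fun y hy => (Real.sqrt_pos.mpr hy).ne'
    fin_cases i <;> fin_cases j
    exacts [h1, continuousOn_const, continuousOn_const, h2]
  exact hc.congr fun y hy => dMat_val (Real.sqrt_pos.mpr hy).ne'

theorem aemeasurable_section (g : SL(2, ℝ)) (ε : ℝ) {α : ℝ} (hα : 0 < α) :
    AEMeasurable (fun p : ℝ × ℝ => g * aMat p.1 * kMat (-(Real.pi / 2)) * aMat p.2⁻¹)
      (paramMeasure ε α) := by
  have hS : MeasurableSet (Ico 1 (ε ^ 2) ×ˢ Ici α) := measurableSet_Ico.prod measurableSet_Ici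
  have hc : ContinuousOn (fun p : ℝ × ℝ => g * aMat p.1 * kMat (-(Real.pi / 2)) * aMat p.2⁻¹)
      (Ico 1 (ε ^ 2) ×ˢ Ici α) := by
    have h1 : ContinuousOn (fun p : ℝ × ℝ => aMat p.1) (Ico 1 (ε ^ 2) ×ˢ Ici α) :=
      continuousOn_aMat.comp continuousOn_fst fun p hp => by
        have := hp.1.1
        rw [mem_Ioi]; linarith
    have h2 : ContinuousOn (fun p : ℝ × ℝ => aMat p.2⁻¹) (Ico 1 (ε ^ 2) ×ˢ Ici α) := by
      have hpos : ∀ p ∈ Ico 1 (ε ^ 2) ×ˢ Ici α, (0 : ℝ) < p.2 := fun p hp => hα.trans_le hp.2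
      exact continuousOn_aMat.comp (continuousOn_snd.inv₀ fun p hp => (hpos p hp).ne')
        fun p hp => inv_pos.mpr (hpos p hp)
    exact ((continuousOn_const.mul h1).mul continuousOn_const).mul h2
  exact (hc.aemeasurable hS).mono_ac (withDensity_absolutelyContinuous _ _)

theorem intensity_eq {h : ℕ} {Γ : Subgroup SL(2, ℝ)} [Countable Γ] (g : Fin h → SL(2, ℝ))
    {α₁ α₂ : ℝ} (h1 : 0 < α₁) (h2 : 0 < α₂) {I : Set ℝ} (hI : MeasurableSet I) :
    intensity Γ g α₁ (strip I α₂) = ENNReal.ofReal ((kappa Γ g)⁻¹ * (1 / α₁)⁻¹) *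
      ∑ l, ENNReal.ofReal (1 / (2 * Real.pi * area Γ)) *
        ∑ l', ∫⁻ p, ((countSet Γ (g l') (strip I α₂)
          (g l * aMat p.1 * kMat (-(Real.pi / 2)) * aMat p.2⁻¹)).encard : ℝ≥0∞)
          ∂(paramMeasure (epsilon Γ (g l)) α₁) := by
  have hG : Measurable (countG Γ g (strip I α₂)) :=
    Finset.measurable_fun_sum _ fun l _ => measurable_encard (g l) hI h2
  have hQ : Measurable (count Γ g (strip I α₂)) := measurable_from_quotient.mpr hG
  rw [intensity, sectionProb, lintegral_smul_measure, smul_eq_mul, sectionMeasure,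
    lintegral_finsetSum_measure]
  congr 1
  refine Finset.sum_congr rfl fun l _ => ?_
  rw [lintegral_smul_measure, smul_eq_mul]
  congr 1
  have hs := aemeasurable_section (g l) (epsilon Γ (g l)) h1
  have hm : AEMeasurable (fun p : ℝ × ℝ =>
      (Quotient.mk'' (g l * aMat p.1 * kMat (-(Real.pi / 2)) * aMat p.2⁻¹) : QuotSpace Γ))
      (paramMeasure (epsilon Γ (g l)) α₁) := measurable_quotient_mk''.comp_aemeasurable hs
  rw [lintegral_map' hQ.aemeasurable hm]
  have hmeas : ∀ l', AEMeasurable (fun p : ℝ × ℝ => ((countSet Γ (g l') (strip I α₂)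
      (g l * aMat p.1 * kMat (-(Real.pi / 2)) * aMat p.2⁻¹)).encard : ℝ≥0∞))
      (paramMeasure (epsilon Γ (g l)) α₁) := fun l' =>
    (measurable_encard (Γ := Γ) (g l') hI h2).comp_aemeasurable hs
  exact lintegral_finsetSum' Finset.univ fun l' _ => hmeas l'

theorem area_pos {Γ : Subgroup SL(2, ℝ)} [Countable Γ] (hΓ : IsLattice Γ) : 0 < area Γ := by
  have hc : Countable (isometryGroup Γ) := by
    have : Function.Surjective ((MulAction.toPermHom SL(2, ℝ) ℍ).subgroupMap Γ) :=
      MonoidHom.subgroupMap_surjective _ _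
    exact this.countable
  have hinv : SMulInvariantMeasure (isometryGroup Γ) ℍ volume := by
    refine ⟨?_⟩
    rintro ⟨_, γ, -, rfl⟩ s hs
    exact measure_preimage_smul_of_nullMeasurableSet hs.nullMeasurableSet γ
  have hpos : covolume (isometryGroup Γ) ℍ ≠ 0 := by
    rw [covolume, dif_pos hΓ.hasFundamentalDomain]
    refine IsFundamentalDomain.measure_ne_zero ?_
      hΓ.hasFundamentalDomain.ExistsIsFundamentalDomain.choose_spec
    intro h
    have := volume_ball_pos UpperHalfPlane.I
    rw [h] at this
    simp at this
  exact ENNReal.toReal_pos hpos hΓ.covolume_lt_top.ne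

/-! ### The density of the process -/

/-- The density `W` of the intensity measure on the horizontal distance. -/
def density {h : ℕ} (Γ : Subgroup SL(2, ℝ)) (g : Fin h → SL(2, ℝ)) (α₁ α₂ w : ℝ) : ℝ :=
  α₁ / totalLength Γ g * ∑ l₁, ∑ l₂, pairDensity Γ (g l₁) (g l₂) α₁ α₂ w

section

variable {h : ℕ} {Γ : Subgroup SL(2, ℝ)} [DiscreteTopology Γ] {g : Fin h → SL(2, ℝ)}

theorem totalLength_pos (hh : 0 < h) (h1 : -1 ∈ Γ) (hclosed : ∀ l, IsClosedGeodesic Γ (g l)) :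
    0 < totalLength Γ g := by
  have : NeZero h := ⟨hh.ne'⟩
  exact mul_pos two_pos (Finset.sum_pos (fun l _ => Real.log_pos (one_lt_epsilon h1 (hclosed l)))
    Finset.univ_nonempty)

variable {α₁ α₂ : ℝ}

/-- The sum over both orders of each pair of geodesics makes the density even. -/
theorem density_neg (h1 : -1 ∈ Γ) (hclosed : ∀ l, IsClosedGeodesic Γ (g l)) (hα₁ : 1 ≤ α₁)
    (hα₂ : 1 ≤ α₂) (w : ℝ) : density Γ g α₁ α₂ (-w) = density Γ g α₁ α₂ w := by
  rw [density, density]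
  congr 1
  have key : ∀ w, 2 * ∑ l₁, ∑ l₂, pairDensity Γ (g l₁) (g l₂) α₁ α₂ w =
      ∑ l₁, ∑ l₂, (pairDensity Γ (g l₁) (g l₂) α₁ α₂ w + pairDensity Γ (g l₂) (g l₁) α₁ α₂ w) := by
    intro w
    simp only [Finset.sum_add_distrib]
    rw [Finset.sum_comm (f := fun l₁ l₂ => pairDensity Γ (g l₂) (g l₁) α₁ α₂ w)]
    ring
  have : 2 * ∑ l₁, ∑ l₂, pairDensity Γ (g l₁) (g l₂) α₁ α₂ (-w) =
      2 * ∑ l₁, ∑ l₂, pairDensity Γ (g l₁) (g l₂) α₁ α₂ w := by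
    rw [key, key]
    exact Finset.sum_congr rfl fun l₁ _ => Finset.sum_congr rfl fun l₂ _ =>
      pairDensity_neg_add h1 (hclosed l₁) (hclosed l₂) hα₁ hα₂ w
  linarith

theorem intensity_eq_ofReal (hh : 0 < h) (hΓ : IsLattice Γ) (h1 : -1 ∈ Γ)
    (hclosed : ∀ l, IsClosedGeodesic Γ (g l))
    (hineq : ∀ l l', l ≠ l' → ∀ γ ∈ Γ, ¬ SameGeodesic (γ * g l) (g l'))
    (hα₁ : 1 ≤ α₁) (hα₂ : 1 ≤ α₂) {I : Set ℝ} (hI : I.OrdConnected) (hb : Bornology.IsBounded I) :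
    intensity Γ g α₁ (strip I α₂) =
      ENNReal.ofReal (min 1 (α₁ / α₂) * I.indicator (fun _ => 1) 0 +
        ∫ v in I, density Γ g α₁ α₂ v) := by
  have : Countable Γ := countable_of_discrete
  have hIm : MeasurableSet I := hI.measurableSet
  have hlen := totalLength_pos hh h1 hclosed
  have harea := area_pos hΓ
  have hint : ∀ l l', IntegrableOn (pairDensity Γ (g l) (g l') α₁ α₂) I := by
    intro l l'
    obtain ⟨r, hr⟩ := hb.subset_closedBall 0
    rw [Real.closedBall_eq_Icc] at hr
    exact ((continuous_pairDensity h1 (hclosed l) (hclosed l') hα₁ hα₂).integrableOn_Icc).mono_set hr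
  set δ : ℝ := I.indicator (fun _ => 1) 0 with hδ
  have hδ0 : 0 ≤ δ := indicator_nonneg (fun _ _ => zero_le_one) _
  have hJ : ∀ l l', 0 ≤ ∫ w in I, pairDensity Γ (g l) (g l') α₁ α₂ w := fun l l' =>
    setIntegral_nonneg hIm fun w _ => pairDensity_nonneg _ _ _
  have hM : 0 < max α₁ α₂ := by linarith [le_max_left α₁ α₂]
  have hlog : ∀ l, 0 < Real.log (epsilon Γ (g l)) := fun l =>
    Real.log_pos (one_lt_epsilon h1 (hclosed l))
  -- only the lifts of a geodesic counted from its own section include the geodesic itself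
  have hpair : ∀ l, ∑ l', ∫⁻ p, ((countSet Γ (g l') (strip I α₂)
      (g l * aMat p.1 * kMat (-(Real.pi / 2)) * aMat p.2⁻¹)).encard : ℝ≥0∞)
        ∂(paramMeasure (epsilon Γ (g l)) α₁) =
      ENNReal.ofReal (2 * Real.log (epsilon Γ (g l)) * (1 / max α₁ α₂) * δ +
        ∑ l', ∫ w in I, pairDensity Γ (g l) (g l') α₁ α₂ w) := by
    intro l
    have hterm : ∀ l', ∫⁻ p, ((countSet Γ (g l') (strip I α₂)
        (g l * aMat p.1 * kMat (-(Real.pi / 2)) * aMat p.2⁻¹)).encard : ℝ≥0∞)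
          ∂(paramMeasure (epsilon Γ (g l)) α₁) =
        (if l' = l then ENNReal.ofReal (2 * Real.log (epsilon Γ (g l)) * (1 / max α₁ α₂) * δ)
          else 0) + ENNReal.ofReal (∫ w in I, pairDensity Γ (g l) (g l') α₁ α₂ w) := by
      intro l'
      rw [← densityMass_eq h1 (hclosed l) (hclosed l') hα₁ hα₂ hIm (hint l l')]
      split_ifs with hl
      · rw [hl]
        exact lintegral_encard_self h1 (hclosed l) hα₁ hα₂ hIm
      · rw [zero_add]
        exact lintegral_encard_of_ne h1 (hclosed l) (hclosed l') hα₁ hα₂ hIm (hineq l' l hl)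
    simp_rw [hterm]
    rw [Finset.sum_add_distrib, Finset.sum_ite_eq' Finset.univ l, if_pos (Finset.mem_univ l),
      ← ENNReal.ofReal_sum_of_nonneg fun l' _ => hJ l l', ← ENNReal.ofReal_add]
    · have := (hlog l).le; positivity
    · exact Finset.sum_nonneg fun l' _ => hJ l l'
  rw [intensity_eq g (by linarith) (by linarith) hIm]
  have hnn : ∀ l, 0 ≤ 2 * Real.log (epsilon Γ (g l)) * (1 / max α₁ α₂) * δ +
        ∑ l', ∫ w in I, pairDensity Γ (g l) (g l') α₁ α₂ w := fun l => by
    have := (hlog l).le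
    have := Finset.sum_nonneg fun l' (_ : l' ∈ Finset.univ) => hJ l l'
    positivity
  simp_rw [hpair]
  have hκ : 0 < kappa Γ g := div_pos hlen (by positivity)
  have hfac : 0 ≤ 1 / (2 * Real.pi * area Γ) := by positivity
  simp_rw [← ENNReal.ofReal_mul hfac]
  rw [← ENNReal.ofReal_sum_of_nonneg fun l _ => mul_nonneg hfac (hnn l), ← ENNReal.ofReal_mul
    (by positivity)]
  congr 1
  have hW : ∫ v in I, density Γ g α₁ α₂ v =
      α₁ / totalLength Γ g * ∑ l, ∑ l', ∫ w in I, pairDensity Γ (g l) (g l') α₁ α₂ w := by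
    simp only [density]
    rw [integral_const_mul, integral_finsetSum _ fun l _ => integrable_finsetSum _ fun l' _ => hint l l']
    congr 1
    exact Finset.sum_congr rfl fun l _ => integral_finsetSum _ fun l' _ => hint l l'
  rw [hW, ← Finset.mul_sum, Finset.sum_add_distrib]
  have hL : ∑ l, 2 * Real.log (epsilon Γ (g l)) * (1 / max α₁ α₂) * δ =
      totalLength Γ g * (1 / max α₁ α₂) * δ := by
    rw [totalLength, Finset.mul_sum, Finset.sum_mul, Finset.sum_mul]
  rw [hL, kappa]
  have hmin : min 1 (α₁ / α₂) = α₁ / max α₁ α₂ := by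
    rcases le_total α₁ α₂ with h | h
    · rw [max_eq_right h, min_eq_right ((div_le_one (by linarith)).mpr h)]
    · rw [max_eq_left h, div_self (by linarith), min_eq_left ((one_le_div (by linarith)).mpr h)]
  rw [hmin]
  have : α₁ ≠ 0 := by linarith
  field_simp

end

end GeodesicLines

end

theorem proposition3p9 {h : ℕ} (hh : 0 < h) (Γ : Subgroup SL(2, ℝ)) (hΓ : IsLattice Γ)
    (hcusp : HasCuspOfWidthOne Γ) (g : Fin h → SL(2, ℝ))
    (hpos : ∀ l, IsPositivelyOriented (g l)) (hclosed : ∀ l, IsClosedGeodesic Γ (g l))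
    (hineq : ∀ l l', l ≠ l' → ∀ γ ∈ Γ, ¬ SameGeodesic (γ * g l) (g l')) :
    (∀ α₁ α₂ : ℝ, 1 ≤ α₁ → 1 ≤ α₂ →
      ∃ W : ℝ → ℝ,
        Continuous W ∧ (∀ v, 0 ≤ W v) ∧ (∀ v, W (-v) = W v) ∧
        (∀ v, v ≠ 0 →
          (∀ l₁ l₂, Summable fun x : AdmissibleCoset Γ (g l₁) (g l₂) =>
            x.term (v / α₁) (v / α₂)) ∧
          W v = α₁ / (totalLength Γ g * v ^ 2) *
            ∑ l₁, ∑ l₂, ∑' x : AdmissibleCoset Γ (g l₁) (g l₂), x.term (v / α₁) (v / α₂)) ∧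
        (α₁ = α₂ →
          (∀ l₁ l₂, Summable fun x : AdmissibleCoset Γ (g l₁) (g l₂) => x.originTerm) ∧
          W 0 = 1 / (α₁ * totalLength Γ g) *
            ∑ l₁, ∑ l₂, ∑' x : AdmissibleCoset Γ (g l₁) (g l₂), x.originTerm) ∧
        (∀ I : Set ℝ, I.OrdConnected → Bornology.IsBounded I →
          intensity Γ g α₁ (strip I α₂) =
            ENNReal.ofReal (min 1 (α₁ / α₂) * I.indicator (fun _ => 1) 0 + ∫ v in I, W v))) ∧
    (∀ q v₁ v₂ : ℝ, q ≠ 1 → q ≠ -1 →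
      IntegrableOn (integrand q v₁ v₂) (Set.Ioo (-1) 1) ∧
      IntegrableOn (integrand q v₁ v₂) (Set.Iio (-1)) ∧
      IntegrableOn (integrand q v₁ v₂) (Set.Ioi 1)) ∧
    (∀ q v : ℝ, q ≠ 1 → q ≠ -1 →
      Hplus q v v =
        (if q < -1 then 0
        else if q < 1 then
          if v ≤ √(2 - 2 * q) then 0 else hFun q (s₁ q v) - hFun q (s₂ q v)
        else hFun q (s₁ q v) - hFun q (-q + √(q ^ 2 - 1))) ∧
      Hminus q v v =
        (if q < -1 then
          if |v| ≤ √(2 - 2 * q) then 0 else hFun q (s₁ q v) - hFun q (s₂ q v)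
        else if q < 1 then
          if v < -√(2 - 2 * q) then hFun q (s₁ q v) - hFun q (s₂ q v) else 0
        else hFun q (-q - √(q ^ 2 - 1)) - hFun q (s₂ q v))) := by
  have hdisc : DiscreteTopology Γ := hΓ.discrete
  have h1 := neg_one_mem hcusp
  refine ⟨fun α₁ α₂ hα₁ hα₂ => ⟨density Γ g α₁ α₂, ?_, fun v => ?_, density_neg h1 hclosed hα₁ hα₂,
    fun v hv => ⟨fun l₁ l₂ => ?_, ?_⟩, ?_, fun I hI hb =>
      intensity_eq_ofReal hh hΓ h1 hclosed hineq hα₁ hα₂ hI hb⟩,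
    fun q v₁ v₂ hq1 hq2 => ⟨integrableOn_integrand hq1 hq2 _, integrableOn_integrand hq1 hq2 _,
      integrableOn_integrand hq1 hq2 _⟩,
    fun q v hq1 hq2 => ⟨Hplus_self hq1 hq2, Hminus_self hq1 hq2⟩⟩
  · exact continuous_const.mul (continuous_finsetSum _ fun l₁ _ => continuous_finsetSum _ fun l₂ _ =>
      continuous_pairDensity h1 (hclosed l₁) (hclosed l₂) hα₁ hα₂)
  · exact mul_nonneg (div_nonneg (by linarith) (totalLength_pos hh h1 hclosed).le)
      (Finset.sum_nonneg fun l₁ _ => Finset.sum_nonneg fun l₂ _ => pairDensity_nonneg _ _ _)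
  · have := (summable_density h1 (hclosed l₁) (hclosed l₂) hα₁ hα₂ v).mul_right (v ^ 2)
    refine this.congr fun x => ?_
    rw [x.density_of_ne_zero hcusp (hclosed l₁) (hclosed l₂) hv]
    field_simp
  · have : ∀ l₁ l₂, pairDensity Γ (g l₁) (g l₂) α₁ α₂ v =
        (∑' x : AdmissibleCoset Γ (g l₁) (g l₂), x.term (v / α₁) (v / α₂)) / v ^ 2 := by
      intro l₁ l₂
      rw [← tsum_div_const]
      exact tsum_congr fun x => x.density_of_ne_zero hcusp (hclosed l₁) (hclosed l₂) hv
    simp only [density, this]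
    simp only [← Finset.sum_div]
    rw [div_mul_div_comm, ← div_mul_eq_mul_div]
  · rintro rfl
    refine ⟨fun l₁ l₂ => ?_, ?_⟩
    · have := (summable_density h1 (hclosed l₁) (hclosed l₂) hα₁ hα₂ 0).mul_right (α₁ ^ 2)
      refine this.congr fun x => ?_
      have : α₁ ≠ 0 := by linarith
      rw [x.density_zero hcusp (hclosed l₁) (hclosed l₂)]
      field_simp
    · have : ∀ l₁ l₂, pairDensity Γ (g l₁) (g l₂) α₁ α₁ 0 =
          (∑' x : AdmissibleCoset Γ (g l₁) (g l₂), x.originTerm) / α₁ ^ 2 := by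
        intro l₁ l₂
        rw [← tsum_div_const]
        exact tsum_congr fun x => x.density_zero hcusp (hclosed l₁) (hclosed l₂) α₁
      simp only [density, this]
      simp only [← Finset.sum_div]
      have h0 : α₁ ≠ 0 := by linarith
      have := (totalLength_pos hh h1 hclosed).ne'
      field_simp
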